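/- Let $N\ge 2$ and let $f_1,\dots,f_N$ be real polynomials in one variable of degree at most two. For $a\in\mathfrak F_N:=\{1,\dots,N\}$ let $L_a\subset\mathbb R^2$ be the line $y=f_a'(x)=t_ax+s_a$. Assume that $t_a\ne t_b$ for $a\ne b$ and that no three of the lines pass through one point. For $a\ne b$ let $v_{ab}=v_{ba}$ be the intersection point of $L_a$ and $L_b$. An $A_\infty$-category (over $\mathbb R$) consists of a set of objects, $\mathbb Z$-graded real vector spaces $\mathrm{Hom}(a,b)$, and multilinear maps $m_n:\mathrm{Hom}(a_1,a_2)\otimes\cdots\otimes\mathrm{Hom}(a_n,a_{n+1})\to\mathrm{Hom}(a_1,a_{n+1})$, $n\ge1$, of degree $2-n$ such that for homogeneous $w_1,\dots,w_n$ $$0=\sum_{k+l=n+1}\sum_{j=0}^{k-1}(-1)^{(j+1)(l+1)+l(|w_1|+\cdots+|w_j|)}\,m_k(w_1,\dots,w_j,m_l(w_{j+1},\dots,w_{j+l}),w_{j+l+1},\dots,w_n).$$ Its suspension has the degrees $|o|=|w|-1$ and the products $(-1)^{\sum_{i=1}^{n-1}(n-i)|o_i|}m_n$. An $A_\infty$-functor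 is a map $g$ on objects together with multilinear maps $g_k$, $k\ge1$, of degree $0$ on the suspensions, such that $\sum m_i(g_{k_1}\otimes\cdots\otimes g_{k_i})=\sum g_k(1^{\otimes i}\otimes m_l\otimes1^{\otimes j})$ for the suspended products, with the Koszul sign $(-1)^{|o_1|+\cdots+|o_i|}$ on the right. It is a homotopy equivalence if $g_1$ induces isomorphisms $H(\mathrm{Hom}(a,b))\to H(\mathrm{Hom}(g(a),g(b)))$ on the $m_1$-cohomology for all objects $a,b$. Let $\mathcal C_{DR}(\mathfrak F_N)$ be the DG category (an $A_\infty$-category with $m_n=0$ for $n\ge 3$) with set of objects $\mathfrak F_N$ and, for all $a,b$, $\mathrm{Hom}^0(a,b)=\mathcal S(\mathbb R)$, $\mathrm{Hom}^1(a,b)=\mathcal S(\mathbb R)\,dx$ (Schwartz functions and one-forms) and zero in the other degrees, with differential $d_{ab}=d-df_{ab}\wedge$, $f_{ab}=f_a-f_b$, and with the wedge product as composition. Finitely many pairwise distinct points $(v_1,\dots,v_n)$, not all on one line, are said to form a clockwise convex polygon if they are, in this cyclic order, the vertices of a convex polygon traversed clockwise, interior angles equal to $\pi$ being allowed; that is,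 for each $i$ (with $v_{n+1}=v_1$) no $v_j$ lies to the left of the oriented edge from $v_i$ to $v_{i+1}$. The area of the polygon is the area of its convex hull. Then there is an $A_\infty$-category $\mathcal C(\mathfrak F_N)$ with set of objects $\mathfrak F_N$ and with the following properties. (i) For $a\ne b$, the graded vector space $V_{ab}:=\mathrm{Hom}(a,b)$ is one-dimensional, with a chosen basis vector $[v_{ab}]$. It is concentrated in degree $0$ if $t_a<t_b$ and in degree $1$ if $t_a>t_b$. (ii) For $a\ne b$, $m_1=0$ on $V_{ab}$. For $k\ge2$ and pairwise distinct $a_1,\dots,a_{k+1}\in\mathfrak F_N$ put $\vec v=(v_{a_1a_2},\dots,v_{a_ka_{k+1}},v_{a_{k+1}a_1})$. If $\vec v$ forms a clockwise convex polygon, then $$m_k([v_{a_1a_2}],\dots,[v_{a_ka_{k+1}}])=\pm e^{-\mathrm{Area}(\vec v)}\,[v_{a_1a_{k+1}}]$$ for one of the two signs; otherwise $m_k([v_{a_1a_2}],\dots,[v_{a_ka_{k+1}}])=0$. (iii) $\mathcal C(\mathfrak F_N)$ is homotopy equivalent to $\mathcal C_{DR}(\mathfrak F_N)$: there is an $A_\infty$-functor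 $\mathcal C(\mathfrak F_N)\to\mathcal C_{DR}(\mathfrak F_N)$ which is the identity on objects and is a homotopy equivalence. -/

import Mathlib

open Polynomial SchwartzMap

namespace FukayaLines

universe u u' v v'

/-! ### Chains of composable homogeneous morphisms -/

/-- A chain `w₁ ⊗ ⋯ ⊗ wₙ` of composable homogeneous morphisms
`wᵢ ∈ H aᵢ aᵢ₊₁ dᵢ` (of degree `dᵢ`), going from `a₁` to `aₙ₊₁`. -/
inductive Chain {Obj : Type u} (H : Obj → Obj → ℤ → Type v) : Obj → Obj → Type (max u v)
  | nil (a : Obj) : Chain H a a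
  | cons {a b c : Obj} {n : ℤ} (w : H a b n) (p : Chain H b c) : Chain H a c

namespace Chain

variable {Obj : Type u} {H : Obj → Obj → ℤ → Type v}

/-- The number of morphisms in a chain (as an integer). -/
def length {a b : Obj} : Chain H a b → ℤ
  | nil _ => 0
  | cons _ p => p.length + 1

/-- The sum of the degrees of the morphisms in a chain. -/
def degree {a b : Obj} : Chain H a b → ℤ
  | nil _ => 0
  | cons (n := n) _ p => n + p.degree

/-- Concatenation of chains. -/
def append {a b c : Obj} : Chain H a b → Chain H b c → Chain H a c
  | nil _, q => q
  | cons w p, q => cons w (p.append q)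

/-- All ways of cutting a chain into an initial and a final (possibly empty) part. -/
def cutTwo {a b : Obj} : Chain H a b → List (Σ c : Obj, Chain H a c × Chain H c b)
  | nil a => [⟨a, nil a, nil a⟩]
  | cons w p => ⟨_, nil _, cons w p⟩ :: p.cutTwo.map fun t => ⟨t.1, cons w t.2.1, t.2.2⟩

/-- The exponent `∑_{i=1}^{n-1} (n - i) |oᵢ|` of the sign relating the product of the suspension to
the original one, where `|oᵢ| = |wᵢ| - 1` is the degree of `wᵢ` in the suspension. -/
def suspSign {a b : Obj} : Chain H a b → ℤ
  | nil _ => 0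
  | cons (n := n) _ p => p.length * (n - 1) + p.suspSign

end Chain

/-- A decomposition of a chain into three consecutive parts. -/
structure Cut {Obj : Type u} (H : Obj → Obj → ℤ → Type v) (a b : Obj) where
  {c : Obj}
  {d : Obj}
  left : Chain H a c
  mid : Chain H c d
  right : Chain H d b

/-- All ways of cutting a chain into three consecutive (possibly empty) parts. -/
def Chain.cuts {Obj : Type u} {H : Obj → Obj → ℤ → Type v} {a b : Obj} (w : Chain H a b) :
    List (Cut H a b) :=
  w.cutTwo.flatMap fun t => t.2.2.cutTwo.map fun s => ⟨t.2.1, s.2.1, s.2.2⟩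

/-! ### `A_∞`-categories -/

/-- An `A_∞`-category over `ℝ` with set of objects `Obj`: a `ℤ`-graded real vector space
`Hom a b` for every two objects and multilinear maps `mₙ`, `n ≥ 1`, of degree `2 - n` on chains of
`n` composable morphisms, such that
`∑ (-1)^{(j+1)(l+1) + l(|w₁|+⋯+|wⱼ|)} m_k(w₁,…,wⱼ, m_l(wⱼ₊₁,…,wⱼ₊ₗ), wⱼ₊ₗ₊₁,…,wₙ) = 0`.

All the `mₙ` are collected in one map `m` on chains; `m w r` is the component in degree `r` of
`mₙ(w₁,…,wₙ)`. There is no `m₀`: by convention `m` is zero on empty chains, so that decompositions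
whose middle part is empty do not contribute to the `A_∞`-relations. -/
structure AInfCategory (Obj : Type u) where
  Hom : Obj → Obj → ℤ → Type v
  [addCommGroup : ∀ a b n, AddCommGroup (Hom a b n)]
  [module : ∀ a b n, Module ℝ (Hom a b n)]
  m : ∀ {a b : Obj}, Chain Hom a b → ∀ r : ℤ, Hom a b r
  m_nil : ∀ (a : Obj) (r : ℤ), m (Chain.nil a) r = 0
  m_degree : ∀ {a b : Obj} (w : Chain Hom a b) (r : ℤ),
    r ≠ w.degree + (2 - w.length) → m w r = 0
  m_add : ∀ {a b c d : Obj} {n : ℤ} (p : Chain Hom a b) (x y : Hom b c n) (q : Chain Hom c d)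
    (r : ℤ), m (p.append (.cons (x + y) q)) r =
      m (p.append (.cons x q)) r + m (p.append (.cons y q)) r
  m_smul : ∀ {a b c d : Obj} {n : ℤ} (p : Chain Hom a b) (k : ℝ) (x : Hom b c n)
    (q : Chain Hom c d) (r : ℤ), m (p.append (.cons (k • x) q)) r = k • m (p.append (.cons x q)) r
  relation : ∀ {a b : Obj} (w : Chain Hom a b) (r : ℤ),
    (w.cuts.map fun t =>
      (-1 : ℝ) ^ ((t.left.length + 1) * (t.mid.length + 1) + t.mid.length * t.left.degree) •
        m (t.left.append (.cons (m t.mid (t.mid.degree + (2 - t.mid.length))) t.right)) r).sum = 0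

attribute [instance] AInfCategory.addCommGroup AInfCategory.module

namespace AInfCategory

variable {Obj : Type u} (C : AInfCategory.{u, v} Obj)

/-- The differential `m₁ : Hom a b n → Hom a b (n + 1)`. -/
def diff {a b : Obj} {n : ℤ} (x : C.Hom a b n) : C.Hom a b (n + 1) :=
  C.m (.cons x (.nil b)) (n + 1)

/-- The products of the suspension `s(C)`, written on the unsuspended morphisms. -/
noncomputable def mSusp {a b : Obj} (w : Chain C.Hom a b) (r : ℤ) : C.Hom a b r :=
  (-1 : ℝ) ^ w.suspSign • C.m w r

end AInfCategory

/-! ### `A_∞`-functors and homotopy equivalences -/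

section blocks

variable {Obj : Type u} {Obj' : Type u'} {H : Obj → Obj → ℤ → Type v}
  {H' : Obj' → Obj' → ℤ → Type v'} {f : Obj → Obj'}
  (g : ∀ {a b : Obj}, Chain H a b → ∀ r : ℤ, H' (f a) (f b) r)

/-- All chains `g(q₁) ⊗ ⋯ ⊗ g(qᵢ)`, where `q₁ ⊗ ⋯ ⊗ qᵢ` runs through the decompositions of
`acc ⊗ w` into consecutive nonempty parts whose first part contains the nonempty chain `acc`. Here
`g(q)` is taken in degree `|q| + 1 - length q`, that is, in the same degree as `q` after
suspension. -/
def blocksAux {a b c : Obj} (acc : Chain H a b) :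
    Chain H b c → List (Chain H' (f a) (f c))
  | .nil b => [.cons (g acc (acc.degree + (1 - acc.length))) (.nil (f b))]
  | .cons w p =>
    blocksAux (acc.append (.cons w (.nil _))) p ++
      (blocksAux (.cons w (.nil _)) p).map
        (.cons (g acc (acc.degree + (1 - acc.length))))

/-- All chains `g(q₁) ⊗ ⋯ ⊗ g(qᵢ)`, where `q₁ ⊗ ⋯ ⊗ qᵢ` runs through the decompositions of a
chain into consecutive nonempty parts. -/
def blocks {a c : Obj} : Chain H a c → List (Chain H' (f a) (f c))
  | .nil a => [.nil (f a)]
  | .cons w p => blocksAux g (.cons w (.nil _)) p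

end blocks

/-- An `A_∞`-functor `C → D`: a map on objects and multilinear maps `g_k`, `k ≥ 1`, on chains of
`k` composable morphisms, which preserve the degree after suspension and satisfy
`∑ m(g_{k₁} ⊗ ⋯ ⊗ g_{kᵢ}) = ∑ g(1^{⊗ i} ⊗ m_l ⊗ 1^{⊗ j})` on the suspensions. The second sum
carries the Koszul sign `(-1)^{|o₁| + ⋯ + |oᵢ|}`, `|oᵢ| = |wᵢ| - 1`. As for `m`, the component of
`g_k(w₁,…,w_k)` in degree `r` is `g w r`, and there is no `g₀`. -/
structure AInfFunctor {Obj : Type u} {Obj' : Type u'} (C : AInfCategory.{u, v} Obj)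
    (D : AInfCategory.{u', v'} Obj') where
  obj : Obj → Obj'
  g : ∀ {a b : Obj}, Chain C.Hom a b → ∀ r : ℤ, D.Hom (obj a) (obj b) r
  g_nil : ∀ (a : Obj) (r : ℤ), g (Chain.nil a) r = 0
  g_degree : ∀ {a b : Obj} (w : Chain C.Hom a b) (r : ℤ),
    r ≠ w.degree + (1 - w.length) → g w r = 0
  g_add : ∀ {a b c d : Obj} {n : ℤ} (p : Chain C.Hom a b) (x y : C.Hom b c n)
    (q : Chain C.Hom c d) (r : ℤ), g (p.append (.cons (x + y) q)) r =
      g (p.append (.cons x q)) r + g (p.append (.cons y q)) r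
  g_smul : ∀ {a b c d : Obj} {n : ℤ} (p : Chain C.Hom a b) (k : ℝ) (x : C.Hom b c n)
    (q : Chain C.Hom c d) (r : ℤ),
      g (p.append (.cons (k • x) q)) r = k • g (p.append (.cons x q)) r
  relation : ∀ {a b : Obj} (w : Chain C.Hom a b) (r : ℤ),
    ((blocks (H' := D.Hom) g w).map fun c => D.mSusp c r).sum =
      (w.cuts.map fun t => (-1 : ℝ) ^ (t.left.degree - t.left.length) •
        g (t.left.append
          (.cons (C.mSusp t.mid (t.mid.degree + (2 - t.mid.length))) t.right)) r).sum

namespace AInfFunctor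

variable {Obj : Type u} {Obj' : Type u'} {C : AInfCategory.{u, v} Obj}
  {D : AInfCategory.{u', v'} Obj'}

/-- The linear part `g₁`, in degree `n`. -/
def linearPart (G : AInfFunctor C D) {a b : Obj} {n : ℤ} (x : C.Hom a b n) :
    D.Hom (G.obj a) (G.obj b) n :=
  G.g (.cons x (.nil b)) n

/-- `G` is a homotopy equivalence: `g₁` induces an isomorphism between the cohomologies of
`Hom a b` and `Hom (G a) (G b)` for all objects `a`, `b`. The two parts say that the map induced
by `g₁` on the cohomology in degree `n + 1` is injective and surjective. -/
structure IsHomotopyEquivalence (G : AInfFunctor C D) : Prop where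
  injective : ∀ (a b : Obj) (n : ℤ) (x : C.Hom a b (n + 1)), C.diff x = 0 →
    (∃ y : D.Hom (G.obj a) (G.obj b) n, D.diff y = G.linearPart x) →
      ∃ z : C.Hom a b n, C.diff z = x
  surjective : ∀ (a b : Obj) (n : ℤ) (y : D.Hom (G.obj a) (G.obj b) (n + 1)), D.diff y = 0 →
    ∃ x : C.Hom a b (n + 1), C.diff x = 0 ∧
      ∃ z : D.Hom (G.obj a) (G.obj b) n, y = G.linearPart x + D.diff z

end AInfFunctor

/-! ### Configurations of lines -/

/-- Real polynomials `f₁, …, f_N` of degree at most two such that the lines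
`L_a : y = f_a'(x) = t_a x + s_a` have pairwise distinct slopes and no three of them (with
distinct labels) pass through one point. -/
structure LineConfig (N : ℕ) where
  f : Fin N → ℝ[X]
  natDegree_le : ∀ a, (f a).natDegree ≤ 2
  slope_ne : ∀ a b, a ≠ b → (f a).derivative.coeff 1 ≠ (f b).derivative.coeff 1
  no_three : ∀ a b c, a ≠ b → b ≠ c → a ≠ c → ¬ ∃ p : ℝ × ℝ,
    p.2 = (f a).derivative.eval p.1 ∧ p.2 = (f b).derivative.eval p.1 ∧
      p.2 = (f c).derivative.eval p.1

namespace LineConfig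

variable {N : ℕ} (F : LineConfig N)

/-- The slope `t_a`. -/
noncomputable def t (a : Fin N) : ℝ := (F.f a).derivative.coeff 1

/-- The intercept `s_a`. -/
noncomputable def s (a : Fin N) : ℝ := (F.f a).derivative.coeff 0

/-- The line `L_a`. -/
def line (a : Fin N) : Set (ℝ × ℝ) := {p | p.2 = (F.f a).derivative.eval p.1}

theorem eval_derivative (a : Fin N) (x : ℝ) :
    (F.f a).derivative.eval x = F.t a * x + F.s a := by
  have h : (F.f a).derivative.natDegree ≤ 1 :=
    (natDegree_derivative_le _).trans (by have := F.natDegree_le a; omega)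
  rw [eq_X_add_C_of_natDegree_le_one h]
  simp [t, s]

/-- The intersection point `v_{ab}` of `L_a` and `L_b` (for `a ≠ b`). -/
noncomputable def v (a b : Fin N) : ℝ × ℝ :=
  ((F.s b - F.s a) / (F.t a - F.t b),
    F.t a * ((F.s b - F.s a) / (F.t a - F.t b)) + F.s a)

theorem line_inter_line {a b : Fin N} (h : a ≠ b) : F.line a ∩ F.line b = {F.v a b} := by
  have h0 : F.t a - F.t b ≠ 0 := sub_ne_zero.2 (F.slope_ne a b h)
  ext ⟨x, y⟩
  simp only [line, Set.mem_inter_iff, Set.mem_ofPred_eq, eval_derivative, Set.mem_singleton_iff, v,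
    Prod.mk.injEq]
  constructor
  · rintro ⟨h1, h2⟩
    have hx : x = (F.s b - F.s a) / (F.t a - F.t b) := by
      rw [eq_div_iff h0]; linarith
    exact ⟨hx, hx ▸ h1⟩
  · rintro ⟨h1, h2⟩
    have hx : x * (F.t a - F.t b) = F.s b - F.s a := by rw [h1, div_mul_cancel₀ _ h0]
    rw [← h1] at h2
    exact ⟨h2, by linarith⟩

open Classical in
/-- The degree of `[v_{ab}]`, for `a ≠ b`. -/
noncomputable def deg (a b : Fin N) : ℤ := if F.t a < F.t b then 0 else 1

end LineConfig

/-! ### Clockwise convex polygons -/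

/-- Twice the signed area of the triangle `pqr`; negative if and only if `p`, `q`, `r` is a
clockwise triangle. -/
def cross (p q r : ℝ × ℝ) : ℝ :=
  (q.1 - p.1) * (r.2 - p.2) - (q.2 - p.2) * (r.1 - p.1)

/-- The points `P 0, P 1, …, P k` (pairwise distinct and not all on one line) are, in this cyclic
order, the vertices of a convex polygon traversed clockwise: the polygon lies on the right of each
of its edges. Angles equal to `π` are allowed. -/
structure IsClockwiseConvexPolygon {k : ℕ} (P : Fin (k + 1) → ℝ × ℝ) : Prop where
  injective : Function.Injective P
  right_of_edge : ∀ i j, cross (P i) (P (i + 1)) (P j) ≤ 0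
  not_collinear : ∃ i j l, cross (P i) (P j) (P l) ≠ 0

/-- The area of the convex polygon with vertices `P 0, …, P k`. -/
noncomputable def area {k : ℕ} (P : Fin (k + 1) → ℝ × ℝ) : ℝ :=
  MeasureTheory.volume.real (convexHull ℝ (Set.range P))

/-- The points `(v_{a₁a₂}, …, v_{a_k a_{k+1}}, v_{a_{k+1}a₁})`; the addition in `Fin (k + 1)` is
cyclic. -/
noncomputable def LineConfig.vertices {N : ℕ} (F : LineConfig N) {k : ℕ}
    (a : Fin (k + 1) → Fin N) : Fin (k + 1) → ℝ × ℝ :=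
  fun i => F.v (a i) (a (i + 1))

/-- The chain `e a₁ a₂ ⊗ e a₂ a₃ ⊗ ⋯ ⊗ e a_k a_{k+1}`. -/
def chainOf {Obj : Type u} {H : Obj → Obj → ℤ → Type v} {d : Obj → Obj → ℤ}
    (e : ∀ a b, H a b (d a b)) :
    ∀ {k : ℕ} (a : Fin (k + 1) → Obj), Chain H (a 0) (a (Fin.last k))
  | 0, a => .nil (a 0)
  | _ + 1, a => .cons (e (a 0) (a 1)) (chainOf e (Fin.tail a))

/-! ### The twisted de Rham DG category -/

/-- Rapidly decreasing differential forms of degree `n` on `ℝ`, written through their coefficient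
function: Schwartz functions `φ` in degree zero, forms `φ dx` with `φ` Schwartz in degree one, and
zero in all other degrees. -/
noncomputable def formSpace (n : ℤ) : Submodule ℝ 𝓢(ℝ, ℝ) := if n = 0 ∨ n = 1 then ⊤ else ⊥

/-- The form of degree `n` with coefficient function `φ` (zero if `n ≠ 0, 1`). -/
noncomputable def toForm (n : ℤ) : 𝓢(ℝ, ℝ) →ₗ[ℝ] formSpace n :=
  if h : n = 0 ∨ n = 1 then
    { toFun := fun φ => ⟨φ, by simp [formSpace, h]⟩
      map_add' := fun _ _ => rfl
      map_smul' := fun _ _ => rfl }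
  else 0

/-- The pointwise product of Schwartz functions. -/
noncomputable def mulS : 𝓢(ℝ, ℝ) →ₗ[ℝ] 𝓢(ℝ, ℝ) →L[ℝ] 𝓢(ℝ, ℝ) :=
  SchwartzMap.pairing (ContinuousLinearMap.mul ℝ ℝ)

/-- The map sending `φ` to the coefficient `φ' - f' φ` of `dφ - df ∧ φ`. -/
noncomputable def twistedDeriv (f : ℝ[X]) : 𝓢(ℝ, ℝ) →L[ℝ] 𝓢(ℝ, ℝ) :=
  SchwartzMap.derivCLM ℝ ℝ - SchwartzMap.smulLeftCLM ℝ (fun x => f.derivative.eval x)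

theorem mulS_apply (φ ψ : 𝓢(ℝ, ℝ)) (x : ℝ) : mulS φ ψ x = φ x * ψ x := by
  simp [mulS]

theorem hasTemperateGrowth_eval (p : ℝ[X]) :
    Function.HasTemperateGrowth (fun x : ℝ => p.eval x) := by
  have h : (fun x : ℝ => p.eval x) = fun x => ∑ i ∈ p.support, p.coeff i * x ^ i := by
    funext x; rw [eval_eq_sum, Polynomial.sum]
  rw [h]
  fun_prop

theorem twistedDeriv_apply (f : ℝ[X]) (φ : 𝓢(ℝ, ℝ)) (x : ℝ) :
    twistedDeriv f φ x = deriv φ x - f.derivative.eval x * φ x := by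
  simp [twistedDeriv, SchwartzMap.smulLeftCLM_apply_apply (hasTemperateGrowth_eval _)]

theorem mulS_assoc (φ ψ χ : 𝓢(ℝ, ℝ)) : mulS (mulS φ ψ) χ = mulS φ (mulS ψ χ) := by
  ext x
  simp only [mulS_apply, mul_assoc]

theorem twistedDeriv_mulS (f g h : ℝ[X]) (φ ψ : 𝓢(ℝ, ℝ)) :
    twistedDeriv (f - h) (mulS φ ψ) =
      mulS (twistedDeriv (f - g) φ) ψ + mulS φ (twistedDeriv (g - h) ψ) := by
  ext x
  have h1 : deriv (mulS φ ψ) x = deriv φ x * ψ x + φ x * deriv ψ x := by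
    have : (mulS φ ψ : ℝ → ℝ) = fun y => φ y * ψ y := funext (mulS_apply φ ψ)
    rw [this]
    exact deriv_fun_mul φ.differentiableAt ψ.differentiableAt
  simp only [add_apply, mulS_apply, twistedDeriv_apply, h1, derivative_sub, eval_sub]
  ring

theorem coe_toForm (n : ℤ) (φ : 𝓢(ℝ, ℝ)) :
    (toForm n φ : 𝓢(ℝ, ℝ)) = if n = 0 ∨ n = 1 then φ else 0 := by
  unfold toForm
  split_ifs <;> rfl

theorem form_eq_zero {n : ℤ} (h0 : n ≠ 0) (h1 : n ≠ 1) (w : formSpace n) :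
    w = 0 := by
  obtain ⟨w, hw⟩ := w
  ext1
  simpa [formSpace, h0, h1] using hw

theorem degree_cases {n : ℤ} (w : formSpace n) : n = 0 ∨ n = 1 ∨ w = 0 := by
  by_cases h0 : n = 0
  · exact .inl h0
  by_cases h1 : n = 1
  · exact .inr (.inl h1)
  · exact .inr (.inr (form_eq_zero h0 h1 w))

/-- The component in degree `r` of `dw - df ∧ w`, for a form `w` of degree `n`. -/
noncomputable def dForm (f : ℝ[X]) {n : ℤ} (w : formSpace n) (r : ℤ) : formSpace r :=
  if r = n + 1 then toForm r (twistedDeriv f w) else 0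

/-- The component in degree `r` of `w₁ ∧ w₂`, for forms of degrees `n₁`, `n₂`. -/
noncomputable def wedge {n₁ n₂ : ℤ} (w₁ : formSpace n₁) (w₂ : formSpace n₂) (r : ℤ) :
    formSpace r :=
  if r = n₁ + n₂ then toForm r (mulS w₁ w₂) else 0

theorem dForm_zero (f : ℝ[X]) (n r : ℤ) : dForm f (0 : formSpace n) r = 0 := by simp [dForm]

theorem wedge_zero {n₁ : ℤ} (w₁ : formSpace n₁) (n₂ r : ℤ) :
    wedge w₁ (0 : formSpace n₂) r = 0 := by simp [wedge]

theorem zero_wedge (n₁ : ℤ) {n₂ : ℤ} (w₂ : formSpace n₂) (r : ℤ) :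
    wedge (0 : formSpace n₁) w₂ r = 0 := by simp [wedge]

theorem coe_dForm (f : ℝ[X]) {n : ℤ} (w : formSpace n) (r : ℤ) :
    (dForm f w r : 𝓢(ℝ, ℝ)) =
      if r = n + 1 ∧ (r = 0 ∨ r = 1) then twistedDeriv f w else 0 := by
  unfold dForm
  by_cases h : r = n + 1 <;> simp [h, coe_toForm]

theorem coe_wedge {n₁ n₂ : ℤ} (w₁ : formSpace n₁) (w₂ : formSpace n₂) (r : ℤ) :
    (wedge w₁ w₂ r : 𝓢(ℝ, ℝ)) =
      if r = n₁ + n₂ ∧ (r = 0 ∨ r = 1) then mulS w₁ w₂ else 0 := by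
  unfold wedge
  by_cases h : r = n₁ + n₂ <;> simp [h, coe_toForm]

theorem dForm_dForm (f : ℝ[X]) {n : ℤ} (w : formSpace n) (s r : ℤ) :
    dForm f (dForm f w s) r = 0 := by
  ext1
  rcases degree_cases w with rfl | rfl | rfl
  · simp only [coe_dForm]
    split_ifs <;> first | (exfalso; omega) | simp
  · simp only [coe_dForm]
    split_ifs <;> first | (exfalso; omega) | simp
  · simp [dForm_zero]

theorem wedge_assoc {n₁ n₂ n₃ : ℤ} (x : formSpace n₁) (y : formSpace n₂) (z : formSpace n₃)
    {s s' : ℤ} (hs : s = n₁ + n₂) (hs' : s' = n₂ + n₃) (r : ℤ) :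
    wedge (wedge x y s) z r = wedge x (wedge y z s') r := by
  subst hs hs'
  ext1
  rcases degree_cases x with rfl | rfl | rfl
  all_goals rcases degree_cases y with rfl | rfl | rfl
  all_goals rcases degree_cases z with rfl | rfl | rfl
  all_goals try simp only [wedge_zero, zero_wedge]
  all_goals simp only [coe_wedge, true_and]
  all_goals split_ifs <;> first | (exfalso; omega) | simp [mulS_assoc]

theorem dForm_wedge (f g h : ℝ[X]) {n₁ n₂ : ℤ} (x : formSpace n₁) (y : formSpace n₂)
    {s s₁ s₂ : ℤ} (hs : s = n₁ + n₂) (hs₁ : s₁ = n₁ + 1) (hs₂ : s₂ = n₂ + 1) (r : ℤ) :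
    dForm (f - h) (wedge x y s) r =
      wedge (dForm (f - g) x s₁) y r + (-1 : ℝ) ^ n₁ • wedge x (dForm (g - h) y s₂) r := by
  subst hs hs₁ hs₂
  ext1
  rcases degree_cases x with rfl | rfl | rfl
  all_goals rcases degree_cases y with rfl | rfl | rfl
  all_goals try simp only [wedge_zero, zero_wedge, dForm_zero, smul_zero, add_zero]
  all_goals simp only [Submodule.coe_add, Submodule.coe_smul, coe_dForm, coe_wedge, true_and]
  all_goals split_ifs <;> first | (exfalso; omega) | simp [twistedDeriv_mulS f g h]

namespace DeRham

variable {N : ℕ} (F : LineConfig N)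

/-- The morphism spaces `Ω_{ab}` of the twisted de Rham DG category. -/
abbrev formHom (N : ℕ) : Fin N → Fin N → ℤ → Type := fun _ _ n => formSpace n

/-- The structure maps of the twisted de Rham DG category: the differential
`d_{ab} = d - df_{ab} ∧` with `f_{ab} = f_a - f_b` on chains of length one, the wedge product on
chains of length two, and zero on all other chains. -/
noncomputable def m {a b : Fin N} :
    Chain (formHom N) a b → ∀ r : ℤ, formSpace r
  | .cons w (.nil _), r => dForm (F.f a - F.f b) w r
  | .cons w₁ (.cons w₂ (.nil _)), r => wedge w₁ w₂ r
  | _, _ => 0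

theorem length_append {Obj : Type*} {H : Obj → Obj → ℤ → Type*} {a b c : Obj}
    (p : Chain H a b) (q : Chain H b c) : (p.append q).length = p.length + q.length := by
  induction p with
  | nil => simp [Chain.append, Chain.length]
  | cons w p ih => simp only [Chain.append, Chain.length, ih]; ring

theorem length_nonneg {Obj : Type*} {H : Obj → Obj → ℤ → Type*} {a b : Obj}
    (p : Chain H a b) : 0 ≤ p.length := by
  induction p with
  | nil => simp [Chain.length]
  | cons w p ih => simp only [Chain.length]; omega

theorem m_eq_zero {a b : Fin N} (w : Chain (formHom N) a b)
    (h : w.length ≠ 1) (h' : w.length ≠ 2) (r : ℤ) : m F w r = 0 := by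
  match w, r with
  | .nil _, _ => rfl
  | .cons _ (.nil _), _ => simp [Chain.length] at h
  | .cons _ (.cons _ (.nil _)), _ => simp [Chain.length] at h'
  | .cons _ (.cons _ (.cons _ _)), _ => rfl

theorem m_degree {a b : Fin N} (w : Chain (formHom N) a b) (r : ℤ)
    (h : r ≠ w.degree + (2 - w.length)) : m F w r = 0 := by
  match w, r with
  | .nil _, _ => rfl
  | .cons _ (.nil _), _ =>
    simp only [Chain.degree, Chain.length] at h
    exact if_neg (by omega)
  | .cons _ (.cons _ (.nil _)), _ =>
    simp only [Chain.degree, Chain.length] at h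
    exact if_neg (by omega)
  | .cons _ (.cons _ (.cons _ _)), _ => rfl

theorem m_add {a b c d : Fin N} {n : ℤ} (p : Chain (formHom N) a b)
    (x y : formSpace n) (q : Chain (formHom N) c d) (r : ℤ) :
    m F (p.append (.cons (b := c) (x + y) q)) r =
      m F (p.append (.cons x q)) r + m F (p.append (.cons y q)) r := by
  match p, q with
  | .nil _, .nil _ => simp only [Chain.append, m, dForm]; split_ifs <;> simp
  | .nil _, .cons _ (.nil _) => simp only [Chain.append, m, wedge]; split_ifs <;> simp
  | .cons _ (.nil _), .nil _ => simp only [Chain.append, m, wedge]; split_ifs <;> simp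
  | .nil _, .cons _ (.cons _ _) => simp [Chain.append, m]
  | .cons _ (.nil _), .cons _ _ => simp [Chain.append, m]
  | .cons _ (.cons _ p), q =>
    have := length_nonneg p
    have := length_nonneg q
    iterate 3 rw [m_eq_zero F _ (by simp only [length_append, Chain.length]; omega)
      (by simp only [length_append, Chain.length]; omega)]
    simp

theorem m_smul {a b c d : Fin N} {n : ℤ} (p : Chain (formHom N) a b)
    (k : ℝ) (x : formSpace n) (q : Chain (formHom N) c d) (r : ℤ) :
    m F (p.append (.cons (b := c) (k • x) q)) r = k • m F (p.append (.cons x q)) r := by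
  match p, q with
  | .nil _, .nil _ => simp only [Chain.append, m, dForm]; split_ifs <;> simp
  | .nil _, .cons _ (.nil _) => simp only [Chain.append, m, wedge]; split_ifs <;> simp
  | .cons _ (.nil _), .nil _ => simp only [Chain.append, m, wedge]; split_ifs <;> simp
  | .nil _, .cons _ (.cons _ _) => simp [Chain.append, m]
  | .cons _ (.nil _), .cons _ _ => simp [Chain.append, m]
  | .cons _ (.cons _ p), q =>
    have := length_nonneg p
    have := length_nonneg q
    iterate 2 rw [m_eq_zero F _ (by simp only [length_append, Chain.length]; omega)
      (by simp only [length_append, Chain.length]; omega)]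
    simp

theorem length_cutTwo {Obj : Type*} {H : Obj → Obj → ℤ → Type*} {a b : Obj} (w : Chain H a b) :
    ∀ t ∈ w.cutTwo, t.2.1.length + t.2.2.length = w.length := by
  induction w with
  | nil => simp [Chain.cutTwo, Chain.length]
  | cons w p ih =>
    intro t ht
    simp only [Chain.cutTwo, List.mem_cons, List.mem_map] at ht
    rcases ht with rfl | ⟨s, hs, rfl⟩
    · simp [Chain.length]
    · have := ih s hs
      simp only [Chain.length]
      omega

theorem length_cuts {Obj : Type*} {H : Obj → Obj → ℤ → Type*} {a b : Obj} (w : Chain H a b) :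
    ∀ t ∈ w.cuts, t.left.length + t.mid.length + t.right.length = w.length := by
  intro t ht
  simp only [Chain.cuts, List.mem_flatMap, List.mem_map] at ht
  obtain ⟨s, hs, u, hu, rfl⟩ := ht
  have h1 := length_cutTwo w s hs
  have h2 := length_cutTwo _ u hu
  simp only
  omega

theorem m_zero {a b c d : Fin N} {n : ℤ} (p : Chain (formHom N) a b)
    (x : formSpace n) (hx : x = 0) (q : Chain (formHom N) c d) (r : ℤ) :
    m F (p.append (.cons (b := c) x q)) r = 0 := by
  subst hx
  simpa using m_smul F p 0 (0 : formSpace n) q r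

/-- A single term of the `A_∞`-relations. -/
noncomputable def relTerm (r : ℤ) {a b : Fin N} (t : Cut (formHom N) a b) :
    formSpace r :=
  (-1 : ℝ) ^ ((t.left.length + 1) * (t.mid.length + 1) + t.mid.length * t.left.degree) •
    m F (t.left.append
      (.cons (m F t.mid (t.mid.degree + (2 - t.mid.length))) t.right)) r

theorem relTerm_of_length (r : ℤ) {a b : Fin N} (t : Cut (formHom N) a b)
    (h : t.mid.length ≠ 1) (h' : t.mid.length ≠ 2) : relTerm F r t = 0 := by
  rw [relTerm, m_zero F _ _ (m_eq_zero F _ h h' _), smul_zero]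

theorem signs_two {r : ℤ} (A B : formSpace r) {i j k n : ℤ} (hi : i = 2) (hj : j = 3)
    (hk : k = 4 + n) :
    0 + ((-1 : ℝ) ^ i • A + ((-1 : ℝ) ^ j • (A + (-1 : ℝ) ^ n • B) +
      (0 + ((-1 : ℝ) ^ k • B + (0 + 0))))) = 0 := by
  have h2 : (-1 : ℝ) ^ i = 1 := by rw [hi]; norm_num
  have h3 : (-1 : ℝ) ^ j = -1 := by rw [hj]; norm_num
  have h4 : (-1 : ℝ) ^ k = (-1 : ℝ) ^ n := by
    rw [hk, zpow_add₀ (by norm_num)]; norm_num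
  rw [h2, h3, h4]
  module

theorem signs_three {r : ℤ} (A : formSpace r) {j k n : ℤ} (x y z : ℝ) (hj : j = 3)
    (hk : k = 2 * n) :
    0 + (x • 0 + ((-1 : ℝ) ^ j • A + (0 + (0 + (y • 0 + ((-1 : ℝ) ^ k • A +
      (0 + (z • 0 + (0 + 0))))))))) = 0 := by
  have h3 : (-1 : ℝ) ^ j = -1 := by rw [hj]; norm_num
  have h4 : (-1 : ℝ) ^ k = 1 := by
    rw [hk, zpow_mul]; norm_num
  rw [h3, h4]
  module

theorem relation {a b : Fin N} (w : Chain (formHom N) a b) (r : ℤ) :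
    (w.cuts.map (relTerm F r)).sum = 0 := by
  match w with
  | .nil a =>
    change relTerm F r ⟨.nil a, .nil a, .nil a⟩ + 0 = 0
    rw [relTerm_of_length F r _ (by simp [Chain.length]) (by simp [Chain.length]), add_zero]
  | .cons (a := a) (b := b) (n := n) x (.nil _) =>
    change relTerm F r ⟨.nil a, .nil a, .cons x (.nil b)⟩ +
      (relTerm F r ⟨.nil a, .cons x (.nil b), .nil b⟩ +
      (relTerm F r ⟨.cons x (.nil b), .nil b, .nil b⟩ + 0)) = 0
    rw [relTerm_of_length F r ⟨.nil a, .nil a, _⟩ (by simp [Chain.length]) (by simp [Chain.length]),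
      relTerm_of_length F r ⟨_, .nil b, .nil b⟩ (by simp [Chain.length]) (by simp [Chain.length]),
      relTerm]
    simp only [Chain.append, m, dForm_dForm, smul_zero, add_zero]
  | .cons (a := a) (b := b) (n := n₁) x (.cons (c := c) (n := n₂) y (.nil _)) =>
    change relTerm F r ⟨.nil a, .nil a, .cons x (.cons y (.nil c))⟩ +
      (relTerm F r ⟨.nil a, .cons x (.nil b), .cons y (.nil c)⟩ +
      (relTerm F r ⟨.nil a, .cons x (.cons y (.nil c)), .nil c⟩ +
      (relTerm F r ⟨.cons x (.nil b), .nil b, .cons y (.nil c)⟩ +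
      (relTerm F r ⟨.cons x (.nil b), .cons y (.nil c), .nil c⟩ +
      (relTerm F r ⟨.cons x (.cons y (.nil c)), .nil c, .nil c⟩ + 0))))) = 0
    rw [relTerm_of_length F r ⟨.nil a, .nil a, _⟩ (by simp [Chain.length]) (by simp [Chain.length]),
      relTerm_of_length F r ⟨_, .nil b, _⟩ (by simp [Chain.length]) (by simp [Chain.length]),
      relTerm_of_length F r ⟨_, .nil c, _⟩ (by simp [Chain.length]) (by simp [Chain.length])]
    simp only [relTerm, Chain.append, m]
    rw [dForm_wedge (F.f a) (F.f b) (F.f c) x y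
      (s₁ := (Chain.cons (H := formHom N) x (.nil b)).degree +
        (2 - (Chain.cons (H := formHom N) x (.nil b)).length))
      (s₂ := (Chain.cons (H := formHom N) y (.nil c)).degree +
        (2 - (Chain.cons (H := formHom N) y (.nil c)).length))
      (by simp only [Chain.degree, Chain.length]; ring)
      (by simp only [Chain.degree, Chain.length]; ring)
      (by simp only [Chain.degree, Chain.length]; ring)]
    exact signs_two _ _ (by simp [Chain.length, Chain.degree])
      (by simp [Chain.length, Chain.degree]) (by simp only [Chain.length, Chain.degree]; ring)
  | .cons (a := a) (b := b) (n := n₁) x (.cons (b := c) (n := n₂) y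
      (.cons (b := d) (n := n₃) z (.nil _))) =>
    change relTerm F r ⟨.nil a, .nil a, .cons x (.cons y (.cons z (.nil d)))⟩ +
      (relTerm F r ⟨.nil a, .cons x (.nil b), .cons y (.cons z (.nil d))⟩ +
      (relTerm F r ⟨.nil a, .cons x (.cons y (.nil c)), .cons z (.nil d)⟩ +
      (relTerm F r ⟨.nil a, .cons x (.cons y (.cons z (.nil d))), .nil d⟩ +
      (relTerm F r ⟨.cons x (.nil b), .nil b, .cons y (.cons z (.nil d))⟩ +
      (relTerm F r ⟨.cons x (.nil b), .cons y (.nil c), .cons z (.nil d)⟩ +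
      (relTerm F r ⟨.cons x (.nil b), .cons y (.cons z (.nil d)), .nil d⟩ +
      (relTerm F r ⟨.cons x (.cons y (.nil c)), .nil c, .cons z (.nil d)⟩ +
      (relTerm F r ⟨.cons x (.cons y (.nil c)), .cons z (.nil d), .nil d⟩ +
      (relTerm F r ⟨.cons x (.cons y (.cons z (.nil d))), .nil d, .nil d⟩ + 0))))))))) = 0
    rw [relTerm_of_length F r ⟨.nil a, .nil a, _⟩ (by simp [Chain.length]) (by simp [Chain.length]),
      relTerm_of_length F r ⟨_, .nil b, _⟩ (by simp [Chain.length]) (by simp [Chain.length]),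
      relTerm_of_length F r ⟨_, .nil c, _⟩ (by simp [Chain.length]) (by simp [Chain.length]),
      relTerm_of_length F r ⟨_, .nil d, _⟩ (by simp [Chain.length]) (by simp [Chain.length]),
      relTerm_of_length F r ⟨_, .cons x (.cons y (.cons z (.nil d))), _⟩
        (by simp [Chain.length]) (by simp [Chain.length])]
    simp only [relTerm, Chain.append, m]
    rw [wedge_assoc x y z
      (s' := (Chain.cons (H := formHom N) y (.cons z (.nil d))).degree +
        (2 - (Chain.cons (H := formHom N) y (.cons z (.nil d))).length))
      (by simp only [Chain.degree, Chain.length]; ring)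
      (by simp only [Chain.degree, Chain.length]; ring)]
    exact signs_three _ (n := 3 + n₁) _ _ _ (by simp [Chain.length, Chain.degree])
      (by simp only [Chain.length, Chain.degree]; ring)
  | .cons w₁ (.cons w₂ (.cons w₃ (.cons w₄ q))) =>
    refine List.sum_eq_zero fun y hy => ?_
    obtain ⟨t, ht, rfl⟩ := List.mem_map.1 hy
    have hl := length_cuts _ t ht
    have := length_nonneg q
    simp only [Chain.length] at hl
    by_cases h : t.mid.length = 1 ∨ t.mid.length = 2
    · rw [relTerm, m_eq_zero F _ (by simp only [length_append, Chain.length]; omega)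
        (by simp only [length_append, Chain.length]; omega), smul_zero]
    · exact relTerm_of_length F r t (by tauto) (by tauto)

end DeRham

/-- The twisted de Rham DG category: the objects are the lines, the morphisms from `a` to `b` are
the rapidly decreasing differential forms on `ℝ`, the differential is `d - df_{ab} ∧` with
`f_{ab} = f_a - f_b`, and the composition is the wedge product. -/
noncomputable def deRham {N : ℕ} (F : LineConfig N) : AInfCategory.{0, 0} (Fin N) where
  Hom := DeRham.formHom N
  addCommGroup _ _ _ := inferInstance
  module _ _ _ := inferInstance
  m := DeRham.m F
  m_nil _ _ := rfl
  m_degree := DeRham.m_degree F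
  m_add := DeRham.m_add F
  m_smul := DeRham.m_smul F
  relation := fun w r => DeRham.relation F w r

end FukayaLines

/-! Twisting is conjugation: `d - df ∧ = e^f d e^{-f}`. If `t_a < t_b`, then `f_{ab}` is concave,
and the Gaussian `e^{f_{ab}}` is Schwartz and spans the cohomology, in degree 0. Otherwise
`e^{-f_{ab}}` is bounded (for `a = b` it is constant), the cohomology sits in degree 1, and `φ dx ↦
∫ e^{-f_{ab}} φ` identifies it with `ℝ`. Contracting homotopies are explicit. In the first case
`e^{-f} φ` is integrated from a base point; in the second a multiple of `e^f` times a bump function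
is subtracted and `e^{-f} φ` is integrated from `-∞`.

Homotopy transfer, written as a recursion on words of objects, then gives the minimal category and
the functor at once. The functor is `φ(w) = -h λ(w)` with `λ = ∑ ± φ φ` over all cuts of the word,
and the products are `μ = p λ`. The functor relation `d φ + λ = ins μ φ` (`d_phi_add_lam`) and the
`A_∞`-relations (`ins_mu_mu`) follow from associativity, the Leibniz rule and the homotopy identity.
This settles (i), (iii) and `m₁ = 0` for every choice of base points and bumps.

For (ii) the choices matter. The base point and the centre of the bump of the pair `p, q` are the
same number `y_{pq}`, a small perturbation of the first coordinate of `v_{pq}`; these numbers differ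
for different pairs, and the bumps have disjoint supports. Then, for pairwise distinct lines and
away from the bumps, `φ` is an exponential times `±1` or `0` (`Adapted.evaluates`). It is nonzero at
`z` exactly when the lines bound, in their order, a convex region open to one side, and the vertical
line through `z` meets this region beyond all of its vertices. The induction works because a
one-form part is carried only by words with one morphism: `λ` contains just the bumps of the first
and of the last pair, the homotopy turns a bump into a step function, and the steps encode how an
open region grows by one line at either end (`gt_and_right_last_iff`, `gt_and_right_first_iff`,
`exists_sign_jump`).

If the output has degree 1, `μ` is the sum of the two bump coefficients, which is a sign exactly
when the lines form an open region; the last intersection point closes it to a polygon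
(`isPolygon_iff_of_gt`). If the output has degree 0, `μ` is the value of `λ` at the base point, and
exactly one cut contributes when the vertical line there divides a polygon into a part open to the
right and a part open to the left (`isPolygon_iff_of_lt`, `sum_right_left`).

The exponent telescopes to minus the sum of the critical values of `f_{a_e} - f_{a_{e+1}}` over all
sides. This sum is invariant under cyclic shifts, so the rightmost vertex may be taken as the
closing one, and integrating the vertical slices of the polygon gives the same sum (`area_eq`). -/

namespace FukayaLines

/-! ### Rapidly decreasing solutions of first order linear equations -/

section Decay

open Filter Topology Set

/-- `u` decreases faster than any power of `x`. -/
def RapidDecay (u : ℝ → ℝ) : Prop := ∀ k : ℕ, ∃ C : ℝ, ∀ x, |x| ^ k * |u x| ≤ C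

theorem RapidDecay.add {u v : ℝ → ℝ} (hu : RapidDecay u) (hv : RapidDecay v) :
    RapidDecay fun x => u x + v x := by
  intro k
  obtain ⟨C, hC⟩ := hu k
  obtain ⟨D, hD⟩ := hv k
  refine ⟨C + D, fun x => ?_⟩
  calc |x| ^ k * |u x + v x| ≤ |x| ^ k * (|u x| + |v x|) := by gcongr; exact abs_add_le _ _
    _ ≤ C + D := by rw [mul_add]; exact add_le_add (hC x) (hD x)

theorem RapidDecay.const_mul {u : ℝ → ℝ} (hu : RapidDecay u) (c : ℝ) :
    RapidDecay fun x => c * u x := by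
  intro k
  obtain ⟨C, hC⟩ := hu k
  refine ⟨|c| * C, fun x => ?_⟩
  calc |x| ^ k * |c * u x| = |c| * (|x| ^ k * |u x|) := by rw [abs_mul]; ring
    _ ≤ |c| * C := by gcongr; exact hC x

theorem RapidDecay.id_mul {u : ℝ → ℝ} (hu : RapidDecay u) : RapidDecay fun x => x * u x := by
  intro k
  obtain ⟨C, hC⟩ := hu (k + 1)
  refine ⟨C, fun x => ?_⟩
  calc |x| ^ k * |x * u x| = |x| ^ (k + 1) * |u x| := by rw [abs_mul]; ring
    _ ≤ C := hC x

/-- `u` is `n` times differentiable, and all these derivatives decrease rapidly. -/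
def RapidDecayUpTo : ℕ → (ℝ → ℝ) → Prop
  | 0, u => RapidDecay u
  | n + 1, u => RapidDecay u ∧ ∃ u', (∀ x, HasDerivAt u (u' x) x) ∧ RapidDecayUpTo n u'

theorem RapidDecayUpTo.rapidDecay {n : ℕ} {u : ℝ → ℝ} (hu : RapidDecayUpTo n u) :
    RapidDecay u := by
  cases n with
  | zero => exact hu
  | succ n => exact hu.1

theorem RapidDecayUpTo.of_succ {n : ℕ} {u : ℝ → ℝ} (hu : RapidDecayUpTo (n + 1) u) :
    RapidDecayUpTo n u := by
  induction n generalizing u with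
  | zero => exact hu.1
  | succ n ih =>
    obtain ⟨h, u', hu', h'⟩ := hu
    exact ⟨h, u', hu', ih h'⟩

theorem RapidDecayUpTo.add {n : ℕ} {u v : ℝ → ℝ} (hu : RapidDecayUpTo n u)
    (hv : RapidDecayUpTo n v) : RapidDecayUpTo n fun x => u x + v x := by
  induction n generalizing u v with
  | zero => exact RapidDecay.add hu hv
  | succ n ih =>
    obtain ⟨h, u', hu', h'⟩ := hu
    obtain ⟨k, v', hv', k'⟩ := hv
    exact ⟨h.add k, _, fun x => (hu' x).add (hv' x), ih h' k'⟩

theorem RapidDecayUpTo.const_mul {n : ℕ} {u : ℝ → ℝ} (hu : RapidDecayUpTo n u) (c : ℝ) :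
    RapidDecayUpTo n fun x => c * u x := by
  induction n generalizing u with
  | zero => exact RapidDecay.const_mul hu c
  | succ n ih =>
    obtain ⟨h, u', hu', h'⟩ := hu
    exact ⟨h.const_mul c, _, fun x => (hu' x).const_mul c, ih h'⟩

theorem RapidDecayUpTo.id_mul {n : ℕ} {u : ℝ → ℝ} (hu : RapidDecayUpTo n u) :
    RapidDecayUpTo n fun x => x * u x := by
  induction n generalizing u with
  | zero => exact RapidDecay.id_mul hu
  | succ n ih =>
    have h0 := hu.of_succ
    obtain ⟨h, u', hu', h'⟩ := hu
    refine ⟨h.id_mul, fun x => u x + x * u' x, fun x => ?_, h0.add (ih h')⟩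
    convert! (hasDerivAt_id x).mul (hu' x) using 1
    simp

theorem rapidDecayUpTo_schwartz (n : ℕ) (φ : 𝓢(ℝ, ℝ)) : RapidDecayUpTo n φ := by
  have h0 : ∀ φ : 𝓢(ℝ, ℝ), RapidDecay φ := fun φ k => by
    obtain ⟨C, -, hC⟩ := φ.decay k 0
    exact ⟨C, fun x => by simpa using hC x⟩
  induction n generalizing φ with
  | zero => exact h0 φ
  | succ n ih =>
    refine ⟨h0 φ, SchwartzMap.derivCLM ℝ ℝ φ, fun x => ?_, ih _⟩
    simpa using φ.differentiableAt.hasDerivAt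

theorem RapidDecayUpTo.contDiff {n : ℕ} {u : ℝ → ℝ} (hu : RapidDecayUpTo (n + 1) u) :
    ContDiff ℝ n u := by
  induction n generalizing u with
  | zero =>
    obtain ⟨-, u', hu', -⟩ := hu
    exact contDiff_zero.2 (continuous_iff_continuousAt.2 fun x => (hu' x).continuousAt)
  | succ n ih =>
    obtain ⟨-, u', hu', h'⟩ := hu
    have : deriv u = u' := funext fun x => (hu' x).deriv
    push_cast
    refine contDiff_succ_iff_deriv.2 ⟨fun x => (hu' x).differentiableAt, by simp, ?_⟩
    rw [this]
    exact ih h'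

theorem RapidDecayUpTo.iteratedDeriv {n : ℕ} {u : ℝ → ℝ} (hu : RapidDecayUpTo n u) :
    RapidDecay (iteratedDeriv n u) := by
  induction n generalizing u with
  | zero => simpa using hu.rapidDecay
  | succ n ih =>
    obtain ⟨-, u', hu', h'⟩ := hu
    have : deriv u = u' := funext fun x => (hu' x).deriv
    rw [iteratedDeriv_succ', this]
    exact ih h'

/-- A function all whose derivatives decrease rapidly, as a Schwartz function. -/
noncomputable def schwartzOfRapidDecay (u : ℝ → ℝ) (hu : ∀ n, RapidDecayUpTo n u) : 𝓢(ℝ, ℝ) where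
  toFun := u
  smooth' := contDiff_infty.2 fun n => (hu (n + 1)).contDiff
  decay' k n := by
    obtain ⟨C, hC⟩ := (hu n).iteratedDeriv k
    refine ⟨C, fun x => ?_⟩
    rw [norm_iteratedFDeriv_eq_norm_iteratedDeriv]
    exact hC x

/-- Bootstrapping: the equation expresses `u'` through `x u`, `u` and `φ`, which already decay to
the order reached before. -/
theorem rapidDecayUpTo_of_ode {α β : ℝ} {u : ℝ → ℝ} (φ : 𝓢(ℝ, ℝ)) (h0 : RapidDecay u)
    (hu : ∀ x, HasDerivAt u ((α * x + β) * u x + φ x) x) (n : ℕ) : RapidDecayUpTo n u := by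
  induction n with
  | zero => exact h0
  | succ n ih =>
    refine ⟨h0, _, hu, ?_⟩
    have h1 := ((ih.id_mul.const_mul α).add (ih.const_mul β)).add (rapidDecayUpTo_schwartz n φ)
    convert! h1 using 2
    ring

/-- Bounds on two half lines and continuity give a global bound. -/
theorem rapidDecay_of_tails {u : ℝ → ℝ} (hc : Continuous u) {R : ℝ}
    (h1 : ∀ k : ℕ, ∃ C, ∀ x, R ≤ x → |x| ^ k * |u x| ≤ C)
    (h2 : ∀ k : ℕ, ∃ C, ∀ x, R ≤ x → |x| ^ k * |u (-x)| ≤ C) : RapidDecay u := by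
  intro k
  obtain ⟨C, hC⟩ := h1 k
  obtain ⟨D, hD⟩ := h2 k
  have hc' : ContinuousOn (fun x => |x| ^ k * |u x|) (Icc (-R) R) := by fun_prop
  obtain ⟨E, hE⟩ := isCompact_Icc.bddAbove_image hc'
  refine ⟨max C (max D E), fun x => ?_⟩
  by_cases hx : R ≤ x
  · exact (hC x hx).trans (le_max_left _ _)
  by_cases hx' : R ≤ -x
  · have := hD (-x) hx'
    rw [neg_neg, abs_neg] at this
    exact this.trans ((le_max_left _ _).trans (le_max_right _ _))
  · refine (hE ⟨x, ⟨by linarith, by linarith⟩, rfl⟩).trans ?_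
    exact (le_max_right _ _).trans (le_max_right _ _)

/-- The barrier argument: if `v' = f' v + ψ` with `f' ≤ -1` and `|ψ| ≤ M`, then `v` stays
bounded by `M` if it starts below `M`. -/
theorem le_of_ode {f f' v ψ : ℝ → ℝ} {R M : ℝ} (hf : ∀ x, HasDerivAt f (f' x) x)
    (hf' : ∀ x, R ≤ x → f' x ≤ -1) (hv : ∀ x, HasDerivAt v (f' x * v x + ψ x) x)
    (hψ : ∀ x, R ≤ x → ψ x ≤ M) (h0 : v R ≤ M) (hM : 0 ≤ M) (x : ℝ) (hx : R ≤ x) :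
    v x ≤ M := by
  -- With the integrating factor, `v - M` has derivative `e^{-f} (ψ + f' M)`, and `ψ + f' M ≤ M - M
  -- = 0`.
  have hd : ∀ y, HasDerivAt (fun y => Real.exp (-f y) * (v y - M))
      (Real.exp (-f y) * (ψ y + f' y * M)) y := fun y => by
    have := ((hf y).neg.exp).mul ((hv y).sub_const M)
    convert! this using 1
    simp only [Pi.neg_apply]
    ring
  have hanti : AntitoneOn (fun y => Real.exp (-f y) * (v y - M)) (Ici R) := by
    refine antitoneOn_of_deriv_nonpos (convex_Ici R)
      (fun y _ => (hd y).continuousAt.continuousWithinAt)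
      (fun y _ => (hd y).differentiableAt.differentiableWithinAt) fun y hy => ?_
    rw [interior_Ici] at hy
    have hy : R ≤ y := le_of_lt hy
    rw [(hd y).deriv]
    have h1 := hψ y hy
    have h2 := hf' y hy
    exact mul_nonpos_of_nonneg_of_nonpos (Real.exp_pos _).le (by nlinarith)
  have h1 := hanti (mem_Ici.2 le_rfl) (mem_Ici.2 hx) hx
  have h2 : Real.exp (-f R) * (v R - M) ≤ 0 :=
    mul_nonpos_of_nonneg_of_nonpos (Real.exp_pos _).le (by linarith)
  have h3 := h1.trans h2
  have := nonpos_of_mul_nonpos_right h3 (Real.exp_pos _)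
  linarith

theorem bound_of_ode {f f' v ψ : ℝ → ℝ} {R M : ℝ} (hf : ∀ x, HasDerivAt f (f' x) x)
    (hf' : ∀ x, R ≤ x → f' x ≤ -1) (hv : ∀ x, HasDerivAt v (f' x * v x + ψ x) x)
    (hψ : ∀ x, R ≤ x → |ψ x| ≤ M) (h0 : |v R| ≤ M) (x : ℝ) (hx : R ≤ x) : |v x| ≤ M := by
  have hM : 0 ≤ M := (abs_nonneg _).trans h0
  refine abs_le.2 ⟨?_, le_of_ode hf hf' hv (fun y hy => (le_abs_self _).trans (hψ y hy))
    ((le_abs_self _).trans h0) hM x hx⟩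
  have := le_of_ode (v := fun y => -v y) (ψ := fun y => -ψ y) hf hf'
    (fun y => by convert! (hv y).neg using 1; ring)
    (fun y hy => (neg_le_abs _).trans (hψ y hy)) ((neg_le_abs _).trans h0) hM x hx
  linarith

/-- Decay towards `+∞` of solutions of `u' = f' u + φ` for `f → -∞`. -/
theorem tail_of_ode_neg {f f' u φ : ℝ → ℝ} {R : ℝ} (hf : ∀ x, HasDerivAt f (f' x) x)
    (hf' : ∀ x, R ≤ x → f' x ≤ -1) (hu : ∀ x, HasDerivAt u (f' x * u x + φ x) x)
    (hφ : RapidDecay φ) (k : ℕ) : ∃ C, ∀ x, R ≤ x → |x| ^ k * |u x| ≤ C := by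
  induction k with
  | zero =>
    obtain ⟨C, hC⟩ := hφ 0
    refine ⟨max C |u R|, fun x hx => ?_⟩
    simp only [pow_zero, one_mul] at hC ⊢
    exact bound_of_ode hf hf' hu (fun y _ => (hC y).trans (le_max_left _ _))
      (le_max_right _ _) x hx
  | succ k ih =>
    obtain ⟨D, hD⟩ := ih
    obtain ⟨C, hC⟩ := hφ (k + 1)
    refine ⟨max (((k : ℝ) + 1) * D + C) |R ^ (k + 1) * u R|, fun x hx => ?_⟩
    rw [← abs_pow, ← abs_mul]
    -- `x^{k+1} u` solves an equation of the same kind; the new source term `(k + 1) x^k u` is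
    -- bounded by the induction hypothesis.
    refine bound_of_ode (v := fun x => x ^ (k + 1) * u x)
      (ψ := fun x => ((k : ℝ) + 1) * (x ^ k * u x) + x ^ (k + 1) * φ x) hf hf' (fun y => ?_)
      (fun y hy => ?_) (le_max_right _ _) x hx
    · have := (hasDerivAt_pow (k + 1) y).mul (hu y)
      convert! this using 1
      push_cast
      ring
    · refine le_trans ((abs_add_le _ _).trans ?_) (le_max_left _ _)
      have h1 := hD y hy
      have h2 := hC y
      rw [← abs_pow, ← abs_mul] at h1 h2
      rw [abs_mul, abs_of_nonneg (by positivity : (0 : ℝ) ≤ k + 1)]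
      gcongr

/-- Decay towards `+∞` of the solution of `u' = f' u + φ` for increasing `f`. -/
theorem le_of_ode_pos {f f' u φ : ℝ → ℝ} {R : ℝ} (hf : ∀ x, HasDerivAt f (f' x) x)
    (hR : 1 ≤ R) (hf' : ∀ x, R ≤ x → 0 ≤ f' x)
    (hu : ∀ x, HasDerivAt u (f' x * u x + φ x) x)
    (hlim : Tendsto (fun x => Real.exp (-f x) * u x) atTop (𝓝 0)) (k : ℕ) {C : ℝ} (hC0 : 0 ≤ C)
    (hC : ∀ x, |x| ^ (k + 2) * |φ x| ≤ C) (x : ℝ) (hx : R ≤ x) :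
    u x ≤ C * (x ^ (k + 1))⁻¹ := by
  -- `C y^{-(k+1)}` is a barrier: since `φ ≥ -C y^{-(k+2)}`, the function `e^{-f} (u - C
  -- y^{-(k+1)})` increases, and it tends to zero, so it is never positive.
  have hd : ∀ y, R ≤ y → HasDerivAt (fun y => Real.exp (-f y) * (u y - C * (y ^ (k + 1))⁻¹))
      (Real.exp (-f y) * (φ y + f' y * (C * (y ^ (k + 1))⁻¹) +
        (k + 1) * (C * (y ^ (k + 2))⁻¹))) y := fun y hy => by
    have hy0 : y ≠ 0 := by linarith
    have h1 := (hasDerivAt_pow (k + 1) y).inv (pow_ne_zero _ hy0)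
    have := ((hf y).neg.exp).mul ((hu y).sub (h1.const_mul C))
    convert! this using 1
    simp only [Pi.neg_apply, Pi.inv_apply, Pi.sub_apply]
    push_cast
    field_simp
    ring
  have hmono : MonotoneOn (fun y => Real.exp (-f y) * (u y - C * (y ^ (k + 1))⁻¹)) (Ici R) := by
    refine monotoneOn_of_deriv_nonneg (convex_Ici R)
      (fun y hy => (hd y hy).continuousAt.continuousWithinAt)
      (fun y hy => (hd y (interior_subset hy)).differentiableAt.differentiableWithinAt)
      fun y hy => ?_
    have hy : R ≤ y := interior_subset hy
    have hy0 : 0 < y := by linarith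
    rw [(hd y hy).deriv]
    have h1 := hC y
    have h2 := hf' y hy
    rw [abs_of_pos hy0] at h1
    have h3 : -φ y ≤ C * (y ^ (k + 2))⁻¹ := by
      refine (neg_le_abs _).trans ?_
      rw [← div_eq_mul_inv, le_div_iff₀ (by positivity)]
      linarith
    have h4 : 0 ≤ (k : ℝ) * (C * (y ^ (k + 2))⁻¹) := by positivity
    have h5 : 0 ≤ f' y * (C * (y ^ (k + 1))⁻¹) := by positivity
    exact mul_nonneg (Real.exp_pos _).le (by linarith)
  have hlim2 : Tendsto (fun y => Real.exp (-f y) * (C * (y ^ (k + 1))⁻¹)) atTop (𝓝 0) := by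
    have h1 : Tendsto (fun y : ℝ => C * (y ^ (k + 1))⁻¹) atTop (𝓝 0) := by
      simpa using ((tendsto_pow_atTop (α := ℝ) (Nat.succ_ne_zero k)).inv_tendsto_atTop).const_mul C
    have hfm : MonotoneOn f (Ici R) := by
      refine monotoneOn_of_deriv_nonneg (convex_Ici R)
        (fun y _ => (hf y).continuousAt.continuousWithinAt)
        (fun y _ => (hf y).differentiableAt.differentiableWithinAt) fun y hy => ?_
      rw [(hf y).deriv]
      exact hf' y (interior_subset hy)
    refine squeeze_zero_norm' (a := fun y => Real.exp (-f R) * (C * (y ^ (k + 1))⁻¹)) ?_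
      (by simpa using h1.const_mul (Real.exp (-f R)))
    filter_upwards [eventually_ge_atTop R] with y hy
    have hy0 : 0 < y := by linarith
    rw [Real.norm_of_nonneg (by positivity)]
    gcongr
    exact hfm (mem_Ici.2 le_rfl) (mem_Ici.2 hy) hy
  have hlim3 : Tendsto (fun y => Real.exp (-f y) * (u y - C * (y ^ (k + 1))⁻¹)) atTop (𝓝 0) := by
    have := hlim.sub hlim2
    simp only [sub_zero] at this
    refine this.congr fun y => by ring
  have hle : Real.exp (-f x) * (u x - C * (x ^ (k + 1))⁻¹) ≤ 0 := by
    refine ge_of_tendsto hlim3 ?_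
    filter_upwards [eventually_ge_atTop x] with y hy
    exact hmono (mem_Ici.2 hx) (mem_Ici.2 (hx.trans hy)) hy
  have := nonpos_of_mul_nonpos_right hle (Real.exp_pos _)
  linarith

/-- For growing `f` a general solution explodes; the limit condition on `e^{-f} u` singles out the
decaying one. -/
theorem tail_of_ode_pos {f f' u φ : ℝ → ℝ} {R : ℝ} (hf : ∀ x, HasDerivAt f (f' x) x)
    (hR : 1 ≤ R) (hf' : ∀ x, R ≤ x → 0 ≤ f' x)
    (hu : ∀ x, HasDerivAt u (f' x * u x + φ x) x) (hφ : RapidDecay φ)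
    (hlim : Tendsto (fun x => Real.exp (-f x) * u x) atTop (𝓝 0)) (k : ℕ) :
    ∃ C, ∀ x, R ≤ x → |x| ^ k * |u x| ≤ C := by
  obtain ⟨C, hC⟩ := hφ (k + 2)
  have hC0 : 0 ≤ C := le_trans (by positivity) (hC 0)
  refine ⟨C, fun x hx => ?_⟩
  have hx0 : 0 < x := by linarith
  have h1 := le_of_ode_pos hf hR hf' hu hlim k hC0 hC x hx
  have h2 := le_of_ode_pos (u := fun y => -u y) (φ := fun y => -φ y) hf hR hf'
    (fun y => by convert! (hu y).neg using 1; ring)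
    (by simpa using hlim.neg) k hC0 (by simpa using hC) x hx
  have h3 : |u x| ≤ C * (x ^ (k + 1))⁻¹ := abs_le.2 ⟨by linarith, h1⟩
  rw [abs_of_pos hx0]
  calc x ^ k * |u x| ≤ x ^ k * (C * (x ^ (k + 1))⁻¹) := by gcongr
    _ = C * x⁻¹ := by field_simp; ring
    _ ≤ C * 1 := by
        gcongr
        exact inv_le_one_of_one_le₀ (by linarith)
    _ = C := mul_one C

end Decay

/-! ### Solution operators for the twisted differential in the concave and the convex case. -/

section Solve

open Filter Topology Set MeasureTheory

/-- The derivative of `p` is affine with negative slope. -/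
def ConcaveQuadratic (p : ℝ[X]) : Prop :=
  ∃ α β : ℝ, α < 0 ∧ ∀ x, p.derivative.eval x = α * x + β

/-- The derivative of `p` is affine with positive slope, or `p` is constant. -/
def ConvexQuadratic (p : ℝ[X]) : Prop :=
  ∃ α β : ℝ, (0 < α ∨ α = 0 ∧ β = 0) ∧ ∀ x, p.derivative.eval x = α * x + β

theorem hasDerivAt_eval_neg (p : ℝ[X]) (x : ℝ) :
    HasDerivAt (fun x => p.eval (-x)) (-p.derivative.eval (-x)) x := by
  have := (p.hasDerivAt (-x)).comp x (hasDerivAt_neg x)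
  convert! this using 1
  ring

theorem hasDerivAt_exp_neg_mul (p : ℝ[X]) {u : ℝ → ℝ} {u' x : ℝ} (hu : HasDerivAt u u' x) :
    HasDerivAt (fun x => Real.exp (-p.eval x) * u x)
      (Real.exp (-p.eval x) * (u' - p.derivative.eval x * u x)) x := by
  have := ((p.hasDerivAt x).neg.exp).mul hu
  convert! this using 1
  simp only [Pi.neg_apply]
  ring

theorem exp_mul_exp_neg_mul (x w : ℝ) : Real.exp x * (Real.exp (-x) * w) = w := by
  rw [← mul_assoc, ← Real.exp_add]
  simp

theorem exp_neg_mul_exp_mul (x w : ℝ) : Real.exp (-x) * (Real.exp x * w) = w := by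
  rw [← mul_assoc, ← Real.exp_add]
  simp

theorem hasDerivAt_exp_mul (p : ℝ[X]) {w : ℝ → ℝ} {w' x : ℝ} (hw : HasDerivAt w w' x) :
    HasDerivAt (fun x => Real.exp (p.eval x) * w x)
      (p.derivative.eval x * (Real.exp (p.eval x) * w x) + Real.exp (p.eval x) * w') x := by
  have := ((p.hasDerivAt x).exp).mul hw
  convert! this using 1
  ring

/-- Since `p → -∞` on both sides, every solution decays. The tail at `-∞` is the tail at `+∞` of `x
↦ u (-x)`, which solves the equation for `p (-x)` with source `-φ (-x)`. -/
theorem ConcaveQuadratic.rapidDecay {p : ℝ[X]} (hp : ConcaveQuadratic p) {u : ℝ → ℝ}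
    (φ : 𝓢(ℝ, ℝ)) (hu : ∀ x, HasDerivAt u (p.derivative.eval x * u x + φ x) x) (n : ℕ) :
    RapidDecayUpTo n u := by
  obtain ⟨α, β, hα, hp⟩ := hp
  have hR : ∀ x, (1 + |β|) / (-α) ≤ x → α * x ≤ -1 - |β| := fun x hx => by
    rw [div_le_iff₀ (by linarith)] at hx
    linarith
  have hφ := (rapidDecayUpTo_schwartz 0 φ)
  refine rapidDecayUpTo_of_ode (α := α) (β := β) φ ?_ (fun x => by rw [← hp]; exact hu x) n
  refine rapidDecay_of_tails (continuous_iff_continuousAt.2 fun x => (hu x).continuousAt)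
    (R := (1 + |β|) / (-α)) (tail_of_ode_neg (fun x => p.hasDerivAt x) (fun x hx => ?_) hu hφ)
    (tail_of_ode_neg (φ := fun x => -φ (-x)) (hasDerivAt_eval_neg p) (fun x hx => ?_)
      (fun x => ?_) fun k => ?_)
  · rw [hp]
    linarith [hR x hx, le_abs_self β]
  · rw [hp]
    linarith [hR x hx, neg_abs_le β]
  · have := (hu (-x)).comp x (hasDerivAt_neg x)
    convert! this using 1
    ring
  · obtain ⟨C, hC⟩ := hφ k
    refine ⟨C, fun x => ?_⟩
    have := hC (-x)
    rwa [abs_neg, ← abs_neg (φ (-x))] at this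

/-- Solutions differ by multiples of `e^p`, which does not decay; vanishing of `e^{-p} u` at both
ends removes this freedom. -/
theorem ConvexQuadratic.rapidDecay {p : ℝ[X]} (hp : ConvexQuadratic p) {u : ℝ → ℝ}
    (φ : 𝓢(ℝ, ℝ)) (hu : ∀ x, HasDerivAt u (p.derivative.eval x * u x + φ x) x)
    (htop : Tendsto (fun x => Real.exp (-p.eval x) * u x) atTop (𝓝 0))
    (hbot : Tendsto (fun x => Real.exp (-p.eval x) * u x) atBot (𝓝 0)) (n : ℕ) :
    RapidDecayUpTo n u := by
  obtain ⟨α, β, hα, hp⟩ := hp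
  -- For constant `p` the quotient is `0` by convention and the bound is trivial.
  have hR : ∀ x, max 1 (|β| / α) ≤ x → |β| ≤ α * x := fun x hx => by
    rcases hα with hα | ⟨rfl, rfl⟩
    · have := (le_max_right _ _).trans hx
      rw [div_le_iff₀ hα] at this
      linarith
    · simp
  have hφ := (rapidDecayUpTo_schwartz 0 φ)
  refine rapidDecayUpTo_of_ode (α := α) (β := β) φ ?_ (fun x => by rw [← hp]; exact hu x) n
  refine rapidDecay_of_tails (continuous_iff_continuousAt.2 fun x => (hu x).continuousAt)
    (tail_of_ode_pos (fun x => p.hasDerivAt x) (le_max_left _ (|β| / α)) (fun x hx => ?_) hu hφ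
      htop)
    (tail_of_ode_pos (φ := fun x => -φ (-x)) (hasDerivAt_eval_neg p) (le_max_left _ _)
      (fun x hx => ?_) (fun x => ?_) (fun k => ?_) (hbot.comp tendsto_neg_atTop_atBot))
  · rw [hp]
    linarith [hR x hx, neg_abs_le β]
  · rw [hp]
    linarith [hR x hx, le_abs_self β]
  · have := (hu (-x)).comp x (hasDerivAt_neg x)
    convert! this using 1
    ring
  · obtain ⟨C, hC⟩ := hφ k
    refine ⟨C, fun x => ?_⟩
    have := hC (-x)
    rwa [abs_neg, ← abs_neg (φ (-x))] at this

theorem ConvexQuadratic.exists_bound {p : ℝ[X]} (hp : ConvexQuadratic p) :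
    ∃ C, ∀ x, Real.exp (-p.eval x) ≤ C := by
  obtain ⟨α, β, hα, hp⟩ := hp
  have hq : ∀ x, p.eval x = α / 2 * x ^ 2 + β * x + p.eval 0 := fun x => by
    have hd : ∀ y, HasDerivAt (fun y => p.eval y - (α / 2 * y ^ 2 + β * y)) 0 y := fun y => by
      have := (p.hasDerivAt y).sub
        (((hasDerivAt_pow 2 y).const_mul (α / 2)).add ((hasDerivAt_id y).const_mul β))
      convert! this using 1
      rw [hp]
      push_cast
      ring
    have := is_const_of_deriv_eq_zero (fun y => (hd y).differentiableAt) (fun y => (hd y).deriv) x 0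
    linarith
  rcases hα with hα | ⟨rfl, rfl⟩
  · refine ⟨Real.exp (β ^ 2 / (2 * α) - p.eval 0), fun x => Real.exp_le_exp.2 ?_⟩
    rw [hq x]
    have : 0 ≤ (α * x + β) ^ 2 / (2 * α) := by positivity
    have h2 : (α * x + β) ^ 2 / (2 * α) = α / 2 * x ^ 2 + β * x + β ^ 2 / (2 * α) := by
      field_simp
      ring
    linarith
  · exact ⟨Real.exp (-p.eval 0), fun x => by rw [hq x]; simp⟩

theorem continuous_exp_neg_eval (p : ℝ[X]) : Continuous fun x => Real.exp (-p.eval x) := by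
  fun_prop

theorem ConvexQuadratic.integrable {p : ℝ[X]} (hp : ConvexQuadratic p) (φ : 𝓢(ℝ, ℝ)) :
    Integrable fun x => Real.exp (-p.eval x) * φ x := by
  obtain ⟨C, hC⟩ := hp.exists_bound
  refine φ.integrable.bdd_mul (c := C) (continuous_exp_neg_eval p).aestronglyMeasurable
    (ae_of_all _ fun x => ?_)
  rw [Real.norm_of_nonneg (Real.exp_pos _).le]
  exact hC x

theorem ConvexQuadratic.tendsto_zero {p : ℝ[X]} (hp : ConvexQuadratic p) (φ : 𝓢(ℝ, ℝ)) :
    Tendsto (fun x => Real.exp (-p.eval x) * φ x) (cocompact ℝ) (𝓝 0) := by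
  obtain ⟨C, hC⟩ := hp.exists_bound
  have h1 : Tendsto (fun x => C * ‖φ x‖) (cocompact ℝ) (𝓝 0) := by
    simpa using (φ.tendsto_cocompact.norm).const_mul C
  refine squeeze_zero_norm (fun x => ?_) h1
  rw [norm_mul, Real.norm_of_nonneg (Real.exp_pos _).le]
  exact mul_le_mul_of_nonneg_right (hC x) (norm_nonneg _)

theorem hasDerivAt_setIntegral_Iic {ψ : ℝ → ℝ} (hψ : Integrable ψ) (hc : Continuous ψ) (x : ℝ) :
    HasDerivAt (fun x => ∫ y in Iic x, ψ y) (ψ x) x := by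
  have h1 : (fun x => ∫ y in Iic x, ψ y) = fun x => (∫ y in Iic 0, ψ y) + ∫ y in (0 : ℝ)..x, ψ y := by
    funext x
    rw [← intervalIntegral.integral_Iic_sub_Iic hψ.integrableOn hψ.integrableOn]
    ring
  rw [h1]
  simpa using (hc.integral_hasStrictDerivAt 0 x).hasDerivAt.const_add (∫ y in Iic 0, ψ y)

/-- The solution `u` of `u' = p' u + φ` with `u(x₀) = c e^{p(x₀)}`, for concave `p`. -/
noncomputable def solveConcave (p : ℝ[X]) (hp : ConcaveQuadratic p) (x₀ c : ℝ) (φ : 𝓢(ℝ, ℝ)) :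
    𝓢(ℝ, ℝ) :=
  schwartzOfRapidDecay
    (fun x => Real.exp (p.eval x) * (c + ∫ y in x₀..x, Real.exp (-p.eval y) * φ y))
    (hp.rapidDecay φ fun x => by
      have hc : Continuous fun y => Real.exp (-p.eval y) * φ y := by fun_prop
      have := hasDerivAt_exp_mul p ((hc.integral_hasStrictDerivAt x₀ x).hasDerivAt.const_add c)
      convert! this using 1
      rw [exp_mul_exp_neg_mul])

theorem solveConcave_apply (p : ℝ[X]) (hp : ConcaveQuadratic p) (x₀ c : ℝ) (φ : 𝓢(ℝ, ℝ)) (x : ℝ) :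
    solveConcave p hp x₀ c φ x =
      Real.exp (p.eval x) * (c + ∫ y in x₀..x, Real.exp (-p.eval y) * φ y) := rfl

/-- The product of `e^p` with a compactly supported Schwartz function. -/
noncomputable def expMul (p : ℝ[X]) (b : 𝓢(ℝ, ℝ)) (hb : HasCompactSupport b) : 𝓢(ℝ, ℝ) :=
  HasCompactSupport.toSchwartzMap (f := fun x => Real.exp (p.eval x) * b x) hb.mul_left
    (by
      have h1 : ContDiff ℝ (⊤ : ℕ∞) fun x : ℝ => p.eval x := (hasTemperateGrowth_eval p).1
      have h2 : ContDiff ℝ (⊤ : ℕ∞) b := b.smooth _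
      exact h1.exp.mul h2)

theorem expMul_apply (p : ℝ[X]) (b : 𝓢(ℝ, ℝ)) (hb : HasCompactSupport b) (x : ℝ) :
    expMul p b hb x = Real.exp (p.eval x) * b x := rfl

/-- The rapidly decreasing solution `u` of `u' = p' u + φ - c e^p b`, for convex `p`, where
`∫ b = 1` and `c` is the unique real number such that this solution exists. -/
noncomputable def solveConvex (p : ℝ[X]) (hp : ConvexQuadratic p) (b : 𝓢(ℝ, ℝ))
    (hb : HasCompactSupport b) (hb' : ∫ x, b x = 1) (φ : 𝓢(ℝ, ℝ)) : 𝓢(ℝ, ℝ) :=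
  schwartzOfRapidDecay
    (fun x => Real.exp (p.eval x) * ∫ y in Iic x, (Real.exp (-p.eval y) * φ y -
      (∫ z, Real.exp (-p.eval z) * φ z) * b y)) (by
    set c := ∫ z, Real.exp (-p.eval z) * φ z with hc
    have hint : Integrable fun y => Real.exp (-p.eval y) * φ y - c * b y :=
      (hp.integrable φ).sub (b.integrable.const_mul c)
    have hcont : Continuous fun y => Real.exp (-p.eval y) * φ y - c * b y := by fun_prop
    have h0 : ∫ y, (Real.exp (-p.eval y) * φ y - c * b y) = 0 := by
      rw [integral_sub (hp.integrable φ) (b.integrable.const_mul c), integral_const_mul, hb', ← hc]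
      ring
    refine hp.rapidDecay (φ - c • expMul p b hb) (fun x => ?_) ?_ ?_
    · have := hasDerivAt_exp_mul p (hasDerivAt_setIntegral_Iic hint hcont x)
      convert! this using 1
      rw [mul_sub, exp_mul_exp_neg_mul]
      simp [expMul_apply]
      ring
    · simp only [exp_neg_mul_exp_mul]
      rw [← h0]
      exact (aecover_Iic tendsto_id).integral_tendsto_of_countably_generated hint
    · simp only [exp_neg_mul_exp_mul]
      exact tendsto_integral_Iic_zero tendsto_id)

theorem solveConvex_apply (p : ℝ[X]) (hp : ConvexQuadratic p) (b : 𝓢(ℝ, ℝ))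
    (hb : HasCompactSupport b) (hb' : ∫ x, b x = 1) (φ : 𝓢(ℝ, ℝ)) (x : ℝ) :
    solveConvex p hp b hb hb' φ x = Real.exp (p.eval x) * ∫ y in Iic x,
      (Real.exp (-p.eval y) * φ y - (∫ z, Real.exp (-p.eval z) * φ z) * b y) := rfl

theorem hasDerivAt_schwartz (u : 𝓢(ℝ, ℝ)) (x : ℝ) : HasDerivAt u (deriv u x) x :=
  u.differentiableAt.hasDerivAt

/-- Conjugation by `e^{-p}` turns the twisted derivative into the ordinary one, so the inversion and
vanishing identities below reduce to the fundamental theorem of calculus. -/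
theorem hasDerivAt_exp_neg_mul_schwartz (p : ℝ[X]) (u : 𝓢(ℝ, ℝ)) (x : ℝ) :
    HasDerivAt (fun x => Real.exp (-p.eval x) * u x)
      (Real.exp (-p.eval x) * twistedDeriv p u x) x := by
  rw [twistedDeriv_apply]
  exact hasDerivAt_exp_neg_mul p (hasDerivAt_schwartz u x)

theorem twistedDeriv_solveConcave (p : ℝ[X]) (hp : ConcaveQuadratic p) (x₀ c : ℝ) (φ : 𝓢(ℝ, ℝ)) :
    twistedDeriv p (solveConcave p hp x₀ c φ) = φ := by
  ext x
  have hc : Continuous fun y => Real.exp (-p.eval y) * φ y := by fun_prop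
  have := hasDerivAt_exp_mul p ((hc.integral_hasStrictDerivAt x₀ x).hasDerivAt.const_add c)
  rw [exp_mul_exp_neg_mul] at this
  rw [twistedDeriv_apply, HasDerivAt.deriv (f := solveConcave p hp x₀ c φ) this,
    solveConcave_apply]
  ring

/-- The initial value is what the homotopy, which starts with `0`, forgets. The difference is the
multiple of the Gaussian `e^p` given by the projection to cohomology. -/
theorem solveConcave_twistedDeriv (p : ℝ[X]) (hp : ConcaveQuadratic p) (x₀ : ℝ) (u : 𝓢(ℝ, ℝ)) :
    solveConcave p hp x₀ (Real.exp (-p.eval x₀) * u x₀) (twistedDeriv p u) = u := by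
  ext x
  have hc : Continuous fun y => Real.exp (-p.eval y) * twistedDeriv p u y := by fun_prop
  rw [solveConcave_apply, intervalIntegral.integral_eq_sub_of_hasDerivAt
    (fun y _ => hasDerivAt_exp_neg_mul_schwartz p u y) (hc.intervalIntegrable _ _)]
  rw [add_sub_cancel, exp_mul_exp_neg_mul]

/-- The integrand is the derivative of `e^{-p} u`, which vanishes at both ends. Hence the functional
descends to cohomology. -/
theorem integral_exp_neg_mul_twistedDeriv (p : ℝ[X]) (hp : ConvexQuadratic p) (u : 𝓢(ℝ, ℝ)) :
    ∫ x, Real.exp (-p.eval x) * twistedDeriv p u x = 0 := by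
  have h := hp.tendsto_zero u
  rw [integral_of_hasDerivAt_of_tendsto (fun y => hasDerivAt_exp_neg_mul_schwartz p u y)
    (hp.integrable _) (h.mono_left atBot_le_cocompact) (h.mono_left atTop_le_cocompact), sub_zero]

/-- The integral of `e^{-p} φ` is the only obstruction to a decaying solution; it is concentrated on
the cocycle `e^p b`. -/
theorem twistedDeriv_solveConvex (p : ℝ[X]) (hp : ConvexQuadratic p) (b : 𝓢(ℝ, ℝ))
    (hb : HasCompactSupport b) (hb' : ∫ x, b x = 1) (φ : 𝓢(ℝ, ℝ)) :
    twistedDeriv p (solveConvex p hp b hb hb' φ) =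
      φ - (∫ z, Real.exp (-p.eval z) * φ z) • expMul p b hb := by
  ext x
  set c := ∫ z, Real.exp (-p.eval z) * φ z with hc
  have hint : Integrable fun y => Real.exp (-p.eval y) * φ y - c * b y :=
    (hp.integrable φ).sub (b.integrable.const_mul c)
  have hcont : Continuous fun y => Real.exp (-p.eval y) * φ y - c * b y := by fun_prop
  have := hasDerivAt_exp_mul p (hasDerivAt_setIntegral_Iic hint hcont x)
  rw [twistedDeriv_apply, HasDerivAt.deriv (f := solveConvex p hp b hb hb' φ) this,
    solveConvex_apply, mul_sub, exp_mul_exp_neg_mul, ← hc]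
  simp [expMul_apply]
  ring

theorem solveConvex_twistedDeriv (p : ℝ[X]) (hp : ConvexQuadratic p) (b : 𝓢(ℝ, ℝ))
    (hb : HasCompactSupport b) (hb' : ∫ x, b x = 1) (u : 𝓢(ℝ, ℝ)) :
    solveConvex p hp b hb hb' (twistedDeriv p u) = u := by
  ext x
  have h := hp.tendsto_zero u
  rw [solveConvex_apply, integral_exp_neg_mul_twistedDeriv p hp]
  simp only [zero_mul, sub_zero]
  rw [integral_Iic_of_hasDerivAt_of_tendsto' (fun y _ => hasDerivAt_exp_neg_mul_schwartz p u y)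
    (hp.integrable _).integrableOn (h.mono_left atBot_le_cocompact), sub_zero, exp_mul_exp_neg_mul]

/-- `solveConcave` with initial value zero, as a linear map. -/
noncomputable def solveConcaveₗ (p : ℝ[X]) (hp : ConcaveQuadratic p) (x₀ : ℝ) :
    𝓢(ℝ, ℝ) →ₗ[ℝ] 𝓢(ℝ, ℝ) where
  toFun := solveConcave p hp x₀ 0
  map_add' φ ψ := by
    ext x
    have hc : ∀ φ : 𝓢(ℝ, ℝ), Continuous fun y => Real.exp (-p.eval y) * φ y := fun φ => by fun_prop
    simp only [solveConcave_apply, add_apply, mul_add, zero_add]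
    rw [intervalIntegral.integral_add ((hc φ).intervalIntegrable _ _)
      ((hc ψ).intervalIntegrable _ _)]
    ring
  map_smul' k φ := by
    ext x
    simp only [solveConcave_apply, smul_apply, smul_eq_mul, zero_add, RingHom.id_apply,
      mul_left_comm _ k, intervalIntegral.integral_const_mul]

/-- The functional `φ ↦ ∫ e^{-p} φ`. -/
noncomputable def expIntegral (p : ℝ[X]) (hp : ConvexQuadratic p) : 𝓢(ℝ, ℝ) →ₗ[ℝ] ℝ where
  toFun φ := ∫ x, Real.exp (-p.eval x) * φ x
  map_add' φ ψ := by
    simp only [add_apply, mul_add]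
    exact integral_add (hp.integrable φ) (hp.integrable ψ)
  map_smul' k φ := by
    simp only [smul_apply, smul_eq_mul, RingHom.id_apply, mul_left_comm _ k, integral_const_mul]

/-- `solveConvex` as a linear map. -/
noncomputable def solveConvexₗ (p : ℝ[X]) (hp : ConvexQuadratic p) (b : 𝓢(ℝ, ℝ))
    (hb : HasCompactSupport b) (hb' : ∫ x, b x = 1) : 𝓢(ℝ, ℝ) →ₗ[ℝ] 𝓢(ℝ, ℝ) where
  toFun := solveConvex p hp b hb hb'
  map_add' φ ψ := by
    ext x
    have hint : ∀ φ : 𝓢(ℝ, ℝ), IntegrableOn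
        (fun y => Real.exp (-p.eval y) * φ y - expIntegral p hp φ * b y) (Iic x) := fun φ =>
      ((hp.integrable φ).sub (b.integrable.const_mul _)).integrableOn
    have h1 := integral_add (hint φ) (hint ψ)
    rw [add_apply, solveConvex_apply, solveConvex_apply, solveConvex_apply, ← mul_add]
    congr 1
    refine Eq.trans ?_ h1
    congr 1
    funext y
    change _ * (φ + ψ) y - expIntegral p hp (φ + ψ) * b y = _
    rw [map_add, add_apply]
    ring
  map_smul' k φ := by
    ext x
    have h1 := integral_const_mul (μ := volume.restrict (Iic x)) k
      (fun y => Real.exp (-p.eval y) * φ y - expIntegral p hp φ * b y)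
    rw [smul_apply, RingHom.id_apply, solveConvex_apply, solveConvex_apply, smul_eq_mul,
      mul_left_comm]
    congr 1
    refine Eq.trans ?_ h1
    congr 1
    funext y
    change _ * (k • φ) y - expIntegral p hp (k • φ) * b y = _
    rw [map_smul, smul_apply, smul_eq_mul, smul_eq_mul]
    ring

end Solve

/-! ### Functions on words and their convolution -/

section Words

variable {ι : Type*} {X Y Z U : Type*} [AddCommGroup X] [Module ℝ X] [AddCommGroup Y] [Module ℝ Y]
  [AddCommGroup Z] [Module ℝ Z] [AddCommGroup U] [Module ℝ U]

/-- The last letter of the word `a :: l`. -/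
def lastLetter : ι → List ι → ι
  | a, [] => a
  | _, b :: l => lastLetter b l

theorem lastLetter_append (a : ι) (l m : List ι) :
    lastLetter a (l ++ m) = lastLetter (lastLetter a l) m := by
  induction l generalizing a with
  | nil => rfl
  | cons b l ih => exact ih b

/-- The function on words starting from `c` obtained by putting `a` in front. -/
def shift (F : ι → List ι → X) (a : ι) : ι → List ι → X := fun c m => F a (c :: m)

/-- The convolution `∑ B(F(u), G(v))` over all ways to cut a word at one of its letters, where this
letter belongs to both `u` and `v`. -/
def conv (B : X →ₗ[ℝ] Y →ₗ[ℝ] Z) (F : ι → List ι → X) (G : ι → List ι → Y) (a : ι)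
    (l : List ι) : Z :=
  match l with
  | [] => B (F a []) (G a [])
  | b :: l => B (F a []) (G a (b :: l)) + conv B (shift F a) G b l

theorem conv_cons (B : X →ₗ[ℝ] Y →ₗ[ℝ] Z) (F : ι → List ι → X) (G : ι → List ι → Y) (a b : ι)
    (l : List ι) :
    conv B F G a (b :: l) = B (F a []) (G a (b :: l)) + conv B (shift F a) G b l := rfl

/-- A word `a :: l` is a sequence of objects and carries one morphism per letter of `l`; the letter
at the cut ends the first factor and begins the second. -/
theorem conv_eq_sum (B : X →ₗ[ℝ] Y →ₗ[ℝ] Z) (F : ι → List ι → X) (G : ι → List ι → Y) (a : ι)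
    (l : List ι) : conv B F G a l = ∑ k ∈ Finset.range (l.length + 1),
      B (F a (l.take k)) (G (lastLetter a (l.take k)) (l.drop k)) := by
  induction l generalizing F a with
  | nil => simp [conv, lastLetter]
  | cons b l ih =>
    rw [conv, ih, List.length_cons, Finset.sum_range_succ' _ (l.length + 1)]
    simp [shift, lastLetter, add_comm]

theorem conv_congr {X' Y' : Type*} [AddCommGroup X'] [Module ℝ X'] [AddCommGroup Y'] [Module ℝ Y']
    {B : X →ₗ[ℝ] Y →ₗ[ℝ] Z} {B' : X' →ₗ[ℝ] Y' →ₗ[ℝ] Z} {F : ι → List ι → X}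
    {G : ι → List ι → Y} {F' : ι → List ι → X'} {G' : ι → List ι → Y'} {a : ι} {l : List ι}
    (h : ∀ l₁ l₂, l = l₁ ++ l₂ → B (F a l₁) (G (lastLetter a l₁) l₂) =
      B' (F' a l₁) (G' (lastLetter a l₁) l₂)) : conv B F G a l = conv B' F' G' a l := by
  rw [conv_eq_sum, conv_eq_sum]
  exact Finset.sum_congr rfl fun k _ => h _ _ (List.take_append_drop k l).symm

theorem conv_add_of_eq {B : X →ₗ[ℝ] Y →ₗ[ℝ] Z} {F F₁ F₂ : ι → List ι → X}
    {G G₁ G₂ : ι → List ι → Y} {a : ι} {l : List ι}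
    (h : ∀ l₁ l₂, l = l₁ ++ l₂ → B (F a l₁) (G (lastLetter a l₁) l₂) =
      B (F₁ a l₁) (G₁ (lastLetter a l₁) l₂) + B (F₂ a l₁) (G₂ (lastLetter a l₁) l₂)) :
    conv B F G a l = conv B F₁ G₁ a l + conv B F₂ G₂ a l := by
  rw [conv_eq_sum, conv_eq_sum, conv_eq_sum, ← Finset.sum_add_distrib]
  exact Finset.sum_congr rfl fun k _ => h _ _ (List.take_append_drop k l).symm

theorem map_conv {Z' : Type*} [AddCommGroup Z'] [Module ℝ Z'] (f : Z →ₗ[ℝ] Z')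
    (B : X →ₗ[ℝ] Y →ₗ[ℝ] Z) (F : ι → List ι → X) (G : ι → List ι → Y) (a : ι) (l : List ι) :
    f (conv B F G a l) = conv (B.compr₂ f) F G a l := by
  rw [conv_eq_sum, conv_eq_sum, map_sum]
  rfl

/-- Both sides run over the same pairs of cuts; `h1` separates those whose first cut is at the first
letter. -/
theorem conv_assoc {V W : Type*} [AddCommGroup V] [Module ℝ V] [AddCommGroup W] [Module ℝ W]
    (B₁ : V →ₗ[ℝ] Z →ₗ[ℝ] U) (B₂ : X →ₗ[ℝ] Y →ₗ[ℝ] V) (B₃ : X →ₗ[ℝ] W →ₗ[ℝ] U)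
    (B₄ : Y →ₗ[ℝ] Z →ₗ[ℝ] W) (h : ∀ x y z, B₁ (B₂ x y) z = B₃ x (B₄ y z))
    (F : ι → List ι → X) (G : ι → List ι → Y) (H : ι → List ι → Z) (a : ι) (l : List ι) :
    conv B₁ (conv B₂ F G) H a l = conv B₃ F (conv B₄ G H) a l := by
  induction l generalizing F a with
  | nil => simp [conv, h]
  | cons b l ih =>
    have h1 : conv B₁ (shift (conv B₂ F G) a) H b l =
        conv B₁ (fun c m => B₂ (F a []) (shift G a c m)) H b l +
          conv B₁ (conv B₂ (shift F a) G) H b l :=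
      conv_add_of_eq fun l₁ l₂ _ => by
        simp only [shift, conv, map_add, LinearMap.add_apply]
    have h2 : B₃ (F a []) (conv B₄ (shift G a) H b l) =
        conv B₁ (fun c m => B₂ (F a []) (shift G a c m)) H b l := by
      rw [map_conv]
      exact conv_congr fun l₁ l₂ _ => (h _ _ _).symm
    rw [conv, h1, ih, ← h2]
    simp only [conv, map_add, h, add_assoc]

/-- The sum of the degrees of the letters of a word. -/
def wdeg (δ : ι → ι → ℤ) : ι → List ι → ℤ
  | _, [] => 0
  | a, b :: l => δ a b + wdeg δ b l

theorem wdeg_append (δ : ι → ι → ℤ) (a : ι) (l m : List ι) :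
    wdeg δ a (l ++ m) = wdeg δ a l + wdeg δ (lastLetter a l) m := by
  induction l generalizing a with
  | nil => simp [wdeg, lastLetter]
  | cons b l ih =>
    simp only [List.cons_append, wdeg, lastLetter, ih]
    ring

/-- Multiplication by the sign given by the degree of a word. -/
noncomputable def twist (δ : ι → ι → ℤ) (F : ι → List ι → X) : ι → List ι → X :=
  fun a l => (-1 : ℝ) ^ wdeg δ a l • F a l

theorem neg_one_zpow_mul_self (n : ℤ) : (-1 : ℝ) ^ n * (-1 : ℝ) ^ n = 1 := by
  rw [← mul_zpow]
  norm_num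

theorem twist_twist (δ : ι → ι → ℤ) (F : ι → List ι → X) : twist δ (twist δ F) = F := by
  funext a l
  rw [twist, twist, smul_smul, neg_one_zpow_mul_self, one_smul]

theorem twist_conv (δ : ι → ι → ℤ) (B : X →ₗ[ℝ] Y →ₗ[ℝ] Z) (F : ι → List ι → X)
    (G : ι → List ι → Y) : twist δ (conv B F G) = conv B (twist δ F) (twist δ G) := by
  funext a l
  have := map_conv (LinearMap.lsmul ℝ Z ((-1 : ℝ) ^ wdeg δ a l)) B F G a l
  refine this.trans (conv_congr fun l₁ l₂ hl => ?_)
  subst hl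
  simp only [twist, LinearMap.compr₂_apply, LinearMap.lsmul_apply, map_smul, LinearMap.smul_apply,
    smul_smul, wdeg_append]
  rw [zpow_add₀ (by norm_num), mul_comm]

/-- The insertion `∑ ± M(mid) F(left, right)` over all ways to write a word as a product of three
factors, the middle one of which is replaced by a single letter. -/
noncomputable def ins (δ : ι → ι → ℤ) (M : ι → List ι → ℝ) (F : ι → List ι → X) (a : ι)
    (l : List ι) : X :=
  match l with
  | [] => 0
  | b :: l => conv (LinearMap.lsmul ℝ X) M (shift F a) a (b :: l) +
      (-1 : ℝ) ^ δ a b • ins δ M (shift F a) b l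

theorem ins_cons (δ : ι → ι → ℤ) (M : ι → List ι → ℝ) (F : ι → List ι → X) (a b : ι)
    (l : List ι) : ins δ M F a (b :: l) = conv (LinearMap.lsmul ℝ X) M (shift F a) a (b :: l) +
      (-1 : ℝ) ^ δ a b • ins δ M (shift F a) b l := rfl

theorem ins_congr (δ : ι → ι → ℤ) (M : ι → List ι → ℝ) {F F' : ι → List ι → X} {a : ι}
    (h : ∀ l, F a l = F' a l) (l : List ι) : ins δ M F a l = ins δ M F' a l := by
  have : shift F a = shift F' a := by
    funext c m
    exact h _
  cases l with
  | nil => rfl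
  | cons b l => rw [ins, ins, this]

/-- The last letter survives every insertion, so a linear map which depends only on it commutes with
insertion. -/
theorem ins_map (δ : ι → ι → ℤ) (M : ι → List ι → ℝ) (f : ι → X →ₗ[ℝ] Y) (F : ι → List ι → X)
    (a : ι) (l : List ι) :
    ins δ M (fun c m => f (lastLetter c m) (F c m)) a l = f (lastLetter a l) (ins δ M F a l) := by
  induction l generalizing F a with
  | nil => simp [ins]
  | cons b l ih =>
    have h1 := ih (shift F a) b
    have h2 : shift (fun c m => f (lastLetter c m) (F c m)) a =
      fun c m => f (lastLetter c m) (shift F a c m) := rfl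
    rw [ins, h2, h1, ins, map_add, map_smul, map_conv]
    congr 1
    refine conv_congr fun l₁ l₂ hl => ?_
    have : lastLetter a (b :: l) = lastLetter (lastLetter a l₁) l₂ := by
      rw [hl, lastLetter_append]
    simp [this]

theorem ins_add (δ : ι → ι → ℤ) (M : ι → List ι → ℝ) (F G : ι → List ι → X)
    (a : ι) (l : List ι) :
    ins δ M (fun c m => F c m + G c m) a l = ins δ M F a l + ins δ M G a l := by
  induction l generalizing F G a with
  | nil => simp [ins]
  | cons b l ih =>
    have h1 := ih (shift F a) (shift G a) b
    have h2 : shift (fun c m => F c m + G c m) a = fun c m => shift F a c m + shift G a c m := rfl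
    rw [ins, h2, h1, ins, ins, smul_add,
      conv_add_of_eq (F₁ := M) (F₂ := M) (G₁ := shift F a) (G₂ := shift G a)
        fun l₁ l₂ _ => map_add _ _ _]
    abel

theorem ins_smul (δ : ι → ι → ℤ) (M : ι → List ι → ℝ) (k : ℝ) (F : ι → List ι → X)
    (a : ι) (l : List ι) : ins δ M (fun c m => k • F c m) a l = k • ins δ M F a l :=
  ins_map δ M (fun _ => LinearMap.lsmul ℝ X k) F a l

theorem ins_eq_zero (δ : ι → ι → ℤ) (M : ι → List ι → ℝ) {F : ι → List ι → X} {a : ι}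
    (h : ∀ l, l ≠ [] → F a l = 0) (l : List ι) : ins δ M F a l = 0 := by
  induction l generalizing F a with
  | nil => rfl
  | cons b l ih =>
    rw [ins, ih (F := shift F a) (fun m _ => h (b :: m) (List.cons_ne_nil _ _)), conv_eq_sum]
    simp [shift, h]

/-- Insertion into a function supported on words with a single letter. -/
theorem ins_of_length_one (δ : ι → ι → ℤ) (M : ι → List ι → ℝ) {F : ι → List ι → X} {a : ι}
    (h : ∀ l, l.length ≠ 1 → F a l = 0) (l : List ι) (hl : l ≠ []) :
    ins δ M F a l = M a l • F a [lastLetter a l] := by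
  cases l with
  | nil => exact absurd rfl hl
  | cons b l =>
    rw [ins, ins_eq_zero, smul_zero, add_zero, conv_eq_sum, Finset.sum_range_succ,
      Finset.sum_eq_zero, zero_add]
    · simp [shift]
    · intro k hk
      have : shift F a (lastLetter a ((b :: l).take k)) ((b :: l).drop k) = 0 := by
        refine h _ ?_
        have := Finset.mem_range.1 hk
        simp only [List.length_cons, List.length_drop] at this ⊢
        omega
      rw [this, map_zero]
    · intro m hm
      refine h _ ?_
      simpa using hm

/-- Insertion is a derivation of convolution: the middle factor lies in the left or in the right
half, and passing the left half costs the sign recorded by `twist`. The hypothesis `hM` removes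
empty middle factors, which `ins` does not see on a word without morphisms. -/
theorem ins_conv (δ : ι → ι → ℤ) {M : ι → List ι → ℝ} (hM : ∀ a, M a [] = 0)
    (B : X →ₗ[ℝ] Y →ₗ[ℝ] Z) (F : ι → List ι → X) (G : ι → List ι → Y) (a : ι) (l : List ι) :
    ins δ M (conv B F G) a l =
      conv B (ins δ M F) G a l + conv B (twist δ F) (ins δ M G) a l := by
  induction l generalizing F a with
  | nil => simp [ins, conv]
  | cons b l ih =>
    have h1 : shift (conv B F G) a = fun c m => B (F a []) (shift G a c m) +
        conv B (shift F a) G c m := rfl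
    have h2 : conv (LinearMap.lsmul ℝ Z) M (shift (conv B F G) a) a (b :: l) =
        B (F a []) (conv (LinearMap.lsmul ℝ Y) M (shift G a) a (b :: l)) +
          conv B (conv (LinearMap.lsmul ℝ X) M (shift F a)) G a (b :: l) := by
      rw [h1, conv_add_of_eq (F₁ := M) (F₂ := M) (G₁ := fun c m => B (F a []) (shift G a c m))
        (G₂ := conv B (shift F a) G) fun l₁ l₂ _ => map_add _ _ _, map_conv]
      congr 1
      · exact conv_congr fun l₁ l₂ _ => by simp
      · exact (conv_assoc _ _ _ _ (fun x y z => by simp) _ _ _ _ _).symm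
    have h3 : ins δ M (shift (conv B F G) a) b l =
        B (F a []) (ins δ M (shift G a) b l) + (conv B (ins δ M (shift F a)) G b l +
          conv B (twist δ (shift F a)) (ins δ M G) b l) := by
      rw [h1, ins_add, ih]
      congr 1
      exact ins_map δ M (fun _ => B (F a [])) (shift G a) b l
    have h4 : conv B (shift (twist δ F) a) (ins δ M G) b l =
        (-1 : ℝ) ^ δ a b • conv B (twist δ (shift F a)) (ins δ M G) b l := by
      have := map_conv (LinearMap.lsmul ℝ Z ((-1 : ℝ) ^ δ a b)) B (twist δ (shift F a))
        (ins δ M G) b l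
      refine Eq.trans (conv_congr fun l₁ l₂ _ => ?_) this.symm
      simp only [shift, twist, wdeg, LinearMap.compr₂_apply, LinearMap.lsmul_apply, map_smul,
        LinearMap.smul_apply, smul_smul]
      rw [zpow_add₀ (by norm_num), mul_comm]
    have h5 : conv B (shift (ins δ M F) a) G b l =
        conv B (conv (LinearMap.lsmul ℝ X) M (shift F a)) G a (b :: l) +
          (-1 : ℝ) ^ δ a b • conv B (ins δ M (shift F a)) G b l := by
      have := map_conv (LinearMap.lsmul ℝ Z ((-1 : ℝ) ^ δ a b)) B (ins δ M (shift F a)) G b l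
      have h0 : conv (LinearMap.lsmul ℝ X) M (shift F a) a [] = 0 := by
        simp [conv, hM]
      rw [LinearMap.lsmul_apply] at this
      rw [this, conv, h0, map_zero, LinearMap.zero_apply, zero_add, conv_eq_sum, conv_eq_sum,
        conv_eq_sum, ← Finset.sum_add_distrib]
      refine Finset.sum_congr rfl fun k _ => ?_
      cases hk : l.take k <;> simp [shift, ins, smul_comm ((-1 : ℝ) ^ δ a b)]
    have h6 : twist δ F a [] = F a [] := by simp [twist, wdeg]
    have h7 : ins δ M F a [] = 0 := rfl
    rw [ins_cons, h2, h3, conv_cons B (ins δ M F), h7, map_zero, LinearMap.zero_apply, zero_add, h5,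
      conv_cons B (twist δ F), h4, h6, ins_cons, map_add, map_smul, smul_add, smul_add]
    abel

/-- Replacing the middle factor by a single morphism changes the total degree by one, hence the
minus sign. -/
theorem ins_twist (δ : ι → ι → ℤ) {M : ι → List ι → ℝ}
    (hM : ∀ a l, M a l ≠ 0 → δ a (lastLetter a l) = wdeg δ a l + 1) (F : ι → List ι → X) (a : ι)
    (l : List ι) : ins δ M (twist δ F) a l = -twist δ (ins δ M F) a l := by
  induction l generalizing F a with
  | nil => simp [ins, twist]
  | cons b l ih =>
    have h1 : ins δ M (shift (twist δ F) a) b l =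
        (-1 : ℝ) ^ δ a b • ins δ M (twist δ (shift F a)) b l := by
      rw [← ins_smul]
      refine ins_congr δ M (fun m => ?_) l
      simp only [shift, twist, wdeg, smul_smul]
      rw [zpow_add₀ (by norm_num)]
    have h2 : conv (LinearMap.lsmul ℝ X) M (shift (twist δ F) a) a (b :: l) =
        -((-1 : ℝ) ^ wdeg δ a (b :: l) •
          conv (LinearMap.lsmul ℝ X) M (shift F a) a (b :: l)) := by
      rw [← neg_smul]
      have := map_conv (LinearMap.lsmul ℝ X (-(-1 : ℝ) ^ wdeg δ a (b :: l)))
        (LinearMap.lsmul ℝ X) M (shift F a) a (b :: l)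
      refine Eq.trans (conv_congr fun l₁ l₂ hl => ?_) this.symm
      rw [hl]
      by_cases h0 : M a l₁ = 0
      · simp [h0]
      simp only [shift, twist, wdeg, wdeg_append, hM _ _ h0, LinearMap.compr₂_apply]
      simp only [LinearMap.lsmul_apply, smul_smul]
      rw [zpow_add₀ (by norm_num), zpow_add₀ (by norm_num), zpow_add₀ (by norm_num)]
      congr 1
      ring
    rw [ins_cons, h1, h2, ih, twist, twist, ins_cons, wdeg]
    rw [zpow_add₀ (by norm_num)]
    module

end Words

/-! ### Homotopy transfer to one-dimensional morphism spaces -/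

/-- Homotopy transfer data for a family of twisted differentials `d a b` on a graded algebra `T`
and the one-dimensional spaces spanned by the cocycles `e a b`. -/
structure TransferData (ι T : Type*) [AddCommGroup T] [Module ℝ T] where
  mul : T →ₗ[ℝ] T →ₗ[ℝ] T
  mul_assoc : ∀ x y z, mul (mul x y) z = mul x (mul y z)
  gr : ℤ → Submodule ℝ T
  mul_mem : ∀ {m n : ℤ} {x y : T}, x ∈ gr m → y ∈ gr n → mul x y ∈ gr (m + n)
  d : ι → ι → T →ₗ[ℝ] T
  d_mem : ∀ {n : ℤ} {x : T} (a b : ι), x ∈ gr n → d a b x ∈ gr (n + 1)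
  leibniz : ∀ {n : ℤ} {x : T} (a b c : ι) (y : T), x ∈ gr n →
    d a c (mul x y) = mul (d a b x) y + (-1 : ℝ) ^ n • mul x (d b c y)
  deg : ι → ι → ℤ
  e : ι → ι → T
  e_mem : ∀ a b, e a b ∈ gr (deg a b)
  d_e : ∀ a b, d a b (e a b) = 0
  p : ι → ι → T →ₗ[ℝ] ℝ
  p_d : ∀ a b x, p a b (d a b x) = 0
  p_eq_zero : ∀ {n : ℤ} {x : T} (a b : ι), x ∈ gr n → n ≠ deg a b → p a b x = 0
  h : ι → ι → T →ₗ[ℝ] T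
  h_mem : ∀ {n : ℤ} {x : T} (a b : ι), x ∈ gr n → h a b x ∈ gr (n - 1)
  homotopy : ∀ a b x, d a b (h a b x) + h a b (d a b x) = x - p a b x • e a b

namespace TransferData

variable {ι T : Type*} [AddCommGroup T] [Module ℝ T] (D : TransferData ι T)

/-- The degree of the basis elements in the suspension. -/
def sdeg (a b : ι) : ℤ := D.deg a b - 1

/-- The transferred functor on words with at most `n + 1` letters. -/
noncomputable def phiAux : ℕ → ι → List ι → T
  | 0, _, _ => 0
  | _ + 1, _, [] => 0
  | _ + 1, a, [b] => D.e a b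
  | n + 1, a, b :: c :: l =>
    -D.h a (lastLetter c l) (conv D.mul (twist D.sdeg (phiAux n)) (phiAux n) a (b :: c :: l))

theorem phiAux_nil (n : ℕ) (a : ι) : D.phiAux n a [] = 0 := by
  cases n <;> rfl

/-- The numerical argument only bounds the recursion: cuts with an empty factor contribute zero, so
only strictly shorter words are ever used. -/
theorem phiAux_eq (n m : ℕ) (a : ι) (l : List ι) (hn : l.length ≤ n) (hm : l.length ≤ m) :
    D.phiAux n a l = D.phiAux m a l := by
  induction n generalizing m a l with
  | zero =>
    obtain rfl : l = [] := List.length_eq_zero_iff.1 (by omega)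
    rw [phiAux_nil, phiAux_nil]
  | succ n ih =>
    match l, m, hm with
    | [], _, _ => rw [phiAux_nil, phiAux_nil]
    | [b], m + 1, _ => rfl
    | b :: c :: l, m + 1, hm =>
      rw [phiAux, phiAux]
      congr 2
      refine conv_congr fun l₁ l₂ hl => ?_
      have hlen := congrArg List.length hl
      simp only [List.length_cons, List.length_append] at hlen hn hm
      simp only [twist]
      by_cases h1 : l₁ = []
      · simp [h1, phiAux_nil]
      by_cases h2 : l₂ = []
      · simp [h2, phiAux_nil]
      have h1 := List.length_pos_of_ne_nil h1
      have h2 := List.length_pos_of_ne_nil h2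
      rw [ih m a l₁ (by omega) (by omega), ih m _ l₂ (by omega) (by omega)]

/-- The structure constants of the transferred functor. -/
noncomputable def phi (a : ι) (l : List ι) : T := D.phiAux l.length a l

/-- The sum of the products of the values of the transferred functor. -/
noncomputable def lam : ι → List ι → T := conv D.mul (twist D.sdeg D.phi) D.phi

/-- The structure constants of the transferred (suspended) products. -/
noncomputable def mu (a : ι) (l : List ι) : ℝ := D.p a (lastLetter a l) (D.lam a l)

theorem phi_nil (a : ι) : D.phi a [] = 0 := rfl

theorem phi_singleton (a b : ι) : D.phi a [b] = D.e a b := rfl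

theorem phi_of_two_le (a : ι) (l : List ι) (hl : 2 ≤ l.length) :
    D.phi a l = -D.h a (lastLetter a l) (D.lam a l) := by
  match l, hl with
  | b :: c :: l, _ =>
    have h : ∀ (a : ι) (m : List ι), m.length ≤ l.length + 1 →
        D.phiAux (l.length + 1) a m = D.phi a m := fun a m hm =>
      D.phiAux_eq _ _ a m hm le_rfl
    change D.phiAux (l.length + 1 + 1) a (b :: c :: l) = _
    rw [phiAux]
    congr 2
    refine conv_congr fun l₁ l₂ hl => ?_
    have hlen := congrArg List.length hl
    simp only [List.length_cons, List.length_append] at hlen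
    simp only [twist]
    by_cases h1 : l₁ = []
    · simp [h1, phiAux_nil, phi_nil]
    by_cases h2 : l₂ = []
    · simp [h2, phiAux_nil, phi_nil]
    have h1 := List.length_pos_of_ne_nil h1
    have h2 := List.length_pos_of_ne_nil h2
    rw [h _ l₁ (by omega), h _ l₂ (by omega)]

theorem lam_nil (a : ι) : D.lam a [] = 0 := by
  simp [lam, conv, phi_nil]

theorem lam_singleton (a b : ι) : D.lam a [b] = 0 := by
  simp [lam, conv, shift, twist, phi_nil]

theorem mu_nil (a : ι) : D.mu a [] = 0 := by
  rw [mu, lam_nil, map_zero]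

theorem mu_singleton (a b : ι) : D.mu a [b] = 0 := by
  rw [mu, lam_singleton, map_zero]

/-- On suspensions the functor has degree 0 and the products have degree 1; before suspension this
puts `phi` in degree `wdeg + 1` and `lam` in degree `wdeg + 2`. The hypothesis on shorter words
serves the induction in `phi_mem`. -/
theorem lam_mem_of_phi_mem (a : ι) (l : List ι)
    (h : ∀ a m, m.length < l.length → D.phi a m ∈ D.gr (wdeg D.sdeg a m + 1)) :
    D.lam a l ∈ D.gr (wdeg D.sdeg a l + 2) := by
  rw [lam, conv_eq_sum]
  refine Submodule.sum_mem _ fun k _ => ?_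
  have hl := List.take_append_drop k l
  set l₁ := l.take k
  set l₂ := l.drop k
  have hlen := congrArg List.length hl
  rw [List.length_append] at hlen
  by_cases h1 : l₁ = []
  · simp [h1, phi_nil, twist]
  by_cases h2 : l₂ = []
  · simp [h2, phi_nil]
  have h1 := List.length_pos_of_ne_nil h1
  have h2 := List.length_pos_of_ne_nil h2
  have := D.mul_mem (Submodule.smul_mem _ ((-1 : ℝ) ^ wdeg D.sdeg a l₁) (h a l₁ (by omega)))
    (h (lastLetter a l₁) l₂ (by omega))
  rw [← hl, wdeg_append]
  convert! this using 2
  ring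

theorem phi_mem (a : ι) (l : List ι) : D.phi a l ∈ D.gr (wdeg D.sdeg a l + 1) := by
  induction hn : l.length using Nat.strong_induction_on generalizing a l with
  | _ n ih =>
    subst hn
    match l with
    | [] => exact Submodule.zero_mem _
    | [b] => simpa [phi_singleton, wdeg, sdeg] using D.e_mem a b
    | b :: c :: l =>
      rw [phi_of_two_le _ _ _ (by simp)]
      have := D.h_mem a (lastLetter a (b :: c :: l)) (D.lam_mem_of_phi_mem a (b :: c :: l)
        fun a m hm => ih _ hm a m rfl)
      refine Submodule.neg_mem _ ?_
      convert! this using 2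
      ring

theorem lam_mem (a : ι) (l : List ι) : D.lam a l ∈ D.gr (wdeg D.sdeg a l + 2) :=
  D.lam_mem_of_phi_mem a l fun a m _ => D.phi_mem a m

theorem deg_of_mu_ne_zero {a : ι} {l : List ι} (h : D.mu a l ≠ 0) :
    D.deg a (lastLetter a l) = wdeg D.sdeg a l + 2 := by
  by_contra hne
  exact h (D.p_eq_zero _ _ (D.lam_mem a l) (Ne.symm hne))

/-- The Leibniz rule and `ins_conv` express the sum of `d λ` and `ins λ` through the defect `d φ -
ins φ`, convolved with `φ` on either side. Substituting `-λ` for the defect leaves two triple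
products of `φ`, which cancel by associativity (`h3`). Only shorter words enter, so this can be used
inside the induction for `d_phi_add_lam`. -/
theorem d_lam_of (a : ι) (l : List ι)
    (h : ∀ a m, m.length < l.length →
      D.d a (lastLetter a m) (D.phi a m) - ins D.sdeg D.mu D.phi a m = -D.lam a m) :
    D.d a (lastLetter a l) (D.lam a l) = -ins D.sdeg D.mu D.lam a l := by
  set dphi : ι → List ι → T := fun a m => D.d a (lastLetter a m) (D.phi a m) with hdphi
  have h1 : D.d a (lastLetter a l) (D.lam a l) =
      conv D.mul (twist D.sdeg dphi) D.phi a l + conv D.mul (fun a m => -D.phi a m) dphi a l := by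
    rw [lam, conv_eq_sum, conv_eq_sum, conv_eq_sum, ← Finset.sum_add_distrib, map_sum]
    refine Finset.sum_congr rfl fun k _ => ?_
    have hl : lastLetter a l = lastLetter (lastLetter a (l.take k)) (l.drop k) := by
      rw [← lastLetter_append, List.take_append_drop]
    have hmem : twist D.sdeg D.phi a (l.take k) ∈ D.gr (wdeg D.sdeg a (l.take k) + 1) :=
      Submodule.smul_mem _ _ (D.phi_mem a (l.take k))
    rw [hl, D.leibniz a (lastLetter a (l.take k)) _ _ hmem]
    simp only [twist, hdphi, map_smul, map_neg, LinearMap.neg_apply, LinearMap.smul_apply]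
    rw [smul_smul, zpow_add₀ (by norm_num), mul_right_comm, neg_one_zpow_mul_self]
    simp
  have hins : ins D.sdeg D.mu (twist D.sdeg D.phi) = fun a m =>
      -twist D.sdeg (ins D.sdeg D.mu D.phi) a m := by
    funext a m
    exact ins_twist D.sdeg (fun a l h => by have := D.deg_of_mu_ne_zero h; simp only [sdeg]; omega) _ a m
  have h2 : ins D.sdeg D.mu D.lam a l =
      conv D.mul (fun a m => -twist D.sdeg (ins D.sdeg D.mu D.phi) a m) D.phi a l +
        conv D.mul D.phi (ins D.sdeg D.mu D.phi) a l := by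
    rw [lam, ins_conv _ D.mu_nil, twist_twist, hins]
  have htw : twist D.sdeg D.lam = conv D.mul D.phi (twist D.sdeg D.phi) := by
    rw [lam, twist_conv, twist_twist]
  have h3 : conv D.mul (twist D.sdeg D.lam) D.phi a l = conv D.mul D.phi D.lam a l := by
    rw [htw]
    exact conv_assoc D.mul D.mul D.mul D.mul D.mul_assoc _ _ _ a l
  rw [eq_neg_iff_add_eq_zero, h1, h2]
  have key : ∀ l₁ l₂, l = l₁ ++ l₂ →
      (D.mul (twist D.sdeg dphi a l₁) (D.phi (lastLetter a l₁) l₂) -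
        D.mul (twist D.sdeg (ins D.sdeg D.mu D.phi) a l₁) (D.phi (lastLetter a l₁) l₂) =
        -D.mul (twist D.sdeg D.lam a l₁) (D.phi (lastLetter a l₁) l₂)) ∧
      (D.mul (D.phi a l₁) (dphi (lastLetter a l₁) l₂) -
        D.mul (D.phi a l₁) (ins D.sdeg D.mu D.phi (lastLetter a l₁) l₂) =
        -D.mul (D.phi a l₁) (D.lam (lastLetter a l₁) l₂)) := by
    intro l₁ l₂ hl
    have hlen := congrArg List.length hl
    rw [List.length_append] at hlen
    constructor
    · by_cases h2 : l₂ = []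
      · simp [h2, phi_nil]
      have h2 := List.length_pos_of_ne_nil h2
      rw [← LinearMap.sub_apply, ← map_sub, twist, twist, ← smul_sub, h a l₁ (by omega), twist]
      simp
    · by_cases h1 : l₁ = []
      · simp [h1, phi_nil]
      have h1 := List.length_pos_of_ne_nil h1
      rw [← map_sub, h _ l₂ (by omega), map_neg]
  rw [conv_eq_sum, conv_eq_sum, conv_eq_sum, conv_eq_sum]
  rw [conv_eq_sum, conv_eq_sum] at h3
  rw [← Finset.sum_add_distrib, ← Finset.sum_add_distrib, ← Finset.sum_add_distrib,
    ← sub_eq_zero.2 h3.symm, ← Finset.sum_sub_distrib]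
  refine Finset.sum_congr rfl fun k _ => ?_
  obtain ⟨k1, k2⟩ := key _ _ (List.take_append_drop k l).symm
  rw [map_neg, map_neg, LinearMap.neg_apply, LinearMap.neg_apply,
    ← neg_neg (D.mul (twist D.sdeg D.lam a (l.take k)) _), ← k1,
    ← neg_neg (D.mul (D.phi a (l.take k)) (D.lam _ _)), ← k2]
  abel

/-- The functor relation. -/
theorem d_phi_add_lam (a : ι) (l : List ι) :
    D.d a (lastLetter a l) (D.phi a l) + D.lam a l = ins D.sdeg D.mu D.phi a l := by
  induction hn : l.length using Nat.strong_induction_on generalizing a l with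
  | _ n ih =>
    subst hn
    match l with
    | [] => simp [phi_nil, lam_nil, ins]
    | [b] =>
      simp [phi_singleton, lam_singleton, lastLetter, D.d_e, ins, conv, mu_nil,
        mu_singleton, shift]
    | b :: c :: l =>
      have hd := D.d_lam_of a (b :: c :: l) fun a m hm => by
        rw [← ih _ hm a m rfl]
        abel
      set w := b :: c :: l with hw
      have h1 : ins D.sdeg D.mu D.phi a w =
          D.mu a w • D.e a (lastLetter a w) -
            D.h a (lastLetter a w) (ins D.sdeg D.mu D.lam a w) := by
        -- `φ + h λ` vanishes except on words with one morphism, where it is `e`. Inserting into it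
        -- therefore leaves only the term `μ e` in which the whole word is replaced.
        have h2 := ins_of_length_one D.sdeg D.mu (a := a)
          (F := fun c m => D.phi c m + D.h c (lastLetter c m) (D.lam c m))
          (fun m hm => by
            by_cases h0 : m = []
            · simp [h0, phi_nil, lam_nil]
            have := List.length_pos_of_ne_nil h0
            rw [D.phi_of_two_le a m (by omega)]
            simp) w (List.cons_ne_nil _ _)
        rw [ins_add] at h2
        have h3 : ins D.sdeg D.mu (fun c m => D.h c (lastLetter c m) (D.lam c m)) a w =
            D.h a (lastLetter a w) (ins D.sdeg D.mu D.lam a w) :=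
          (ins_congr D.sdeg D.mu (F' := fun c m => D.h a (lastLetter c m) (D.lam c m))
            (fun _ => rfl) w).trans (ins_map D.sdeg D.mu (D.h a) D.lam a w)
        rw [h3, lam_singleton, map_zero, add_zero, phi_singleton] at h2
        rw [← h2]
        abel
      have h4 := D.homotopy a (lastLetter a w) (D.lam a w)
      rw [hd, map_neg] at h4
      rw [D.phi_of_two_le a w (by simp [hw]), map_neg, h1, mu]
      have h5 : D.d a (lastLetter a w) (D.h a (lastLetter a w) (D.lam a w)) =
        D.lam a w - D.p a (lastLetter a w) (D.lam a w) • D.e a (lastLetter a w) +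
          D.h a (lastLetter a w) (ins D.sdeg D.mu D.lam a w) := by
        rw [← h4]
        abel
      rw [h5]
      abel

/-- The `A_∞`-relations in the suspension. -/
theorem ins_mu_mu (a : ι) (l : List ι) : ins D.sdeg D.mu D.mu a l = 0 := by
  have hd := D.d_lam_of a l fun a m _ => by
    rw [← D.d_phi_add_lam a m]
    abel
  -- As `μ = p λ` and `d λ = -ins λ`, the relation is a case of `p d = 0`.
  have h1 : ins D.sdeg D.mu D.mu a l = D.p a (lastLetter a l) (ins D.sdeg D.mu D.lam a l) :=
    (ins_congr D.sdeg D.mu (F' := fun c m => D.p a (lastLetter c m) (D.lam c m))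
      (fun _ => rfl) l).trans (ins_map D.sdeg D.mu (D.p a) D.lam a l)
  have h2 := D.p_d a (lastLetter a l) (D.lam a l)
  rw [hd, map_neg, neg_eq_zero] at h2
  rw [h1, h2]

end TransferData

/-! ### Chains in one-dimensional morphism spaces -/

section Chains

variable {Obj : Type*} {H : Obj → Obj → ℤ → Type*}

theorem Chain.append_nil {a b : Obj} (p : Chain H a b) : p.append (.nil b) = p := by
  induction p with
  | nil => rfl
  | cons w p ih => rw [Chain.append, ih]

theorem Chain.append_assoc {a b c d : Obj} (p : Chain H a b) (q : Chain H b c) (r : Chain H c d) :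
    (p.append q).append r = p.append (q.append r) := by
  induction p with
  | nil => rfl
  | cons w p ih => simp only [Chain.append, ih]

theorem Chain.suspSign_append {a b c : Obj} (p : Chain H a b) (q : Chain H b c) :
    (p.append q).suspSign = p.suspSign + q.length * (p.degree - p.length) + q.suspSign := by
  induction p with
  | nil => simp [Chain.append, Chain.degree, Chain.suspSign, Chain.length]
  | cons w p ih =>
    simp only [Chain.append, Chain.degree, Chain.suspSign, Chain.length, ih, DeRham.length_append]
    ring

theorem Chain.eq_append_of_mem_cutTwo {a b : Obj} (w : Chain H a b) :
    ∀ t ∈ w.cutTwo, t.2.1.append t.2.2 = w := by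
  induction w with
  | nil => simp [Chain.cutTwo, Chain.append]
  | cons w p ih =>
    intro t ht
    simp only [Chain.cutTwo, List.mem_cons, List.mem_map] at ht
    rcases ht with rfl | ⟨s, hs, rfl⟩
    · rfl
    · simp only [Chain.append, ih s hs]

theorem Chain.eq_append_of_mem_cuts {a b : Obj} (w : Chain H a b) :
    ∀ t ∈ w.cuts, t.left.append (t.mid.append t.right) = w := by
  intro t ht
  simp only [Chain.cuts, List.mem_flatMap, List.mem_map] at ht
  obtain ⟨s, hs, u, hu, rfl⟩ := ht
  simp only [Chain.eq_append_of_mem_cutTwo _ u hu, Chain.eq_append_of_mem_cutTwo _ s hs]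

theorem Chain.cuts_cons {a b c : Obj} {n : ℤ} (w : H a b n) (p : Chain H b c) :
    (Chain.cons w p).cuts = ((Chain.cons w p).cutTwo.map fun s => ⟨.nil a, s.2.1, s.2.2⟩) ++
      p.cuts.map fun t => ⟨.cons w t.left, t.mid, t.right⟩ := by
  simp [Chain.cuts, Chain.cutTwo, List.flatMap_map, List.map_flatMap, List.map_map,
    Function.comp_def]

/-- The list of all objects of a chain but the first one. -/
def Chain.objs {a b : Obj} : Chain H a b → List Obj
  | .nil _ => []
  | .cons (b := b) _ p => b :: p.objs

theorem Chain.lastLetter_objs {a b : Obj} (p : Chain H a b) : lastLetter a p.objs = b := by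
  induction p with
  | nil => rfl
  | cons w p ih => exact ih

theorem Chain.objs_append {a b c : Obj} (p : Chain H a b) (q : Chain H b c) :
    (p.append q).objs = p.objs ++ q.objs := by
  induction p with
  | nil => rfl
  | cons w p ih => simp only [Chain.append, Chain.objs, ih, List.cons_append]

end Chains

/-- The one-dimensional graded vector space concentrated in degree `δ a b`. -/
noncomputable def lineSub {Obj : Type*} (δ : Obj → Obj → ℤ) (a b : Obj) (n : ℤ) : Submodule ℝ ℝ :=
  if n = δ a b then ⊤ else ⊥

/-- The morphism spaces given by `lineSub`. -/
abbrev lineHom {Obj : Type*} (δ : Obj → Obj → ℤ) : Obj → Obj → ℤ → Type :=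
  fun a b n => lineSub δ a b n

section LineChains

variable {Obj : Type*} {δ : Obj → Obj → ℤ}

/-- The element of `lineHom δ a b n` with a given coordinate (zero if `n ≠ δ a b`). -/
noncomputable def toLine (δ : Obj → Obj → ℤ) (a b : Obj) (n : ℤ) : ℝ →ₗ[ℝ] lineHom δ a b n :=
  if h : n = δ a b then
    { toFun := fun x => ⟨x, by simp [lineSub, h]⟩
      map_add' := fun _ _ => rfl
      map_smul' := fun _ _ => rfl }
  else 0

theorem coe_toLine (a b : Obj) (n : ℤ) (x : ℝ) :
    ((toLine δ a b n x : lineHom δ a b n) : ℝ) = if n = δ a b then x else 0 := by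
  unfold toLine
  split_ifs <;> rfl

theorem eq_of_coe_ne_zero {a b : Obj} {n : ℤ} {w : lineHom δ a b n} (h : (w : ℝ) ≠ 0) :
    n = δ a b := by
  by_contra hn
  have := w.2
  simp only [lineSub, hn, if_false, Submodule.mem_bot] at this
  exact h this

/-- The product of the coordinates of the morphisms in a chain. -/
noncomputable def coef {a b : Obj} : Chain (lineHom δ) a b → ℝ
  | .nil _ => 1
  | .cons w p => (w : ℝ) * coef p

theorem coef_append {a b c : Obj} (p : Chain (lineHom δ) a b) (q : Chain (lineHom δ) b c) :
    coef (p.append q) = coef p * coef q := by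
  induction p with
  | nil => simp [Chain.append, coef]
  | cons w p ih => simp only [Chain.append, coef, ih]; ring

/-- A nonzero vector can only sit in degree `δ a b`; so, unless a factor vanishes, the suspended
degree of a chain depends only on its objects. -/
theorem degree_of_coef_ne_zero {a b : Obj} {p : Chain (lineHom δ) a b} (h : coef p ≠ 0) :
    p.degree - p.length = wdeg (fun a b => δ a b - 1) a p.objs := by
  induction p with
  | nil => rfl
  | cons w p ih =>
    simp only [coef] at h
    have h1 := eq_of_coe_ne_zero (left_ne_zero_of_mul h)
    have h2 := ih (right_ne_zero_of_mul h)
    simp only [Chain.degree, Chain.length, Chain.objs, wdeg]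
    omega

variable {X Y Z : Type*} [AddCommGroup X] [Module ℝ X] [AddCommGroup Y] [Module ℝ Y]
  [AddCommGroup Z] [Module ℝ Z]

/-- By multilinearity a chain enters only through `coef` and its objects. This translates sums over
lists of cuts into `conv`, as `sum_cuts` does for `ins`. -/
theorem sum_cutTwo (B : X →ₗ[ℝ] Y →ₗ[ℝ] Z) (F : Obj → List Obj → X) (G : Obj → List Obj → Y)
    {a b : Obj} (w : Chain (lineHom δ) a b) :
    (w.cutTwo.map fun t => B (coef t.2.1 • F a t.2.1.objs)
      (coef t.2.2 • G t.1 t.2.2.objs)).sum = coef w • conv B F G a w.objs := by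
  induction w generalizing F with
  | nil => simp [Chain.cutTwo, coef, conv, Chain.objs]
  | cons w p ih =>
    rename_i a b c n
    have h1 := ih (shift F a)
    simp only [Chain.cutTwo, List.map_cons, List.map_map, Function.comp_def, List.sum_cons, coef,
      Chain.objs]
    rw [conv_cons, smul_add, mul_comm, ← smul_smul (coef p) (w : ℝ) (conv _ _ _ _ _), smul_comm,
      ← h1, List.smul_sum, List.map_map]
    congr 1
    · simp
    · congr 2
      funext t
      simp only [Function.comp_def, shift, map_smul, LinearMap.smul_apply, smul_smul]
      congr 1
      ring

theorem sum_cuts {M : Obj → List Obj → ℝ} (hM : ∀ a, M a [] = 0) (F : Obj → List Obj → X)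
    {a b : Obj} (w : Chain (lineHom δ) a b) :
    (w.cuts.map fun t => ((-1 : ℝ) ^ wdeg (fun a b => δ a b - 1) a t.left.objs *
      (coef t.left * (coef t.mid * M t.c t.mid.objs) * coef t.right)) •
        F a (t.left.objs ++ t.d :: t.right.objs)).sum =
      coef w • ins (fun a b => δ a b - 1) M F a w.objs := by
  induction w generalizing F with
  | nil => simp [Chain.cuts, Chain.cutTwo, hM, ins, Chain.objs]
  | cons w p ih =>
    rename_i a b c n
    have h1 := ih (shift F a)
    have h2 := sum_cutTwo (LinearMap.lsmul ℝ X) M (shift F a) (Chain.cons w p)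
    rw [Chain.cuts_cons, List.map_append, List.sum_append, List.map_map, List.map_map]
    simp only [Function.comp_def, Chain.objs, coef, wdeg, List.nil_append, List.cons_append] at h2 ⊢
    rw [ins_cons, smul_add, ← h2]
    congr 1
    · congr 2
      funext t
      simp [shift, smul_smul, mul_comm]
    · rw [smul_smul, mul_right_comm, ← smul_smul, ← h1, List.smul_sum, List.map_map]
      congr 2
      funext t
      simp only [Function.comp_def, shift, smul_smul]
      rw [zpow_add₀ (by norm_num)]
      congr 1
      ring

end LineChains

theorem neg_one_zpow_congr {m n : ℤ} (h : Even (m - n)) : (-1 : ℝ) ^ m = (-1 : ℝ) ^ n := by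
  rw [← sub_add_cancel m n, zpow_add₀ (by norm_num), h.neg_one_zpow, one_mul]

/-! ### The transferred `A_∞`-category -/

namespace TransferData

variable {ι T : Type} [AddCommGroup T] [Module ℝ T] (D : TransferData ι T)

/-- The products of the transferred `A_∞`-category. -/
noncomputable def minimalM {a b : ι} (w : Chain (lineHom D.deg) a b) (r : ℤ) : lineHom D.deg a b r :=
  toLine D.deg a b r ((-1 : ℝ) ^ w.suspSign * (coef w * D.mu a w.objs))

/-- `toLine` returns zero in a wrong degree; nothing is lost, since the value there vanishes for
degree reasons. -/
theorem coe_minimalM {a b : ι} (w : Chain (lineHom D.deg) a b) {r : ℤ}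
    (hr : r = w.degree + (2 - w.length)) :
    (D.minimalM w r : ℝ) = (-1 : ℝ) ^ w.suspSign * (coef w * D.mu a w.objs) := by
  rw [minimalM, coe_toLine]
  split_ifs with h
  · rfl
  · rcases eq_or_ne (coef w) 0 with h0 | h0
    · simp [h0]
    rcases eq_or_ne (D.mu a w.objs) 0 with h1 | h1
    · simp [h1]
    have h2 := degree_of_coef_ne_zero h0
    have h3 := D.deg_of_mu_ne_zero h1
    rw [Chain.lastLetter_objs] at h3
    exact absurd (by rw [h3, hr]; change _ = wdeg (fun a b => D.deg a b - 1) _ _ + 2; omega) h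

theorem minimalM_degree {a b : ι} (w : Chain (lineHom D.deg) a b) (r : ℤ)
    (hr : r ≠ w.degree + (2 - w.length)) : D.minimalM w r = 0 := by
  ext1
  rw [minimalM, coe_toLine, ZeroMemClass.coe_zero]
  split_ifs with h
  · rcases eq_or_ne (coef w) 0 with h0 | h0
    · simp [h0]
    rcases eq_or_ne (D.mu a w.objs) 0 with h1 | h1
    · simp [h1]
    have h2 := degree_of_coef_ne_zero h0
    have h3 := D.deg_of_mu_ne_zero h1
    rw [Chain.lastLetter_objs] at h3
    exact absurd (by rw [h, h3]; change wdeg (fun a b => D.deg a b - 1) _ _ + 2 = _; omega) hr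
  · rfl

theorem suspSign_append_cons {a b c d : ι} {n : ℤ} (p : Chain (lineHom D.deg) a b)
    (x y : lineHom D.deg b c n) (q : Chain (lineHom D.deg) c d) :
    (p.append (.cons x q)).suspSign = (p.append (.cons y q)).suspSign := by
  simp only [Chain.suspSign_append, Chain.suspSign, Chain.length]

theorem minimal_relation {a b : ι} (w : Chain (lineHom D.deg) a b) (r : ℤ) :
    (w.cuts.map fun t =>
      (-1 : ℝ) ^ ((t.left.length + 1) * (t.mid.length + 1) + t.mid.length * t.left.degree) •
        D.minimalM (t.left.append
          (.cons (D.minimalM t.mid (t.mid.degree + (2 - t.mid.length))) t.right)) r).sum = 0 := by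
  have h := sum_cuts D.mu_nil D.mu w
  have h0 : ins (fun a b => D.deg a b - 1) D.mu D.mu a w.objs = 0 := D.ins_mu_mu a w.objs
  rw [h0, smul_zero] at h
  -- Up to one global sign, with exponent `length + 1 + suspSign` of the whole chain, the terms of
  -- the relation are those of the suspended relation.
  have h1 := congrArg (toLine D.deg a b r) (congrArg ((-1 : ℝ) ^ (w.length + 1 + w.suspSign) • ·) h)
  simp only [smul_zero, map_zero] at h1
  rw [map_smul, map_list_sum, List.map_map, List.smul_sum, List.map_map] at h1
  rw [← h1]
  congr 1
  refine List.map_congr_left fun t ht => ?_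
  simp only [Function.comp_apply, ← map_smul]
  rw [minimalM, ← map_smul]
  congr 1
  have hw := w.eq_append_of_mem_cuts t ht
  simp only [smul_eq_mul, coef_append, coef, Chain.objs_append, Chain.objs, coe_minimalM D t.mid rfl]
  rcases eq_or_ne (coef t.left) 0 with hl | hl
  · simp [hl]
  have hdeg := degree_of_coef_ne_zero hl
  rw [← hdeg, ← hw]
  simp only [Chain.suspSign_append, Chain.suspSign, DeRham.length_append, Chain.length]
  generalize D.mu a (t.left.objs ++ t.d :: t.right.objs) = A
  generalize D.mu t.c t.mid.objs = B
  generalize coef t.left = x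
  generalize coef t.mid = y
  generalize coef t.right = z
  generalize t.left.length = j
  generalize t.left.degree = g
  generalize t.left.suspSign = S₁
  generalize t.mid.length = k
  generalize t.mid.degree = g'
  generalize t.mid.suspSign = S₂
  generalize t.right.length = m
  generalize t.right.suspSign = S₃
  trans (-1 : ℝ) ^ ((j + 1) * (k + 1) + k * g + (S₁ + (m + 1) * (g - j) +
    (m * (g' + (2 - k) - 1) + S₃)) + S₂) * (x * (y * z) * (A * B))
  · rw [zpow_add₀ (by norm_num) _ S₂, zpow_add₀ (by norm_num) ((j + 1) * (k + 1) + k * g)]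
    ring
  · rw [neg_one_zpow_congr (n := j + (k + m) + 1 +
      (S₁ + (k + m) * (g - j) + (S₂ + m * (g' - k) + S₃)) + (g - j)), zpow_add₀ (by norm_num) _ (g - j)]
    · ring
    -- The two exponents differ by `2 j k`.
    · exact ⟨j * k, by ring⟩

/-- The transferred `A_∞`-category, with one-dimensional morphism spaces. -/
noncomputable def minimal : AInfCategory.{0, 0} ι where
  Hom := lineHom D.deg
  addCommGroup _ _ _ := inferInstance
  module _ _ _ := inferInstance
  m := D.minimalM
  m_nil a r := by
    rw [minimalM, Chain.objs, mu_nil, mul_zero, mul_zero, map_zero]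
  m_degree := D.minimalM_degree
  m_add p x y q r := by
    rw [minimalM, minimalM, minimalM, ← map_add, D.suspSign_append_cons p (x + y) x q,
      D.suspSign_append_cons p y x q]
    simp only [coef_append, coef, Chain.objs_append, Chain.objs, Submodule.coe_add]
    congr 1
    ring
  m_smul p k x q r := by
    rw [minimalM, minimalM, ← map_smul, D.suspSign_append_cons p (k • x) x q]
    simp only [coef_append, coef, Chain.objs_append, Chain.objs, Submodule.coe_smul, smul_eq_mul]
    congr 1
    ring
  relation := D.minimal_relation

end TransferData

/-! ### Sums over decompositions into blocks -/

section Blocks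

universe u u' v v'

variable {Obj : Type u} {Obj' : Type u'} {H : Obj → Obj → ℤ → Type v}
  {H' : Obj' → Obj' → ℤ → Type v'} {f : Obj → Obj'}
  (g : ∀ {a b : Obj}, Chain H a b → ∀ r : ℤ, H' (f a) (f b) r)

/-- The chain `g(q) ⊗ c`, where `g(q)` is taken in the degree which is preserved after
suspension. -/
def consBlock {a b : Obj} {c : Obj'} (q : Chain H a b) (t : Chain H' (f b) c) :
    Chain H' (f a) c :=
  .cons (g q (q.degree + (1 - q.length))) t

theorem one_le_length_of_mem_blocksAux {a b c : Obj} (acc : Chain H a b) (p : Chain H b c) :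
    ∀ t ∈ blocksAux (H' := H') g acc p, 1 ≤ t.length := by
  induction p generalizing a with
  | nil => simp [blocksAux, Chain.length]
  | cons w p ih =>
    intro t ht
    simp only [blocksAux, List.mem_append, List.mem_map] at ht
    rcases ht with ht | ⟨s, hs, rfl⟩
    · exact ih _ t ht
    · have := ih _ s hs
      simp only [Chain.length]
      omega

variable {X : Type*} [AddCommMonoid X]

/-- Only the decomposition into a single block has length one. -/
theorem sum_blocksAux_of_length_two {a b c : Obj} (K : Chain H' (f a) (f c) → X)
    (hK : ∀ t, 2 ≤ t.length → K t = 0) (acc : Chain H a b) (p : Chain H b c) :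
    ((blocksAux (H' := H') g acc p).map K).sum =
      K (consBlock g (acc.append p) (.nil _)) := by
  induction p with
  | nil =>
    rw [Chain.append_nil]
    exact add_zero _
  | cons w p ih =>
    rw [blocksAux, List.map_append, List.sum_append, ih K hK, Chain.append_assoc, List.map_map]
    simp only [Chain.append]
    rw [List.sum_eq_zero, add_zero]
    intro x hx
    obtain ⟨t, ht, rfl⟩ := List.mem_map.1 hx
    refine hK _ ?_
    have := one_le_length_of_mem_blocksAux g _ p t ht
    simp only [Chain.length]
    omega

/-- The de Rham category has no products beyond the second, so one or two blocks suffice. `cutTwo`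
also lists the cut with an empty last part, which is not a block decomposition; `hK'` makes it
harmless. -/
theorem sum_blocksAux_of_length_three {a b c : Obj} (K : Chain H' (f a) (f c) → X)
    (hK : ∀ t, 3 ≤ t.length → K t = 0)
    (hK' : ∀ {n : ℤ} (x : H' (f a) (f c) n),
      K (.cons x (consBlock g (.nil c) (.nil _))) = 0) (acc : Chain H a b)
    (p : Chain H b c) :
    ((blocksAux (H' := H') g acc p).map K).sum =
      K (consBlock g (acc.append p) (.nil _)) + (p.cutTwo.map fun t =>
        K (consBlock g (acc.append t.2.1) (consBlock g t.2.2 (.nil _)))).sum := by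
  induction p with
  | nil =>
    have h : K (consBlock g acc (consBlock g (.nil _) (.nil _))) = 0 := hK' _
    simp only [Chain.append_nil, Chain.cutTwo, List.map_cons, List.map_nil, List.sum_cons,
      List.sum_nil, h, add_zero]
    exact add_zero _
  | cons w p ih =>
    rw [blocksAux, List.map_append, List.sum_append, ih K hK hK', Chain.append_assoc, List.map_map,
      add_assoc, sum_blocksAux_of_length_two]
    · simp only [Chain.append, Chain.cutTwo, List.map_cons, List.map_map, List.sum_cons,
        Function.comp_def, Chain.append_assoc, Chain.append_nil]
      rw [add_comm (List.sum _)]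
      rfl
    · intro t ht
      refine hK _ ?_
      simp only [Chain.length]
      omega

theorem sum_blocks {a c : Obj} (K : Chain H' (f a) (f c) → X)
    (hK : ∀ t, 3 ≤ t.length → K t = 0)
    (hK₁ : ∀ {n : ℤ} (x : H' (f a) (f c) n),
      K (.cons x (consBlock g (.nil c) (.nil _))) = 0)
    (hK₂ : ∀ {n : ℤ} (x : H' (f a) (f c) n),
      K (consBlock g (.nil a) (.cons x (.nil _))) = 0)
    (w : Chain H a c) (hw : 1 ≤ w.length) :
    ((blocks (H' := H') g w).map K).sum = K (consBlock g w (.nil _)) +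
      (w.cutTwo.map fun t =>
        K (consBlock g t.2.1 (consBlock g t.2.2 (.nil _)))).sum := by
  cases w with
  | nil => simp [Chain.length] at hw
  | cons w p =>
    rw [blocks, sum_blocksAux_of_length_three g K hK hK₁]
    simp only [Chain.append, Chain.cutTwo, List.map_cons, List.map_map, List.sum_cons,
      Function.comp_def]
    rw [show K (consBlock g (.nil a) (consBlock g (.cons w p) (.nil _))) = 0 from hK₂ _, zero_add]

end Blocks

/-! ### The transfer data of the twisted de Rham category -/

/-- The differential forms on `ℝ`: pairs of a function and (the coefficient of) a one-form. -/
abbrev Forms : Type := 𝓢(ℝ, ℝ) × 𝓢(ℝ, ℝ)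

namespace Forms

/-- The wedge product. -/
noncomputable def mul : Forms →ₗ[ℝ] Forms →ₗ[ℝ] Forms :=
  LinearMap.mk₂ ℝ (fun x y => (mulS x.1 y.1, mulS x.1 y.2 + mulS x.2 y.1))
    (fun x x' y => by ext <;> simp [mulS_apply]; ring)
    (fun k x y => by ext <;> simp [mulS_apply])
    (fun x y y' => by ext <;> simp [mulS_apply]; ring)
    (fun k x y => by ext <;> simp [mulS_apply])

theorem mul_apply (x y : Forms) : mul x y = (mulS x.1 y.1, mulS x.1 y.2 + mulS x.2 y.1) := rfl

/-- The forms of degree `n`. -/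
def gr (n : ℤ) : Submodule ℝ Forms where
  carrier := {x | (n ≠ 0 → x.1 = 0) ∧ (n ≠ 1 → x.2 = 0)}
  add_mem' := fun {x y} hx hy => ⟨fun h => by simp [hx.1 h, hy.1 h], fun h => by simp [hx.2 h, hy.2 h]⟩
  zero_mem' := ⟨fun _ => rfl, fun _ => rfl⟩
  smul_mem' := fun k x hx => ⟨fun h => by simp [hx.1 h], fun h => by simp [hx.2 h]⟩

theorem mem_gr {n : ℤ} {x : Forms} : x ∈ gr n ↔ (n ≠ 0 → x.1 = 0) ∧ (n ≠ 1 → x.2 = 0) := Iff.rfl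

theorem gr_cases {n : ℤ} {x : Forms} (hx : x ∈ gr n) :
    (n = 0 ∧ x.2 = 0) ∨ (n = 1 ∧ x.1 = 0) ∨ x = 0 := by
  by_cases h0 : n = 0
  · exact .inl ⟨h0, hx.2 (by omega)⟩
  by_cases h1 : n = 1
  · exact .inr (.inl ⟨h1, hx.1 h0⟩)
  · exact .inr (.inr (Prod.ext (hx.1 h0) (hx.2 h1)))

theorem mul_mem {m n : ℤ} {x y : Forms} (hx : x ∈ gr m) (hy : y ∈ gr n) : mul x y ∈ gr (m + n) := by
  rcases gr_cases hx with ⟨rfl, h⟩ | ⟨rfl, h⟩ | rfl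
  · rcases gr_cases hy with ⟨rfl, h'⟩ | ⟨rfl, h'⟩ | rfl
    · simp [mul_apply, h, h', mem_gr]
    · simp [mul_apply, h, h', mem_gr]
    · simp
  · rcases gr_cases hy with ⟨rfl, h'⟩ | ⟨rfl, h'⟩ | rfl
    · simp [mul_apply, h, h', mem_gr]
    · simp [mul_apply, h, h', mem_gr]
    · simp
  · simp

theorem mul_assoc (x y z : Forms) : mul (mul x y) z = mul x (mul y z) := by
  ext <;> simp only [mul_apply, mulS_apply, add_apply] <;> ring

/-- The twisted differential. -/
noncomputable def d (p : ℝ[X]) : Forms →ₗ[ℝ] Forms :=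
  LinearMap.inr ℝ _ _ ∘ₗ (twistedDeriv p).toLinearMap ∘ₗ LinearMap.fst ℝ _ _

theorem d_apply (p : ℝ[X]) (x : Forms) : d p x = (0, twistedDeriv p x.1) := rfl

theorem d_mem {n : ℤ} {x : Forms} (p : ℝ[X]) (hx : x ∈ gr n) : d p x ∈ gr (n + 1) := by
  refine ⟨fun _ => rfl, fun h => ?_⟩
  rw [d_apply, hx.1 (by omega), map_zero]

theorem leibniz {n : ℤ} {x : Forms} (f g h : ℝ[X]) (y : Forms) (hx : x ∈ gr n) :
    d (f - h) (mul x y) = mul (d (f - g) x) y + (-1 : ℝ) ^ n • mul x (d (g - h) y) := by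
  rcases gr_cases hx with ⟨rfl, h0⟩ | ⟨rfl, h0⟩ | rfl
  · simp [mul_apply, d_apply, twistedDeriv_mulS f g h, add_comm]
  · simp [mul_apply, d_apply, h0]
  · simp

/-- The component of degree `r` of a form. -/
noncomputable def comp (r : ℤ) : Forms →ₗ[ℝ] formSpace r :=
  toForm r ∘ₗ if r = 0 then LinearMap.fst ℝ _ _ else LinearMap.snd ℝ _ _

theorem comp_apply (r : ℤ) (x : Forms) :
    comp r x = toForm r (if r = 0 then x.1 else x.2) := by
  unfold comp
  split_ifs <;> rfl

theorem coe_comp (r : ℤ) (x : Forms) :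
    (comp r x : 𝓢(ℝ, ℝ)) = if r = 0 then x.1 else if r = 1 then x.2 else 0 := by
  rw [comp_apply, coe_toForm]
  by_cases h0 : r = 0 <;> by_cases h1 : r = 1 <;> simp [h0, h1]

theorem comp_eq_zero {n r : ℤ} {x : Forms} (hx : x ∈ gr n) (h : r ≠ n) : comp r x = 0 := by
  ext1
  rw [coe_comp]
  split_ifs with h0 h1
  · exact hx.1 (by omega)
  · exact hx.2 (by omega)
  · rfl

theorem dForm_comp {n : ℤ} {x : Forms} (p : ℝ[X]) (hx : x ∈ gr n) (r : ℤ) :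
    dForm p (comp n x) r = comp r (d p x) := by
  ext1
  rw [coe_dForm, coe_comp, coe_comp, d_apply]
  rcases gr_cases hx with ⟨rfl, hx⟩ | ⟨rfl, hx⟩ | rfl
  · split_ifs <;> first | omega | simp_all
  · split_ifs <;> first | omega | simp_all
  · simp

theorem wedge_comp {m n : ℤ} {x y : Forms} (hx : x ∈ gr m) (hy : y ∈ gr n) (r : ℤ) :
    wedge (comp m x) (comp n y) r = comp r (mul x y) := by
  ext1
  rw [coe_wedge, coe_comp, coe_comp, coe_comp, mul_apply]
  rcases gr_cases hx with ⟨rfl, hx⟩ | ⟨rfl, hx⟩ | rfl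
  · rcases gr_cases hy with ⟨rfl, hy⟩ | ⟨rfl, hy⟩ | rfl
    · split_ifs <;> first | omega | simp_all
    · split_ifs <;> first | omega | simp_all
    · simp
  · rcases gr_cases hy with ⟨rfl, hy⟩ | ⟨rfl, hy⟩ | rfl
    · split_ifs <;> first | omega | simp_all
    · split_ifs <;> first | omega | simp_all
    · simp
  · simp

/-- The form of degree `n` with a given coefficient, as an element of `Forms`. -/
noncomputable def ofForm (n : ℤ) (φ : formSpace n) : Forms :=
  if n = 0 then (φ.1, 0) else (0, φ.1)

theorem ofForm_mem (n : ℤ) (φ : formSpace n) : ofForm n φ ∈ gr n := by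
  rcases degree_cases φ with rfl | rfl | rfl
  · exact ⟨fun h => absurd rfl h, fun _ => by simp [ofForm]⟩
  · exact ⟨fun _ => by simp [ofForm], fun h => absurd rfl h⟩
  · have : ofForm n (0 : formSpace n) = 0 := by
      unfold ofForm
      split_ifs <;> rfl
    rw [this]
    exact zero_mem _

theorem comp_ofForm (n : ℤ) (φ : formSpace n) : comp n (ofForm n φ) = φ := by
  ext1
  rw [coe_comp]
  rcases degree_cases φ with rfl | rfl | rfl
  · simp [ofForm]
  · simp [ofForm]
  · unfold ofForm
    split_ifs <;> rfl

theorem eq_of_comp_eq {n : ℤ} {x y : Forms} (hx : x ∈ gr n) (hy : y ∈ gr n)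
    (h : comp n x = comp n y) : x = y := by
  have h := congrArg Subtype.val h
  rw [coe_comp, coe_comp] at h
  rcases eq_or_ne n 0 with rfl | h0
  · exact Prod.ext (by simpa using h) ((hx.2 (by omega)).trans (hy.2 (by omega)).symm)
  rcases eq_or_ne n 1 with rfl | h1
  · exact Prod.ext ((hx.1 (by omega)).trans (hy.1 (by omega)).symm) (by simpa using h)
  · exact Prod.ext ((hx.1 h0).trans (hy.1 h0).symm) ((hx.2 h1).trans (hy.2 h1).symm)

end Forms

/-- A choice of a base point and of a bump function of integral one for every pair of lines. -/
structure Bumps (N : ℕ) where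
  point : Fin N → Fin N → ℝ
  bump : Fin N → Fin N → 𝓢(ℝ, ℝ)
  hasCompactSupport : ∀ a b, HasCompactSupport (bump a b)
  integral_eq_one : ∀ a b, ∫ x, bump a b x = 1

namespace LineConfig

variable {N : ℕ} (F : LineConfig N)

/-- The polynomial `f_a - f_b`, normalized to vanish at the critical point. -/
noncomputable def q (a b : Fin N) : ℝ[X] :=
  F.f a - F.f b - C ((F.f a - F.f b).eval (F.v a b).1)

theorem derivative_q (a b : Fin N) : (F.q a b).derivative = (F.f a - F.f b).derivative := by
  simp [q]

theorem twistedDeriv_q (a b : Fin N) : twistedDeriv (F.q a b) = twistedDeriv (F.f a - F.f b) := by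
  rw [twistedDeriv, twistedDeriv, derivative_q]

theorem eval_derivative_q (a b : Fin N) (x : ℝ) :
    (F.q a b).derivative.eval x = (F.t a - F.t b) * x + (F.s a - F.s b) := by
  rw [derivative_q, derivative_sub, eval_sub, F.eval_derivative, F.eval_derivative]
  ring

theorem concave_q {a b : Fin N} (h : F.t a < F.t b) : ConcaveQuadratic (F.q a b) :=
  ⟨_, _, sub_neg.2 h, F.eval_derivative_q a b⟩

/-- This includes `a = b`, where `q` vanishes: on rapidly decreasing forms the untwisted complex,
too, has its cohomology in degree one. -/
theorem convex_q {a b : Fin N} (h : ¬F.t a < F.t b) : ConvexQuadratic (F.q a b) := by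
  refine ⟨_, _, ?_, F.eval_derivative_q a b⟩
  rcases eq_or_ne a b with rfl | hab
  · exact .inr ⟨sub_self _, sub_self _⟩
  · exact .inl (sub_pos.2 (lt_of_le_of_ne (not_lt.1 h) (F.slope_ne a b hab).symm))

open Classical in
/-- The homotopy between the twisted de Rham complex and its cohomology. -/
noncomputable def solve (B : Bumps N) (a b : Fin N) : 𝓢(ℝ, ℝ) →ₗ[ℝ] 𝓢(ℝ, ℝ) :=
  if h : F.t a < F.t b then solveConcaveₗ (F.q a b) (F.concave_q h) (B.point a b)
  else solveConvexₗ (F.q a b) (F.convex_q h) (B.bump a b) (B.hasCompactSupport a b)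
    (B.integral_eq_one a b)

/-- The functional `u ↦ e^{-p(x)} u(x)`. -/
noncomputable def expEval (p : ℝ[X]) (x : ℝ) : 𝓢(ℝ, ℝ) →ₗ[ℝ] ℝ where
  toFun u := Real.exp (-p.eval x) * u x
  map_add' u v := by simp [mul_add]
  map_smul' k u := by simp [mul_left_comm]

open Classical in
/-- The projection of the twisted de Rham complex to its cohomology. -/
noncomputable def proj (B : Bumps N) (a b : Fin N) : Forms →ₗ[ℝ] ℝ :=
  if h : F.t a < F.t b then expEval (F.q a b) (B.point a b) ∘ₗ LinearMap.fst ℝ _ _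
  else expIntegral (F.q a b) (F.convex_q h) ∘ₗ LinearMap.snd ℝ _ _

open Classical in
/-- The cocycle representing the generator of the cohomology of the twisted de Rham complex. -/
noncomputable def cocycle (B : Bumps N) (a b : Fin N) : Forms :=
  if h : F.t a < F.t b then (solveConcave (F.q a b) (F.concave_q h) (B.point a b) 1 0, 0)
  else (0, expMul (F.q a b) (B.bump a b) (B.hasCompactSupport a b))

theorem proj_cocycle (B : Bumps N) (a b : Fin N) : F.proj B a b (F.cocycle B a b) = 1 := by
  by_cases h : F.t a < F.t b
  · simp only [proj, cocycle, h, dif_pos]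
    change Real.exp (-(F.q a b).eval _) * solveConcave _ (F.concave_q h) _ _ _ _ = 1
    rw [solveConcave_apply, exp_neg_mul_exp_mul]
    simp
  · simp only [proj, cocycle, h, dif_neg, not_false_eq_true]
    change ∫ x, Real.exp (-(F.q a b).eval x) * (Real.exp ((F.q a b).eval x) * B.bump a b x) = 1
    simp only [exp_neg_mul_exp_mul, B.integral_eq_one]

/-- The homotopy transfer data for the twisted de Rham complexes of a configuration of lines. -/
noncomputable def transferData (B : Bumps N) : TransferData (Fin N) Forms where
  mul := Forms.mul
  mul_assoc := Forms.mul_assoc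
  gr := Forms.gr
  mul_mem := Forms.mul_mem
  d a b := Forms.d (F.f a - F.f b)
  d_mem _ _ := Forms.d_mem _
  leibniz a b c := Forms.leibniz (F.f a) (F.f b) (F.f c)
  deg := F.deg
  e := F.cocycle B
  e_mem a b := by
    by_cases h : F.t a < F.t b
    · simp only [cocycle, deg, h, dif_pos, if_pos, Forms.mem_gr]
      simp
    · simp only [cocycle, deg, h, dif_neg, if_neg, not_false_eq_true, Forms.mem_gr]
      simp
  d_e a b := by
    rw [Forms.d_apply, ← F.twistedDeriv_q]
    by_cases h : F.t a < F.t b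
    · simp only [cocycle, h, dif_pos]
      rw [twistedDeriv_solveConcave]
      rfl
    · simp only [cocycle, h, dif_neg, not_false_eq_true, map_zero]
      rfl
  p := F.proj B
  p_d a b x := by
    rw [Forms.d_apply, ← F.twistedDeriv_q]
    by_cases h : F.t a < F.t b
    · simp [proj, h]
    · simp only [proj, h, dif_neg, not_false_eq_true]
      exact integral_exp_neg_mul_twistedDeriv _ (F.convex_q h) _
  p_eq_zero {n x} a b hx hn := by
    by_cases h : F.t a < F.t b
    · simp only [deg, h, if_pos] at hn
      simp [proj, h, hx.1 hn]
    · simp only [deg, h, if_neg, not_false_eq_true] at hn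
      simp [proj, h, hx.2 hn]
  h a b := LinearMap.inl ℝ _ _ ∘ₗ F.solve B a b ∘ₗ LinearMap.snd ℝ _ _
  h_mem {n x} a b hx := by
    refine ⟨fun h => ?_, fun _ => rfl⟩
    change F.solve B a b x.2 = 0
    rw [hx.2 (by omega), map_zero]
  homotopy a b x := by
    change (0, twistedDeriv (F.f a - F.f b) (F.solve B a b x.2)) +
      (F.solve B a b (twistedDeriv (F.f a - F.f b) x.1), 0) = _
    rw [← F.twistedDeriv_q]
    -- In the concave case `d h = 1` on one-forms and `h d` loses the value at the base point; in
    -- the convex case `h d = 1` on functions and `d h` loses the integral.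
    by_cases h : F.t a < F.t b
    · simp only [solve, proj, cocycle, h, dif_pos]
      refine Prod.ext ?_ ?_
      · change 0 + solveConcave _ (F.concave_q h) _ 0 _ = x.1 - (Real.exp (-(F.q a b).eval _) * x.1 _) •
          solveConcave _ (F.concave_q h) _ 1 0
        have h1 := solveConcave_twistedDeriv (F.q a b) (F.concave_q h) (B.point a b) x.1
        rw [zero_add]
        conv_rhs => enter [1]; rw [← h1]
        ext y
        simp only [solveConcave_apply, sub_apply, smul_apply, smul_eq_mul, zero_apply, mul_zero,
          intervalIntegral.integral_zero]
        ring
      · change twistedDeriv _ (solveConcave _ (F.concave_q h) _ 0 _) + 0 = x.2 - _ • 0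
        rw [twistedDeriv_solveConcave, smul_zero, add_zero, sub_zero]
    · simp only [solve, proj, cocycle, h, dif_neg, not_false_eq_true]
      refine Prod.ext ?_ ?_
      · change 0 + solveConvex _ (F.convex_q h) _ (B.hasCompactSupport a b) (B.integral_eq_one a b) _ = x.1 - _ • 0
        rw [solveConvex_twistedDeriv, smul_zero, zero_add, sub_zero]
      · change twistedDeriv _ (solveConvex _ (F.convex_q h) _
          (B.hasCompactSupport a b) (B.integral_eq_one a b) _) + 0 = x.2 - _
        rw [twistedDeriv_solveConvex, add_zero]
        rfl

/-- The minimal `A_∞`-category of a configuration of lines. -/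
noncomputable def minimal (B : Bumps N) : AInfCategory.{0, 0} (Fin N) := (F.transferData B).minimal

/-- The structure maps of the functor from the minimal `A_∞`-category to the de Rham category. -/
noncomputable def functorG (B : Bumps N) {a b : Fin N} (w : Chain (lineHom F.deg) a b) (r : ℤ) :
    formSpace r :=
  Forms.comp r (coef w • (F.transferData B).phi a w.objs)

theorem smul_phi_mem (B : Bumps N) {a b : Fin N} (w : Chain (lineHom F.deg) a b) :
    coef w • (F.transferData B).phi a w.objs ∈ Forms.gr (w.degree + (1 - w.length)) := by
  rcases eq_or_ne (coef w) 0 with h0 | h0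
  · rw [h0, zero_smul]
    exact zero_mem _
  · have h1 : (F.transferData B).phi a w.objs ∈ Forms.gr _ := (F.transferData B).phi_mem a w.objs
    have h2 := degree_of_coef_ne_zero h0
    refine Submodule.smul_mem _ _ ?_
    convert! h1 using 2
    change _ = wdeg (fun a b => F.deg a b - 1) a w.objs + 1
    omega

theorem coef_cons {a b c : Fin N} {n : ℤ} (x : lineHom F.deg a b n)
    (p : Chain (lineHom F.deg) b c) : coef (.cons x p) = (x : ℝ) * coef p := rfl

theorem functorG_nil (B : Bumps N) (a : Fin N) (r : ℤ) :
    F.functorG B (.nil a) r = 0 := by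
  rw [functorG, Chain.objs, TransferData.phi_nil, smul_zero, map_zero]

/-- The suspended products of the de Rham category on chains of length one. -/
theorem susp_m_one (B : Bumps N) {a b : Fin N} (w : Chain (lineHom F.deg) a b) (r : ℤ) :
    (-1 : ℝ) ^ (consBlock (f := id) (H' := DeRham.formHom N) (F.functorG B) w (.nil b)).suspSign •
      DeRham.m F (consBlock (f := id) (H' := DeRham.formHom N) (F.functorG B) w (.nil b)) r =
    Forms.comp r (coef w • (F.transferData B).d a b ((F.transferData B).phi a w.objs)) := by
  have h1 : (consBlock (f := id) (H' := DeRham.formHom N) (F.functorG B) w (.nil b)).suspSign = 0 := by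
    simp [consBlock, Chain.suspSign, Chain.length]
  rw [h1, zpow_zero, one_smul, ← map_smul]
  exact Forms.dForm_comp _ (F.smul_phi_mem B w) r

/-- The suspended products of the de Rham category on chains of length two. -/
theorem susp_m_two (B : Bumps N) {a b c : Fin N} (w : Chain (lineHom F.deg) a b)
    (w' : Chain (lineHom F.deg) b c) (r : ℤ) :
    (-1 : ℝ) ^ (consBlock (f := id) (H' := DeRham.formHom N) (F.functorG B) w
      (consBlock (f := id) (F.functorG B) w' (.nil c))).suspSign •
      DeRham.m F (consBlock (f := id) (H' := DeRham.formHom N) (F.functorG B) w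
        (consBlock (f := id) (F.functorG B) w' (.nil c))) r =
    Forms.comp r (Forms.mul (coef w • twist (F.transferData B).sdeg (F.transferData B).phi a w.objs)
      (coef w' • (F.transferData B).phi b w'.objs)) := by
  -- The first factor has the suspended degree of `w`, so the suspension sign is the one built into
  -- `twist`.
  have h1 : (consBlock (f := id) (H' := DeRham.formHom N) (F.functorG B) w
      (consBlock (f := id) (F.functorG B) w' (.nil c))).suspSign = w.degree - w.length := by
    simp [consBlock, Chain.suspSign, Chain.length]
    ring
  have h2 : DeRham.m F (consBlock (f := id) (H' := DeRham.formHom N) (F.functorG B) w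
        (consBlock (f := id) (F.functorG B) w' (.nil c))) r = Forms.comp r (Forms.mul
        (coef w • (F.transferData B).phi a w.objs) (coef w' • (F.transferData B).phi b w'.objs)) :=
    Forms.wedge_comp (F.smul_phi_mem B w) (F.smul_phi_mem B w') r
  rw [h1, h2, ← map_smul, ← LinearMap.smul_apply, ← map_smul]
  congr 3
  rw [twist, smul_comm]
  rcases eq_or_ne (coef w) 0 with h0 | h0
  · simp [h0]
  rw [degree_of_coef_ne_zero h0]
  rfl

theorem sum_susp_m_blocks (B : Bumps N) {a b : Fin N} (w : Chain (lineHom F.deg) a b) (r : ℤ) :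
    ((blocks (f := id) (H' := DeRham.formHom N) (F.functorG B) w).map
      fun c => (-1 : ℝ) ^ c.suspSign • DeRham.m F c r).sum =
    Forms.comp r (coef w • ((F.transferData B).d a b ((F.transferData B).phi a w.objs) +
      (F.transferData B).lam a w.objs)) := by
  cases w with
  | nil =>
    simp only [blocks, Chain.objs, TransferData.phi_nil, TransferData.lam_nil, map_zero, add_zero,
      smul_zero, List.map_cons, List.map_nil, List.sum_cons, List.sum_nil]
    exact smul_zero _
  | cons x p =>
    rw [sum_blocks (f := id) (H' := DeRham.formHom N) (F.functorG B)
      (fun c => (-1 : ℝ) ^ c.suspSign • DeRham.m F c r)]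
    · rw [F.susp_m_one B, smul_add, map_add]
      congr 1
      have h := congrArg (Forms.comp r) (sum_cutTwo Forms.mul
        (twist (F.transferData B).sdeg (F.transferData B).phi) (F.transferData B).phi
        (Chain.cons x p))
      refine Eq.trans ?_ h
      rw [map_list_sum, List.map_map]
      congr 1
      exact List.map_congr_left fun t _ => F.susp_m_two B _ _ r
    · intro t ht
      rw [DeRham.m_eq_zero F t (by omega) (by omega), smul_zero]
    · intro n x
      have h2 : ∀ m : ℤ, (-1 : ℝ) ^ m • wedge x
          (F.functorG B (.nil b) (0 + (1 - 0))) r = 0 := by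
        intro m
        rw [functorG_nil, wedge_zero, smul_zero]
      exact h2 _
    · intro n x
      have h2 : ∀ m : ℤ, (-1 : ℝ) ^ m • wedge
          (F.functorG B (.nil a) (0 + (1 - 0))) x r = 0 := by
        intro m
        rw [functorG_nil, zero_wedge, smul_zero]
      exact h2 _
    · have := DeRham.length_nonneg p
      simp only [Chain.length]
      omega

theorem functorG_append_cons (B : Bumps N) {a b c d : Fin N} {n : ℤ}
    (p : Chain (lineHom F.deg) a b) (x : lineHom F.deg b c n) (q : Chain (lineHom F.deg) c d)
    (r : ℤ) : F.functorG B (p.append (.cons x q)) r =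
      Forms.comp r ((coef p * (x * coef q)) • (F.transferData B).phi a (p.objs ++ c :: q.objs)) := by
  rw [functorG, coef_append, coef_cons, Chain.objs_append, Chain.objs]

theorem functor_relation (B : Bumps N) {a b : Fin N} (w : Chain (lineHom F.deg) a b) (r : ℤ) :
    ((blocks (f := id) (H' := DeRham.formHom N) (F.functorG B) w).map
      fun c => (-1 : ℝ) ^ c.suspSign • DeRham.m F c r).sum =
      (w.cuts.map fun t => (-1 : ℝ) ^ (t.left.degree - t.left.length) •
        F.functorG B (t.left.append
          (.cons ((-1 : ℝ) ^ t.mid.suspSign •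
            (F.transferData B).minimalM t.mid (t.mid.degree + (2 - t.mid.length))) t.right)) r).sum := by
  have hd := (F.transferData B).d_phi_add_lam a w.objs
  rw [Chain.lastLetter_objs] at hd
  rw [sum_susp_m_blocks, hd]
  have h := congrArg (Forms.comp r) (sum_cuts (F.transferData B).mu_nil (F.transferData B).phi w)
  refine h.symm.trans ?_
  rw [map_list_sum, List.map_map]
  congr 1
  refine List.map_congr_left fun t _ => ?_
  refine Eq.trans ?_ (congrArg _ (F.functorG_append_cons B t.left _ t.right r).symm)
  rw [Function.comp_apply, ← map_smul]
  congr 1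
  rw [Submodule.coe_smul, smul_eq_mul]
  have hc : ((F.transferData B).minimalM t.mid (t.mid.degree + (2 - t.mid.length)) : ℝ) =
      (-1 : ℝ) ^ t.mid.suspSign * (coef t.mid * (F.transferData B).mu t.c t.mid.objs) :=
    TransferData.coe_minimalM (F.transferData B) t.mid rfl
  refine Eq.trans ?_ (congrArg (fun z : ℝ => (-1 : ℝ) ^ (t.left.degree - t.left.length) •
    (coef t.left * ((-1 : ℝ) ^ t.mid.suspSign * z * coef t.right)) •
      (F.transferData B).phi a (t.left.objs ++ t.d :: t.right.objs)) hc.symm)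
  rw [smul_smul, ← mul_assoc ((-1 : ℝ) ^ t.mid.suspSign), neg_one_zpow_mul_self, one_mul]
  rcases eq_or_ne (coef t.left) 0 with h0 | h0
  · simp [h0]
  rw [degree_of_coef_ne_zero h0, mul_assoc (coef t.left)]

theorem functorG_add (B : Bumps N) {a b c d : Fin N} {n : ℤ} (p : Chain (lineHom F.deg) a b)
    (x y : lineHom F.deg b c n) (q : Chain (lineHom F.deg) c d) (r : ℤ) :
    F.functorG B (p.append (.cons (x + y) q)) r =
      F.functorG B (p.append (.cons x q)) r + F.functorG B (p.append (.cons y q)) r := by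
  rw [functorG_append_cons, functorG_append_cons, functorG_append_cons, ← map_add, ← add_smul,
    Submodule.coe_add]
  congr 2
  ring

theorem functorG_smul (B : Bumps N) {a b c d : Fin N} {n : ℤ} (p : Chain (lineHom F.deg) a b)
    (k : ℝ) (x : lineHom F.deg b c n) (q : Chain (lineHom F.deg) c d) (r : ℤ) :
    F.functorG B (p.append (.cons (k • x) q)) r = k • F.functorG B (p.append (.cons x q)) r := by
  rw [functorG_append_cons, functorG_append_cons, ← map_smul, smul_smul, Submodule.coe_smul,
    smul_eq_mul]
  congr 2
  ring

/-- The functor from the minimal `A_∞`-category to the de Rham category. -/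
noncomputable def functor (B : Bumps N) : AInfFunctor (F.minimal B) (deRham F) where
  obj := id
  g := F.functorG B
  g_nil := F.functorG_nil B
  g_degree w _ hr := Forms.comp_eq_zero (F.smul_phi_mem B w) hr
  g_add := F.functorG_add B
  g_smul := F.functorG_smul B
  relation w r := F.functor_relation B w r

theorem minimal_diff (B : Bumps N) {a b : Fin N} {n : ℤ} (x : (F.minimal B).Hom a b n) :
    (F.minimal B).diff x = 0 := by
  have h : (F.transferData B).mu a [b] = 0 := TransferData.mu_singleton _ a b
  change toLine F.deg a b (n + 1) (_ * (_ * (F.transferData B).mu a [b])) = 0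
  rw [h, mul_zero, mul_zero, map_zero]

theorem functorG_single (B : Bumps N) {a b : Fin N} {n : ℤ} (x : lineHom F.deg a b n) (r : ℤ) :
    F.functorG B (.cons x (.nil b)) r = Forms.comp r ((x : ℝ) • F.cocycle B a b) := by
  rw [functorG, coef_cons, coef, mul_one]
  rfl

/-- The projection kills exact forms and takes the value one on the cocycle. -/
theorem eq_zero_of_functorG_eq (B : Bumps N) (a b : Fin N) (n : ℤ) (x : lineHom F.deg a b (n + 1))
    (y : formSpace n)
    (hy : dForm (F.f a - F.f b) y (n + 1) = F.functorG B (.cons x (.nil b)) (n + 1)) : x = 0 := by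
  ext1
  by_contra hx
  have hn := eq_of_coe_ne_zero hx
  have h1 := Forms.dForm_comp (F.f a - F.f b) (Forms.ofForm_mem n y) (n + 1)
  rw [Forms.comp_ofForm, hy, functorG_single] at h1
  have h2 : (F.cocycle B a b) ∈ Forms.gr (n + 1) := by
    rw [hn]
    exact (F.transferData B).e_mem a b
  have h3 := Forms.eq_of_comp_eq (Submodule.smul_mem _ _ h2)
    (Forms.d_mem _ (Forms.ofForm_mem n y)) h1
  have h4 := congrArg (F.proj B a b) h3
  have h5 : F.proj B a b (Forms.d (F.f a - F.f b) (Forms.ofForm n y)) = 0 :=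
    (F.transferData B).p_d a b _
  rw [map_smul, proj_cocycle, h5, smul_eq_mul, mul_one] at h4
  exact hx h4

/-- For a closed form the homotopy identity reads `y = p(y) e + d (h y)`. -/
theorem exists_functorG_add (B : Bumps N) (a b : Fin N) (n : ℤ) (y : formSpace (n + 1))
    (hy : dForm (F.f a - F.f b) y (n + 1 + 1) = 0) :
    ∃ (x : lineHom F.deg a b (n + 1)) (z : formSpace n),
      y = F.functorG B (.cons x (.nil b)) (n + 1) + dForm (F.f a - F.f b) z (n + 1) := by
  set D := F.transferData B
  set Y := Forms.ofForm (n + 1) y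
  have hY : Y ∈ Forms.gr (n + 1) := Forms.ofForm_mem _ y
  have hdY : Forms.d (F.f a - F.f b) Y = 0 := by
    have h1 := Forms.dForm_comp (F.f a - F.f b) hY (n + 1 + 1)
    rw [Forms.comp_ofForm, hy] at h1
    exact Forms.eq_of_comp_eq (Forms.d_mem _ hY) (zero_mem _) (by rw [← h1, map_zero])
  have h2 : Forms.d (F.f a - F.f b) (D.h a b Y) + D.h a b (Forms.d (F.f a - F.f b) Y) =
    Y - F.proj B a b Y • F.cocycle B a b := D.homotopy a b Y
  rw [hdY, map_zero, add_zero] at h2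
  have hh : D.h a b Y ∈ Forms.gr n := by
    have := D.h_mem a b hY
    rwa [add_sub_cancel_right] at this
  refine ⟨toLine F.deg a b (n + 1) (F.proj B a b Y), Forms.comp n (D.h a b Y), ?_⟩
  rw [Forms.dForm_comp _ hh, functorG_single, h2, coe_toLine, ← map_add]
  have h3 : (if n + 1 = F.deg a b then F.proj B a b Y else 0) = F.proj B a b Y := by
    split_ifs with h
    · rfl
    · exact (D.p_eq_zero a b hY h).symm
  rw [h3, add_sub_cancel, Forms.comp_ofForm]

theorem functor_isHomotopyEquivalence (B : Bumps N) :
    (F.functor B).IsHomotopyEquivalence where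
  injective a b n x _ h := by
    obtain ⟨y, hy⟩ := h
    exact ⟨0, (F.minimal_diff B _).trans (F.eq_zero_of_functorG_eq B a b n x y hy).symm⟩
  surjective a b n y h := by
    obtain ⟨x, z, hxz⟩ := F.exists_functorG_add B a b n y h
    exact ⟨x, F.minimal_diff B _, z, hxz⟩

end LineConfig

/-! ### Arrangements of lines -/

/-- Lines `y = t_p x + s_p` in general position, together with real numbers `y_{pq}` which have
pairwise distinct values on distinct unordered pairs and are ordered compatibly with the first
coordinates of the intersection points of the lines. -/
structure Arrangement (ι : Type*) where
  t : ι → ℝ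
  s : ι → ℝ
  y : ι → ι → ℝ
  t_ne : ∀ p q, p ≠ q → t p ≠ t q
  no_three : ∀ p q r, p ≠ q → q ≠ r → p ≠ r → ∀ z, t p * z + s p = t q * z + s q →
    t q * z + s q ≠ t r * z + s r
  y_symm : ∀ p q, y p q = y q p
  y_ne : ∀ p q p' q', p ≠ q → p' ≠ q' → y p q = y p' q' → (p = p' ∧ q = q') ∨ (p = q' ∧ q = p')
  y_lt : ∀ p q p' q', p ≠ q → p' ≠ q' → (s q - s p) / (t p - t q) < (s q' - s p') / (t p' - t q') →
    y p q < y p' q'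

namespace Arrangement

variable {ι : Type*} (G : Arrangement ι)

/-- The affine function whose graph is a line of the arrangement. -/
def ln (p : ι) (z : ℝ) : ℝ := G.t p * z + G.s p

/-- The first coordinate of the intersection point of two lines. -/
noncomputable def x (p q : ι) : ℝ := (G.s q - G.s p) / (G.t p - G.t q)

/-- The arrangement rotated by a half turn. -/
def rot : Arrangement ι where
  t := G.t
  s p := -G.s p
  y p q := -G.y p q
  t_ne := G.t_ne
  no_three p q r hpq hqr hpr z h h' :=
    G.no_three p q r hpq hqr hpr (-z) (by linarith) (by linarith)
  y_symm p q := by rw [G.y_symm]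
  y_ne p q p' q' h h' e := G.y_ne p q p' q' h h' (neg_injective e)
  y_lt p q p' q' h h' e := by
    refine neg_lt_neg (G.y_lt p' q' p q h' h ?_)
    rw [← neg_lt_neg_iff, ← neg_div, ← neg_div]
    convert! e using 2 <;> ring

theorem ln_rot (p : ι) (z : ℝ) : G.rot.ln p z = -G.ln p (-z) := by
  simp only [ln, rot]
  ring

theorem x_rot (p q : ι) : G.rot.x p q = -G.x p q := by
  simp only [x, rot]
  rw [← neg_div]
  congr 1
  ring

theorem rot_rot : G.rot.rot = G := by
  simp [rot]

variable {G}

theorem x_symm (p q : ι) : G.x p q = G.x q p := by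
  rw [x, x, ← neg_div_neg_eq]
  congr 1 <;> ring

theorem ln_sub_ln {p q : ι} (h : p ≠ q) (z : ℝ) :
    G.ln p z - G.ln q z = (G.t p - G.t q) * (z - G.x p q) := by
  have h0 : G.t p - G.t q ≠ 0 := sub_ne_zero.2 (G.t_ne p q h)
  rw [mul_sub, x, mul_div_cancel₀ _ h0, ln, ln]
  ring

theorem ln_x {p q : ι} (h : p ≠ q) : G.ln p (G.x p q) = G.ln q (G.x p q) := by
  have := G.ln_sub_ln h (G.x p q)
  rw [sub_self, mul_zero] at this
  linarith

theorem ne_of_t_lt {p q : ι} (h : G.t p < G.t q) : p ≠ q := by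
  rintro rfl
  exact lt_irrefl _ h

theorem le_x_iff {p q : ι} (h : G.t p < G.t q) {z : ℝ} :
    z ≤ G.x p q ↔ G.ln q z ≤ G.ln p z := by
  have h1 := G.ln_sub_ln (ne_of_t_lt h) z
  rw [← sub_nonneg, ← sub_nonneg (a := G.ln p z), h1]
  constructor
  · intro h2
    nlinarith
  · intro h2
    by_contra h3
    nlinarith

theorem x_le_iff {p q : ι} (h : G.t p < G.t q) {z : ℝ} :
    G.x p q ≤ z ↔ G.ln p z ≤ G.ln q z := by
  have h1 := G.ln_sub_ln (ne_of_t_lt h) z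
  rw [← sub_nonneg, ← sub_nonpos (a := G.ln p z), h1]
  constructor
  · intro h2
    nlinarith
  · intro h2
    by_contra h3
    nlinarith

theorem lt_x_iff {p q : ι} (h : G.t p < G.t q) {z : ℝ} :
    z < G.x p q ↔ G.ln q z < G.ln p z := by
  rw [← not_le, x_le_iff h, not_le]

theorem x_lt_iff {p q : ι} (h : G.t p < G.t q) {z : ℝ} :
    G.x p q < z ↔ G.ln p z < G.ln q z := by
  rw [← not_le, le_x_iff h, not_le]

/-- The point `v_{pq}` does not lie on any third line. -/
theorem ln_x_ne {p q r : ι} (hpq : p ≠ q) (hqr : q ≠ r) (hpr : p ≠ r) :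
    G.ln q (G.x p q) ≠ G.ln r (G.x p q) :=
  G.no_three p q r hpq hqr hpr _ (ln_x hpq)

theorem x_ne {p q r : ι} (hpq : p ≠ q) (hqr : q ≠ r) (hpr : p ≠ r) : G.x p q ≠ G.x q r := by
  intro h
  have h1 := ln_x (G := G) hqr
  rw [← h] at h1
  exact ln_x_ne hpq hqr hpr h1

/-- Two intersection points on a common line have distinct first coordinates, so the perturbation
cannot change their order. Ties, broken by `y`, occur only between pairs without a common line. -/
theorem y_lt_iff {p q r : ι} (hpq : p ≠ q) (hqr : q ≠ r) (hpr : p ≠ r) :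
    G.y p q < G.y q r ↔ G.x p q < G.x q r := by
  constructor
  · intro h
    refine lt_of_le_of_ne (not_lt.1 fun h' => ?_) (x_ne hpq hqr hpr)
    exact lt_asymm h (G.y_lt _ _ _ _ hqr hpq h')
  · exact G.y_lt _ _ _ _ hpq hqr

theorem y_lt_iff' {p q r : ι} (hpq : p ≠ q) (hqr : q ≠ r) (hpr : p ≠ r) :
    G.y q r < G.y p q ↔ G.x q r < G.x p q := by
  have := y_lt_iff (G := G) hqr.symm hpq.symm hpr.symm
  rwa [G.y_symm r q, G.y_symm q p, x_symm r q, x_symm q p] at this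

theorem x_le_of_y_le {p q p' q' : ι} (h : p ≠ q) (h' : p' ≠ q') (hy : G.y p q ≤ G.y p' q') :
    G.x p q ≤ G.x p' q' :=
  not_lt.1 fun hx => not_lt.2 hy (G.y_lt _ _ _ _ h' h hx)

end Arrangement

/-! ### Convex regions which are open to the right. -/

namespace Arrangement

variable {ι : Type*} (G : Arrangement ι)

/-- The first coordinate of the intersection point of two consecutive lines of a sequence. -/
noncomputable def vx (a : ℕ → ι) (e : ℕ) : ℝ := G.x (a e) (a (e + 1))

/-- The perturbed first coordinate of the intersection point of two consecutive lines of a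
sequence. -/
def vy (a : ℕ → ι) (e : ℕ) : ℝ := G.y (a e) (a (e + 1))

/-- The intersection points of consecutive lines among `a i, …, a (m + 1)` are, in this order, the
vertices of a convex region which is open to the right and whose leftmost vertex is the
intersection point of `a j` and `a (j + 1)`. -/
structure OpenRightAt (a : ℕ → ι) (i m j : ℕ) : Prop where
  le_left : i ≤ j
  le_right : j ≤ m
  ascent : G.t (a j) < G.t (a (j + 1))
  descent : ∀ l, i ≤ l → l ≤ m → l ≠ j → G.t (a (l + 1)) < G.t (a l)
  lower : ∀ e l, i ≤ e → e ≤ m → i ≤ l → l ≤ j → G.ln (a l) (G.vx a e) ≤ G.ln (a e) (G.vx a e)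
  upper : ∀ e l, i ≤ e → e ≤ m → j < l → l ≤ m + 1 → G.ln (a e) (G.vx a e) ≤ G.ln (a l) (G.vx a e)

/-- The intersection points of consecutive lines among `a i, …, a (m + 1)` are, in this order, the
vertices of a convex region which is open to the right. -/
def OpenRight (a : ℕ → ι) (i m : ℕ) : Prop := ∃ j, G.OpenRightAt a i m j

/-- The region bounded by the lines `a i, …, a (m + 1)` is open to the right, and the vertical line
through `z` meets it to the right of all vertices. -/
structure Right (a : ℕ → ι) (i m : ℕ) (z : ℝ) : Prop where
  openRight : G.OpenRight a i m
  first_lt : G.vy a i < z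
  last_lt : G.vy a m < z
  lt_of_gt : G.t (a (m + 1)) < G.t (a i) → z < G.y (a i) (a (m + 1))
  lt_of_lt : G.t (a i) < G.t (a (m + 1)) → G.y (a i) (a (m + 1)) < z

variable {G} {a : ℕ → ι} {i m j : ℕ}

theorem vx_rot (e : ℕ) : G.rot.vx a e = -G.vx a e := G.x_rot _ _

theorem vy_rot (e : ℕ) : G.rot.vy a e = -G.vy a e := rfl

theorem ln_vx {e : ℕ} (h : a e ≠ a (e + 1)) : G.ln (a (e + 1)) (G.vx a e) = G.ln (a e) (G.vx a e) :=
  (ln_x h).symm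

theorem ne_of_injOn (ha : Set.InjOn a (Set.Icc i (m + 1))) {p q : ℕ} (hp : i ≤ p) (hq : i ≤ q)
    (hp' : p ≤ m + 1) (hq' : q ≤ m + 1) (h : p ≠ q) : a p ≠ a q :=
  fun e => h (ha ⟨hp, hp'⟩ ⟨hq, hq'⟩ e)

namespace OpenRightAt

/-- The vertex `e + 1` lies on or above the line `a e`, whose slope exceeds that of `a (e + 1)`;
hence it is to the left of the intersection of these lines, which is the vertex `e`. -/
theorem vx_lower (h : G.OpenRightAt a i m j) (ha : Set.InjOn a (Set.Icc i (m + 1))) {e : ℕ}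
    (h1 : i ≤ e) (h2 : e < j) : G.vx a (e + 1) < G.vx a e := by
  have hj := h.le_right
  have ht := h.descent e h1 (by omega) (by omega)
  refine lt_of_le_of_ne ?_ (x_ne (ne_of_injOn ha (by omega) (by omega) (by omega) (by omega)
    (by omega)) (ne_of_injOn ha (by omega) (by omega) (by omega) (by omega)
    (by omega)) (ne_of_injOn ha (by omega) (by omega) (by omega) (by omega) (by omega))).symm
  rw [vx, vx, x_symm (a e), le_x_iff ht]
  exact h.lower (e + 1) e (by omega) (by omega) h1 (by omega)

theorem vx_upper (h : G.OpenRightAt a i m j) (ha : Set.InjOn a (Set.Icc i (m + 1))) {e : ℕ}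
    (h1 : j ≤ e) (h2 : e < m) : G.vx a e < G.vx a (e + 1) := by
  have hj := h.le_left
  have ht := h.descent (e + 1) (by omega) (by omega) (by omega)
  refine lt_of_le_of_ne ?_ (x_ne (ne_of_injOn ha (by omega) (by omega) (by omega) (by omega)
    (by omega)) (ne_of_injOn ha (by omega) (by omega) (by omega) (by omega)
    (by omega)) (ne_of_injOn ha (by omega) (by omega) (by omega) (by omega) (by omega)))
  rw [vx, vx, x_symm (a (e + 1)), le_x_iff ht]
  refine le_trans (le_of_eq (ln_vx ?_)) (h.upper e (e + 2) (by omega) (by omega) (by omega) (by omega))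
  exact ne_of_injOn ha (by omega) (by omega) (by omega) (by omega) (by omega)

theorem vy_lower (h : G.OpenRightAt a i m j) (ha : Set.InjOn a (Set.Icc i (m + 1))) {e : ℕ}
    (h1 : i ≤ e) (h2 : e < j) : G.vy a (e + 1) < G.vy a e := by
  have hj := h.le_right
  refine (y_lt_iff' ?_ ?_ ?_).2 (h.vx_lower ha h1 h2) <;>
  exact ne_of_injOn ha (by omega) (by omega) (by omega) (by omega) (by omega)

theorem vy_upper (h : G.OpenRightAt a i m j) (ha : Set.InjOn a (Set.Icc i (m + 1))) {e : ℕ}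
    (h1 : j ≤ e) (h2 : e < m) : G.vy a e < G.vy a (e + 1) := by
  have hj := h.le_left
  refine (y_lt_iff ?_ ?_ ?_).2 (h.vx_upper ha h1 h2) <;>
  exact ne_of_injOn ha (by omega) (by omega) (by omega) (by omega) (by omega)

theorem vx_le_first (h : G.OpenRightAt a i m j) (ha : Set.InjOn a (Set.Icc i (m + 1))) {e : ℕ}
    (h1 : i ≤ e) (h2 : e ≤ j) : G.vx a e ≤ G.vx a i := by
  induction e, h1 using Nat.le_induction with
  | base => exact le_rfl
  | succ e he ih => exact (h.vx_lower ha he (by omega)).le.trans (ih (by omega))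

theorem vx_le_last (h : G.OpenRightAt a i m j) (ha : Set.InjOn a (Set.Icc i (m + 1))) {e : ℕ}
    (h1 : j ≤ e) (h2 : e ≤ m) : G.vx a e ≤ G.vx a m := by
  induction h2 using Nat.decreasingInduction with
  | self => exact le_rfl
  | of_succ e he ih => exact (h.vx_upper ha h1 he).le.trans (ih (by omega))

theorem vy_le_first (h : G.OpenRightAt a i m j) (ha : Set.InjOn a (Set.Icc i (m + 1))) {e : ℕ}
    (h1 : i ≤ e) (h2 : e ≤ j) : G.vy a e ≤ G.vy a i := by
  induction e, h1 using Nat.le_induction with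
  | base => exact le_rfl
  | succ e he ih => exact (h.vy_lower ha he (by omega)).le.trans (ih (by omega))

theorem vy_le_last (h : G.OpenRightAt a i m j) (ha : Set.InjOn a (Set.Icc i (m + 1))) {e : ℕ}
    (h1 : j ≤ e) (h2 : e ≤ m) : G.vy a e ≤ G.vy a m := by
  induction h2 using Nat.decreasingInduction with
  | self => exact le_rfl
  | of_succ e he ih => exact (h.vy_upper ha h1 he).le.trans (ih (by omega))

theorem vx_le (h : G.OpenRightAt a i m j) (ha : Set.InjOn a (Set.Icc i (m + 1))) {e : ℕ}
    (h1 : i ≤ e) (h2 : e ≤ m) {z : ℝ} (hi : G.vx a i ≤ z) (hm : G.vx a m ≤ z) : G.vx a e ≤ z := by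
  rcases le_total e j with h3 | h3
  · exact (h.vx_le_first ha h1 h3).trans hi
  · exact (h.vx_le_last ha h3 h2).trans hm

theorem vy_lt (h : G.OpenRightAt a i m j) (ha : Set.InjOn a (Set.Icc i (m + 1))) {e : ℕ}
    (h1 : i ≤ e) (h2 : e ≤ m) {z : ℝ} (hi : G.vy a i < z) (hm : G.vy a m < z) : G.vy a e < z := by
  rcases le_total e j with h3 | h3
  · exact (h.vy_le_first ha h1 h3).trans_lt hi
  · exact (h.vy_le_last ha h3 h2).trans_lt hm

/-- To the right of all vertices, the first line is the highest one among those bounding the region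
from below. -/
theorem ln_le_first (h : G.OpenRightAt a i m j) (ha : Set.InjOn a (Set.Icc i (m + 1))) {z : ℝ}
    (hi : G.vx a i ≤ z) {l : ℕ} (h1 : i ≤ l) (h2 : l ≤ j) : G.ln (a l) z ≤ G.ln (a i) z := by
  have hj := h.le_right
  induction l, h1 using Nat.le_induction with
  | base => exact le_rfl
  | succ e he ih =>
    refine le_trans ?_ (ih (by omega))
    have ht := h.descent e he (by omega) (by omega)
    rw [← x_le_iff ht, x_symm]
    exact (h.vx_le_first ha he (by omega)).trans hi

/-- To the right of all vertices, the last line is the lowest one among those bounding the region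
from above. -/
theorem last_le_ln (h : G.OpenRightAt a i m j) (ha : Set.InjOn a (Set.Icc i (m + 1))) {z : ℝ}
    (hm : G.vx a m ≤ z) {l : ℕ} (h1 : j < l) (h2 : l ≤ m + 1) :
    G.ln (a (m + 1)) z ≤ G.ln (a l) z := by
  have hj := h.le_left
  induction h2 using Nat.decreasingInduction with
  | self => exact le_rfl
  | of_succ e he ih =>
    refine le_trans (ih (by omega)) ?_
    have ht := h.descent e (by omega) (by omega) (by omega)
    rw [← x_le_iff ht, x_symm]
    exact (h.vx_le_last ha (by omega) (by omega)).trans hm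

theorem last_lt_first (h : G.OpenRightAt a i m j) (ha : Set.InjOn a (Set.Icc i (m + 1)))
    (h1 : i < m) (h2 : m = j) : G.vy a m < G.vy a i := by
  subst h2
  obtain ⟨m, rfl⟩ : ∃ m', m = m' + 1 := ⟨m - 1, by omega⟩
  exact (h.vy_lower ha (e := m) (by omega) (by omega)).trans_le (h.vy_le_first ha (by omega) (by omega))

theorem first_lt_last (h : G.OpenRightAt a i m j) (ha : Set.InjOn a (Set.Icc i (m + 1)))
    (h1 : i < m) (h2 : i = j) : G.vy a i < G.vy a m := by
  subst h2
  exact (h.vy_upper ha (e := i) (by omega) (by omega)).trans_le (h.vy_le_last ha (by omega) (by omega))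

end OpenRightAt

end Arrangement

/-! ### Adding and removing an outer line of an open region. -/

namespace Arrangement

variable {ι : Type*} {G : Arrangement ι} {a : ℕ → ι} {i m j : ℕ}

/-- The points `v_{pq}` and `v_{qr}` lie on `q`, so comparing their perturbed coordinates tells, for
either order of the slopes, whether `v_{qr}` is below the line `p`. This decodes the last two
conditions in `Right`; `ln_lt_iff_of_upper` is the counterpart above `p`. -/
theorem ln_lt_iff_of_lower {p q r : ι} (hpq : p ≠ q) (hqr : q ≠ r) (hpr : p ≠ r) :
    ((G.t p < G.t q → G.y q r < G.y q p) ∧ (G.t q < G.t p → G.y q p < G.y q r)) ↔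
      G.ln q (G.x q r) < G.ln p (G.x q r) := by
  rcases lt_or_gt_of_ne (G.t_ne p q hpq) with h | h
  · simp only [h, not_lt_of_gt h, true_imp_iff, false_imp_iff, and_true]
    rw [← lt_x_iff h, G.y_symm q p, y_lt_iff' hpq hqr hpr]
  · simp only [h, not_lt_of_gt h, true_imp_iff, false_imp_iff, true_and]
    rw [← x_lt_iff h, G.y_symm q p, y_lt_iff hpq hqr hpr, x_symm]

theorem ln_lt_iff_of_upper {p q r : ι} (hpq : p ≠ q) (hqr : q ≠ r) (hpr : p ≠ r) :
    ((G.t q < G.t p → G.y q r < G.y p q) ∧ (G.t p < G.t q → G.y p q < G.y q r)) ↔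
      G.ln p (G.x q r) < G.ln q (G.x q r) := by
  rcases lt_or_gt_of_ne (G.t_ne p q hpq) with h | h
  · simp only [h, not_lt_of_gt h, true_imp_iff, false_imp_iff, true_and]
    rw [← x_lt_iff h, y_lt_iff hpq hqr hpr]
  · simp only [h, not_lt_of_gt h, true_imp_iff, false_imp_iff, and_true]
    rw [← lt_x_iff h, y_lt_iff' hpq hqr hpr, x_symm q p]

theorem vx_le_of_vy_lt {e e' : ℕ} (h : a e ≠ a (e + 1)) (h' : a e' ≠ a (e' + 1))
    (hy : G.vy a e < G.vy a e') : G.vx a e ≤ G.vx a e' := x_le_of_y_le h h' hy.le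

/-- The new vertex lies on the old last line, beyond all old vertices and above the first line
(`hsep`). There the first line is the highest lower one and the last line the lowest upper one, so
the new vertex satisfies all inequalities. The new line has smaller slope, hence passes above the
old vertices, which lie to its left. -/
theorem OpenRight.of_right_last (him : i ≤ m) (ha : Set.InjOn a (Set.Icc i (m + 1 + 1)))
    (ht : G.t (a (m + 1 + 1)) < G.t (a (m + 1))) (h : G.Right a i m (G.vy a (m + 1))) :
    G.OpenRight a i (m + 1) := by
  have hne : ∀ {p q : ℕ}, i ≤ p → i ≤ q → p ≤ m + 1 + 1 → q ≤ m + 1 + 1 → p ≠ q → a p ≠ a q :=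
    ne_of_injOn ha
  have ha' : Set.InjOn a (Set.Icc i (m + 1)) := ha.mono (Set.Icc_subset_Icc le_rfl (by omega))
  obtain ⟨⟨j, hj⟩, hf, hl, hgt, hlt⟩ := h
  have h1 := hj.le_left
  have h2 := hj.le_right
  have hsep := (ln_lt_iff_of_upper (hne (by omega) (by omega) (by omega) (by omega) (by omega))
    (hne (p := m + 1) (q := m + 1 + 1) (by omega) (by omega) (by omega) (by omega) (by omega))
    (hne (p := i) (by omega) (by omega) (by omega) (by omega) (by omega))).1 ⟨hgt, hlt⟩
  have hf' : G.vx a i ≤ G.vx a (m + 1) := vx_le_of_vy_lt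
    (hne (by omega) (by omega) (by omega) (by omega) (by omega))
    (hne (by omega) (by omega) (by omega) (by omega) (by omega)) hf
  have hl' : G.vx a m ≤ G.vx a (m + 1) := vx_le_of_vy_lt
    (hne (by omega) (by omega) (by omega) (by omega) (by omega))
    (hne (by omega) (by omega) (by omega) (by omega) (by omega)) hl
  refine ⟨j, h1, by omega, hj.ascent, fun l hl1 hl2 hl3 => ?_, fun e l he1 he2 hl1 hl2 => ?_,
    fun e l he1 he2 hl1 hl2 => ?_⟩
  · rcases eq_or_ne l (m + 1) with rfl | hl4
    · exact ht
    · exact hj.descent l hl1 (by omega) hl3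
  · rcases eq_or_ne e (m + 1) with rfl | he4
    · exact (hj.ln_le_first ha' hf' hl1 hl2).trans hsep.le
    · exact hj.lower e l he1 (by omega) hl1 hl2
  · rcases eq_or_ne e (m + 1) with rfl | he4
    · rcases eq_or_ne l (m + 1 + 1) with rfl | hl4
      · exact (ln_vx (hne (by omega) (by omega) (by omega) (by omega) (by omega))).ge
      · exact hj.last_le_ln ha' hl' hl1 (by omega)
    · rcases eq_or_ne l (m + 1 + 1) with rfl | hl4
      · refine (hj.upper e (m + 1) he1 (by omega) (by omega) (by omega)).trans ?_
        rw [← le_x_iff ht, x_symm]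
        exact hj.vx_le ha' he1 (by omega) hf' hl'
      · exact hj.upper e l he1 (by omega) hl1 (by omega)

theorem OpenRight.of_right_first (him : i ≤ m) (ha : Set.InjOn a (Set.Icc i (m + 1 + 1)))
    (ht : G.t (a (i + 1)) < G.t (a i)) (h : G.Right a (i + 1) (m + 1) (G.vy a i)) :
    G.OpenRight a i (m + 1) := by
  have hne : ∀ {p q : ℕ}, i ≤ p → i ≤ q → p ≤ m + 1 + 1 → q ≤ m + 1 + 1 → p ≠ q → a p ≠ a q :=
    ne_of_injOn ha
  have ha' : Set.InjOn a (Set.Icc (i + 1) (m + 1 + 1)) :=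
    ha.mono (Set.Icc_subset_Icc (by omega) le_rfl)
  obtain ⟨⟨j, hj⟩, hf, hl, hgt, hlt⟩ := h
  have h1 := hj.le_left
  have h2 := hj.le_right
  rw [vy, G.y_symm (a i) (a (i + 1))] at hgt hlt
  have hsep := (ln_lt_iff_of_lower (hne (by omega) (by omega) (by omega) (by omega) (by omega))
    (hne (p := i + 1) (q := i) (by omega) (by omega) (by omega) (by omega) (by omega))
    (hne (p := m + 1 + 1) (by omega) (by omega) (by omega) (by omega) (by omega))).1 ⟨hgt, hlt⟩
  rw [x_symm] at hsep
  have hf' : G.vx a (i + 1) ≤ G.vx a i := vx_le_of_vy_lt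
    (hne (by omega) (by omega) (by omega) (by omega) (by omega))
    (hne (by omega) (by omega) (by omega) (by omega) (by omega)) hf
  have hl' : G.vx a (m + 1) ≤ G.vx a i := vx_le_of_vy_lt
    (hne (by omega) (by omega) (by omega) (by omega) (by omega))
    (hne (by omega) (by omega) (by omega) (by omega) (by omega)) hl
  have hi := G.ln_vx (a := a) (e := i) (hne (by omega) (by omega) (by omega) (by omega) (by omega))
  refine ⟨j, by omega, by omega, hj.ascent, fun l hl1 hl2 hl3 => ?_, fun e l he1 he2 hl1 hl2 => ?_,
    fun e l he1 he2 hl1 hl2 => ?_⟩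
  · rcases eq_or_ne l i with rfl | hl4
    · exact ht
    · exact hj.descent l (by omega) (by omega) hl3
  · rcases eq_or_ne e i with rfl | he4
    · rcases eq_or_ne l e with rfl | hl4
      · exact le_rfl
      · exact (hj.ln_le_first ha' hf' (by omega) hl2).trans hi.le
    · rcases eq_or_ne l i with rfl | hl4
      · refine le_trans ?_ (hj.lower e (l + 1) (by omega) (by omega) (by omega) (by omega))
        rw [← le_x_iff ht, x_symm]
        exact hj.vx_le ha' (by omega) (by omega) hf' hl'
      · exact hj.lower e l (by omega) (by omega) (by omega) hl2
  · rcases eq_or_ne e i with rfl | he4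
    · exact hi.ge.trans (hsep.le.trans (hj.last_le_ln ha' hl' hl1 hl2))
    · exact hj.upper e l (by omega) (by omega) hl1 (by omega)

/-- Converse of `OpenRight.of_right_last`: lying to the right of the first vertex, the last vertex
is not the leftmost one, so the slope descends there and dropping the last line leaves an open
region. -/
theorem OpenRight.right_last (him : i ≤ m) (ha : Set.InjOn a (Set.Icc i (m + 1 + 1)))
    (h : G.OpenRight a i (m + 1)) (hy : G.vy a i < G.vy a (m + 1)) :
    G.t (a (m + 1 + 1)) < G.t (a (m + 1)) ∧ G.Right a i m (G.vy a (m + 1)) := by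
  have hne : ∀ {p q : ℕ}, i ≤ p → i ≤ q → p ≤ m + 1 + 1 → q ≤ m + 1 + 1 → p ≠ q → a p ≠ a q :=
    ne_of_injOn ha
  obtain ⟨j, hj⟩ := h
  have h1 := hj.le_left
  have h2 := hj.le_right
  have h3 : m + 1 ≠ j := fun h3 => lt_asymm hy (hj.last_lt_first ha (by omega) h3)
  have hsep := (ln_lt_iff_of_upper (hne (by omega) (by omega) (by omega) (by omega) (by omega))
    (hne (p := m + 1) (q := m + 1 + 1) (by omega) (by omega) (by omega) (by omega) (by omega))
    (hne (p := i) (by omega) (by omega) (by omega) (by omega) (by omega))).2 (lt_of_le_of_ne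
      (hj.lower (m + 1) i (by omega) (by omega) (by omega) (by omega))
      (by
        have := ln_x_ne (G := G) (p := a (m + 1 + 1)) (q := a (m + 1)) (r := a i)
          (hne (by omega) (by omega) (by omega) (by omega) (by omega))
          (hne (by omega) (by omega) (by omega) (by omega) (by omega))
          (hne (by omega) (by omega) (by omega) (by omega) (by omega))
        rw [x_symm] at this
        exact this.symm))
  refine ⟨hj.descent (m + 1) (by omega) (by omega) h3,
    ⟨j, h1, by omega, hj.ascent, fun l hl1 hl2 hl3 => hj.descent l hl1 (by omega) hl3,
      fun e l he1 he2 => hj.lower e l he1 (by omega),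
      fun e l he1 he2 hl1 hl2 => hj.upper e l he1 (by omega) hl1 (by omega)⟩, hy,
    hj.vy_upper ha (by omega) (by omega), hsep.1, hsep.2⟩

theorem OpenRight.right_first (him : i ≤ m) (ha : Set.InjOn a (Set.Icc i (m + 1 + 1)))
    (h : G.OpenRight a i (m + 1)) (hy : G.vy a (m + 1) < G.vy a i) :
    G.t (a (i + 1)) < G.t (a i) ∧ G.Right a (i + 1) (m + 1) (G.vy a i) := by
  have hne : ∀ {p q : ℕ}, i ≤ p → i ≤ q → p ≤ m + 1 + 1 → q ≤ m + 1 + 1 → p ≠ q → a p ≠ a q :=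
    ne_of_injOn ha
  obtain ⟨j, hj⟩ := h
  have h1 := hj.le_left
  have h2 := hj.le_right
  have h3 : i ≠ j := fun h3 => lt_asymm hy (hj.first_lt_last ha (by omega) h3)
  have hi := G.ln_vx (a := a) (e := i) (hne (by omega) (by omega) (by omega) (by omega) (by omega))
  have hsep := (ln_lt_iff_of_lower (hne (by omega) (by omega) (by omega) (by omega) (by omega))
    (hne (p := i + 1) (q := i) (by omega) (by omega) (by omega) (by omega) (by omega))
    (hne (p := m + 1 + 1) (by omega) (by omega) (by omega) (by omega) (by omega))).2 (lt_of_le_of_ne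
      (by
        rw [x_symm]
        exact hi.le.trans (hj.upper i (m + 1 + 1) (by omega) (by omega) (by omega) (by omega)))
      (by
        rw [x_symm]
        exact ln_x_ne (hne (by omega) (by omega) (by omega) (by omega) (by omega))
          (hne (by omega) (by omega) (by omega) (by omega) (by omega))
          (hne (by omega) (by omega) (by omega) (by omega) (by omega))))
  rw [G.y_symm (a (i + 1)) (a i)] at hsep
  refine ⟨hj.descent i (by omega) (by omega) h3,
    ⟨j, by omega, by omega, hj.ascent, fun l hl1 hl2 hl3 => hj.descent l (by omega) (by omega) hl3,
      fun e l he1 he2 hl1 => hj.lower e l (by omega) (by omega) (by omega),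
      fun e l he1 he2 hl1 hl2 => hj.upper e l (by omega) (by omega) hl1 (by omega)⟩,
    hj.vy_lower ha (by omega) (by omega), hy, hsep.1, hsep.2⟩

/-- If the first and the last of the lines bounding a region which is open to the right meet to the
right, they do so to the right of all vertices. -/
theorem OpenRight.lt_of_gt (him : i < m) (ha : Set.InjOn a (Set.Icc i (m + 1)))
    (h : G.OpenRight a i m) (ht : G.t (a (m + 1)) < G.t (a i)) :
    G.vy a i < G.y (a i) (a (m + 1)) ∧ G.vy a m < G.y (a i) (a (m + 1)) := by
  obtain ⟨j, hj⟩ := h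
  have h1 := hj.le_left
  have h2 := hj.le_right
  have hne : ∀ {p q : ℕ}, i ≤ p → i ≤ q → p ≤ m + 1 → q ≤ m + 1 → p ≠ q → a p ≠ a q :=
    ne_of_injOn ha
  constructor
  · rw [vy, G.y_symm, y_lt_iff (hne (by omega) (by omega) (by omega) (by omega) (by omega))
      (hne (by omega) (by omega) (by omega) (by omega) (by omega))
      (hne (by omega) (by omega) (by omega) (by omega) (by omega))]
    refine lt_of_le_of_ne ?_ (x_ne (hne (by omega) (by omega) (by omega) (by omega) (by omega))
      (hne (by omega) (by omega) (by omega) (by omega) (by omega))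
      (hne (by omega) (by omega) (by omega) (by omega) (by omega)))
    rw [x_symm (a i), le_x_iff ht, x_symm]
    exact hj.upper i (m + 1) (by omega) (by omega) (by omega) (by omega)
  · rw [vy, G.y_symm (a i), y_lt_iff (hne (by omega) (by omega) (by omega) (by omega) (by omega))
      (hne (by omega) (by omega) (by omega) (by omega) (by omega))
      (hne (by omega) (by omega) (by omega) (by omega) (by omega))]
    refine lt_of_le_of_ne ?_ (x_ne (hne (by omega) (by omega) (by omega) (by omega) (by omega))
      (hne (by omega) (by omega) (by omega) (by omega) (by omega))
      (hne (by omega) (by omega) (by omega) (by omega) (by omega)))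
    rw [le_x_iff ht, ← ln_x (hne (by omega) (by omega) (by omega) (by omega) (by omega))]
    exact hj.lower m i (by omega) (by omega) (by omega) (by omega)

/-- If the first and the last of the lines bounding a region which is open to the right meet to the
left, they do so to the left of the first and the last vertex. -/
theorem OpenRight.lt_of_lt (him : i < m) (ha : Set.InjOn a (Set.Icc i (m + 1)))
    (h : G.OpenRight a i m) (ht : G.t (a i) < G.t (a (m + 1))) :
    G.y (a i) (a (m + 1)) < G.vy a i ∧ G.y (a i) (a (m + 1)) < G.vy a m := by
  obtain ⟨j, hj⟩ := h
  have h1 := hj.le_left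
  have h2 := hj.le_right
  have hne : ∀ {p q : ℕ}, i ≤ p → i ≤ q → p ≤ m + 1 → q ≤ m + 1 → p ≠ q → a p ≠ a q :=
    ne_of_injOn ha
  constructor
  · rw [vy, G.y_symm (a i) (a (i + 1)),
      y_lt_iff' (hne (by omega) (by omega) (by omega) (by omega) (by omega))
      (hne (by omega) (by omega) (by omega) (by omega) (by omega))
      (hne (by omega) (by omega) (by omega) (by omega) (by omega))]
    refine lt_of_le_of_ne ?_ (x_ne (hne (by omega) (by omega) (by omega) (by omega) (by omega))
      (hne (by omega) (by omega) (by omega) (by omega) (by omega))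
      (hne (by omega) (by omega) (by omega) (by omega) (by omega))).symm
    rw [x_le_iff ht, x_symm]
    exact hj.upper i (m + 1) (by omega) (by omega) (by omega) (by omega)
  · rw [vy, G.y_symm (a i), y_lt_iff' (hne (by omega) (by omega) (by omega) (by omega) (by omega))
      (hne (by omega) (by omega) (by omega) (by omega) (by omega))
      (hne (by omega) (by omega) (by omega) (by omega) (by omega))]
    refine lt_of_le_of_ne ?_ (x_ne (hne (by omega) (by omega) (by omega) (by omega) (by omega))
      (hne (by omega) (by omega) (by omega) (by omega) (by omega))
      (hne (by omega) (by omega) (by omega) (by omega) (by omega))).symm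
    rw [x_symm, x_le_iff ht, ← ln_x (hne (by omega) (by omega) (by omega) (by omega) (by omega))]
    exact hj.lower m i (by omega) (by omega) (by omega) (by omega)

/-- A region with at least two vertices cannot be open both to the right and to the left. -/
theorem OpenRight.not_rot (him : i < m) (ha : Set.InjOn a (Set.Icc i (m + 1)))
    (h : G.OpenRight a i m) (h' : G.rot.OpenRight a i m) : False := by
  obtain ⟨j, hj⟩ := h
  obtain ⟨j', hj'⟩ := h'
  have h1 := hj.le_left
  have h2 := hj.le_right
  obtain rfl : j = j' := by
    by_contra hne
    exact lt_asymm hj.ascent (hj'.descent j h1 h2 hne)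
  rcases eq_or_ne j m with rfl | h3
  · obtain ⟨j, rfl⟩ : ∃ j', j = j' + 1 := ⟨j - 1, by omega⟩
    have e1 := hj.vy_lower ha (e := j) (by omega) (by omega)
    have e2 := hj'.vy_lower ha (e := j) (by omega) (by omega)
    rw [vy_rot, vy_rot] at e2
    linarith
  · have e1 := hj.vy_upper ha (e := j) (by omega) (by omega)
    have e2 := hj'.vy_upper ha (e := j) (by omega) (by omega)
    rw [vy_rot, vy_rot] at e2
    linarith

theorem openRight_self (h : G.t (a i) < G.t (a (i + 1))) : G.OpenRight a i i := by
  refine ⟨i, le_rfl, le_rfl, h, fun l h1 h2 h3 => absurd (by omega) h3, fun e l h1 h2 h3 h4 => ?_,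
    fun e l h1 h2 h3 h4 => ?_⟩
  · obtain rfl : e = i := by omega
    obtain rfl : l = e := by omega
    exact le_rfl
  · obtain rfl : e = i := by omega
    obtain rfl : l = e + 1 := by omega
    exact (ln_vx (ne_of_t_lt h)).ge

end Arrangement

/-! ### Closed polygons: upper and lower lines, and the leftmost vertex. -/

namespace Arrangement

variable {ι : Type*} (G : Arrangement ι)

/-- The intersection points of consecutive lines of a periodic sequence lie to the right of the
oriented edges of the polygon which they form. -/
def IsPolygon (a : ℕ → ι) : Prop := ∀ l e,
  (G.vx a (l + 1) - G.vx a l) * (G.ln (a e) (G.vx a e) - G.ln (a (l + 1)) (G.vx a e)) ≤ 0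

/-- No vertex lies above the line `a l`. -/
def IsUpper (a : ℕ → ι) (l : ℕ) : Prop := ∀ e, G.ln (a e) (G.vx a e) ≤ G.ln (a l) (G.vx a e)

/-- No vertex lies below the line `a l`. -/
def IsLower (a : ℕ → ι) (l : ℕ) : Prop := ∀ e, G.ln (a l) (G.vx a e) ≤ G.ln (a e) (G.vx a e)

variable {G} {a : ℕ → ι} {m : ℕ}

theorem isPolygon_rot : G.rot.IsPolygon a ↔ G.IsPolygon a := by
  refine forall_congr' fun l => forall_congr' fun e => ?_
  simp only [ln_rot, vx_rot, neg_neg]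
  ring_nf

theorem isUpper_rot {l : ℕ} : G.rot.IsUpper a l ↔ G.IsLower a l := by
  refine forall_congr' fun e => ?_
  rw [ln_rot, ln_rot, vx_rot, neg_neg, neg_le_neg_iff]

theorem isLower_rot {l : ℕ} : G.rot.IsLower a l ↔ G.IsUpper a l := by
  refine forall_congr' fun e => ?_
  rw [ln_rot, ln_rot, vx_rot, neg_neg, neg_le_neg_iff]

section Periodic

theorem ne_succ (hp : Function.Periodic a (m + 2)) (ha : Set.InjOn a (Set.Icc 0 (m + 1))) (l : ℕ) :
    a l ≠ a (l + 1) := by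
  rw [← hp.map_mod_nat l, ← hp.map_mod_nat (l + 1)]
  have h1 := Nat.mod_lt l (show 0 < m + 2 by omega)
  have h2 := Nat.mod_lt (l + 1) (show 0 < m + 2 by omega)
  refine ne_of_injOn ha (Nat.zero_le _) (Nat.zero_le _) (by omega) (by omega) fun h => ?_
  have h3 : l + 0 ≡ l + 1 [MOD m + 2] := h
  have h4 := Nat.ModEq.add_left_cancel' _ h3
  rw [Nat.ModEq, Nat.zero_mod, Nat.mod_eq_of_lt (by omega)] at h4
  omega

theorem ne_succ_succ (hm : 1 ≤ m) (hp : Function.Periodic a (m + 2))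
    (ha : Set.InjOn a (Set.Icc 0 (m + 1))) (l : ℕ) : a l ≠ a (l + 2) := by
  rw [← hp.map_mod_nat l, ← hp.map_mod_nat (l + 2)]
  have h1 := Nat.mod_lt l (show 0 < m + 2 by omega)
  have h2 := Nat.mod_lt (l + 2) (show 0 < m + 2 by omega)
  refine ne_of_injOn ha (Nat.zero_le _) (Nat.zero_le _) (by omega) (by omega) fun h => ?_
  have h3 : l + 0 ≡ l + 2 [MOD m + 2] := h
  have h4 := Nat.ModEq.add_left_cancel' _ h3
  rw [Nat.ModEq, Nat.zero_mod, Nat.mod_eq_of_lt (by omega)] at h4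
  omega

theorem vx_periodic (hp : Function.Periodic a (m + 2)) : Function.Periodic (G.vx a) (m + 2) := by
  intro l
  rw [vx, vx, hp, show l + (m + 2) + 1 = l + 1 + (m + 2) by omega, hp]

theorem vx_ne_succ (hm : 1 ≤ m) (hp : Function.Periodic a (m + 2))
    (ha : Set.InjOn a (Set.Icc 0 (m + 1))) (l : ℕ) : G.vx a l ≠ G.vx a (l + 1) :=
  x_ne (ne_succ hp ha l) (ne_succ hp ha _) (ne_succ_succ hm hp ha l)

/-- The vertices of the polygon are pairwise distinct. -/
theorem vertex_injective (hm : 1 ≤ m) (hp : Function.Periodic a (m + 2))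
    (ha : Set.InjOn a (Set.Icc 0 (m + 1))) {e e' : ℕ} (he : e ≤ m + 1) (he' : e' ≤ m + 1)
    (hx : G.vx a e = G.vx a e') (hy : G.ln (a e) (G.vx a e) = G.ln (a e') (G.vx a e')) :
    e = e' := by
  by_contra hne
  have hae : a e ≠ a e' := ne_of_injOn ha (Nat.zero_le _) (Nat.zero_le _) he he' hne
  have h1 := ln_vx (G := G) (ne_succ hp ha e)
  have h2 := ln_vx (G := G) (ne_succ hp ha e')
  have h0 : a (m + 2) = a 0 := by simpa using hp 0
  have key : ∀ {e e' : ℕ}, a e ≠ a e' → G.vx a e = G.vx a e' →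
      G.ln (a e) (G.vx a e) = G.ln (a e') (G.vx a e') → a e = a (e' + 1) := by
    intro e e' hae hx hy
    by_contra h
    refine ln_x_ne (G := G) (ne_succ hp ha e') (r := a e) (Ne.symm h) hae.symm ?_
    change G.ln (a (e' + 1)) (G.vx a e') = G.ln (a e) (G.vx a e')
    rw [ln_vx (ne_succ hp ha e'), ← hy, hx]
  have key2 : ∀ {e e' : ℕ}, e ≤ m + 1 → e' ≤ m + 1 → a e = a (e' + 1) →
      e = e' + 1 ∨ (e = 0 ∧ e' = m + 1) := by
    intro e e' he he' h
    rcases eq_or_ne e' (m + 1) with rfl | h3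
    · rw [h0] at h
      exact .inr ⟨ha ⟨Nat.zero_le _, he⟩ ⟨Nat.zero_le _, by omega⟩ h, rfl⟩
    · exact .inl (ha ⟨Nat.zero_le _, he⟩ ⟨Nat.zero_le _, by omega⟩ h)
  have h3 := key2 he he' (key hae hx hy)
  have h4 := key2 he' he (key hae.symm hx.symm hy.symm)
  omega

/-- Every vertex lies off the next line. -/
theorem ln_succ_ne (hm : 1 ≤ m) (hp : Function.Periodic a (m + 2))
    (ha : Set.InjOn a (Set.Icc 0 (m + 1))) (l : ℕ) :
    G.ln (a (l + 1)) (G.vx a (l + 1)) ≠ G.ln (a l) (G.vx a (l + 1)) := by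
  have := ln_x_ne (G := G) (p := a (l + 2)) (q := a (l + 1)) (r := a l)
    (ne_succ hp ha (l + 1)).symm (ne_succ hp ha l).symm (ne_succ_succ hm hp ha l).symm
  rwa [x_symm] at this

/-- The side on the line `a l` runs from vertex `l - 1`, written `l + (m + 1)` by periodicity, to
vertex `l`. A side running to the right needs all vertices below its line, one running to the left
needs them above. -/
theorem isPolygon_of (hp : Function.Periodic a (m + 2))
    (h : ∀ l ≤ m + 1, (G.vx a (l + (m + 1)) < G.vx a l ∧
        ∀ e ≤ m + 1, G.ln (a e) (G.vx a e) ≤ G.ln (a l) (G.vx a e)) ∨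
      (G.vx a l < G.vx a (l + (m + 1)) ∧
        ∀ e ≤ m + 1, G.ln (a l) (G.vx a e) ≤ G.ln (a e) (G.vx a e))) : G.IsPolygon a := by
  intro l e
  have h1 := Nat.mod_lt (l + 1) (show 0 < m + 2 by omega)
  have h2 := Nat.mod_lt e (show 0 < m + 2 by omega)
  have hX := vx_periodic (G := G) hp
  have e1 : G.vx a l = G.vx a ((l + 1) % (m + 2) + (m + 1)) := by
    rw [← hX l, ← hX.map_mod_nat ((l + 1) % (m + 2) + (m + 1)), ← hX.map_mod_nat (l + (m + 2))]
    congr 1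
    rw [Nat.mod_add_mod]
    congr 1
    omega
  rw [← hX.map_mod_nat (l + 1), ← hX.map_mod_nat e, ← hp.map_mod_nat (l + 1), ← hp.map_mod_nat e,
    e1]
  rcases h ((l + 1) % (m + 2)) (by omega) with ⟨h3, h4⟩ | ⟨h3, h4⟩
  · exact mul_nonpos_of_nonneg_of_nonpos (sub_nonneg.2 h3.le) (sub_nonpos.2 (h4 _ (by omega)))
  · exact mul_nonpos_of_nonpos_of_nonneg (sub_nonpos.2 h3.le) (sub_nonneg.2 (h4 _ (by omega)))

variable (hm : 1 ≤ m) (hp : Function.Periodic a (m + 2)) (ha : Set.InjOn a (Set.Icc 0 (m + 1)))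
  (h : G.IsPolygon a)

theorem isUpper_periodic (hp : Function.Periodic a (m + 2)) :
    Function.Periodic (G.IsUpper a) (m + 2) := by
  intro l
  simp only [IsUpper, hp l]

theorem isLower_periodic (hp : Function.Periodic a (m + 2)) :
    Function.Periodic (G.IsLower a) (m + 2) := by
  intro l
  simp only [IsLower, hp l]

include hm hp ha in
theorem not_isUpper_and_isLower {l : ℕ} (hU : G.IsUpper a l) (hD : G.IsLower a l) : False :=
  ln_succ_ne hm hp ha l (le_antisymm (hU (l + 1)) (hD (l + 1)))

namespace IsPolygon

include hm hp ha h

/-- Consecutive vertices have different first coordinates, so the direction of a side decides on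
which side of its line all vertices lie. -/
theorem succ_cases (l : ℕ) : (G.vx a l < G.vx a (l + 1) ∧ G.IsUpper a (l + 1)) ∨
    (G.vx a (l + 1) < G.vx a l ∧ G.IsLower a (l + 1)) := by
  rcases lt_or_gt_of_ne (vx_ne_succ (G := G) hm hp ha l) with h1 | h1
  · refine .inl ⟨h1, fun e => ?_⟩
    have := h l e
    by_contra h2
    nlinarith
  · refine .inr ⟨h1, fun e => ?_⟩
    have := h l e
    by_contra h2
    nlinarith

theorem lt_of_isUpper {l : ℕ} (hU : G.IsUpper a (l + 1)) : G.vx a l < G.vx a (l + 1) := by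
  rcases h.succ_cases hm hp ha l with h1 | h1
  · exact h1.1
  · exact absurd h1.2 fun h2 => not_isUpper_and_isLower hm hp ha hU h2

theorem lt_of_isLower {l : ℕ} (hD : G.IsLower a (l + 1)) : G.vx a (l + 1) < G.vx a l := by
  rcases h.succ_cases hm hp ha l with h1 | h1
  · exact absurd h1.2 fun h2 => not_isUpper_and_isLower hm hp ha h2 hD
  · exact h1.1

theorem isUpper_or_isLower (l : ℕ) : G.IsUpper a l ∨ G.IsLower a l := by
  rw [← isUpper_periodic hp l, ← isLower_periodic hp l]
  exact (h.succ_cases hm hp ha (l + (m + 1))).imp And.right And.right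

/-- If the slope grew, the vertex `l + 1`, which lies on `a (l + 1)` to the right of the vertex `l`,
would be above the line `a l`. The other three slope comparisons are proved in the same way. -/
theorem t_lt_of_isUpper {l : ℕ} (h1 : G.IsUpper a l) (h2 : G.IsUpper a (l + 1)) :
    G.t (a (l + 1)) < G.t (a l) := by
  refine lt_of_le_of_ne (not_lt.1 fun h3 => ?_) (G.t_ne _ _ (ne_succ hp ha l).symm)
  exact absurd ((x_lt_iff h3).1 (h.lt_of_isUpper hm hp ha h2)) (not_lt.2 (h1 _))

theorem t_lt_of_isLower {l : ℕ} (h1 : G.IsLower a l) (h2 : G.IsLower a (l + 1)) :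
    G.t (a (l + 1)) < G.t (a l) := by
  refine lt_of_le_of_ne (not_lt.1 fun h3 => ?_) (G.t_ne _ _ (ne_succ hp ha l).symm)
  exact absurd ((lt_x_iff h3).1 (h.lt_of_isLower hm hp ha h2)) (not_lt.2 (h1 _))

theorem t_lt_of_isLower_of_isUpper {l : ℕ} (h1 : G.IsLower a l) (h2 : G.IsUpper a (l + 1)) :
    G.t (a l) < G.t (a (l + 1)) := by
  refine lt_of_le_of_ne (not_lt.1 fun h3 => ?_) (G.t_ne _ _ (ne_succ hp ha l))
  have h4 := h.lt_of_isUpper hm hp ha h2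
  rw [vx, x_symm, x_lt_iff h3] at h4
  exact absurd h4 (not_lt.2 (h1 _))

theorem t_lt_of_isUpper_of_isLower {l : ℕ} (h1 : G.IsUpper a l) (h2 : G.IsLower a (l + 1)) :
    G.t (a l) < G.t (a (l + 1)) := by
  refine lt_of_le_of_ne (not_lt.1 fun h3 => ?_) (G.t_ne _ _ (ne_succ hp ha l))
  have h4 := h.lt_of_isLower hm hp ha h2
  rw [show G.vx a l = G.x (a (l + 1)) (a l) from x_symm _ _, lt_x_iff h3] at h4
  exact absurd h4 (not_lt.2 (h1 _))

/-- The leftmost vertex of a polygon is unique. -/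
theorem leftmost_lt {l : ℕ} (hl : l ≤ m + 1) (h1 : G.IsLower a l) (h2 : G.IsUpper a (l + 1))
    {e : ℕ} (he : e ≤ m + 1) (hne : e ≠ l) : G.vx a l < G.vx a e := by
  have ht := h.t_lt_of_isLower_of_isUpper hm hp ha h1 h2
  refine lt_of_le_of_ne ((x_le_iff ht).2 ((h1 e).trans (h2 e))) fun h3 => hne ?_
  refine vertex_injective (G := G) hm hp ha he hl h3.symm (le_antisymm ?_ ?_)
  · rw [h3]
    refine (h2 e).trans ?_
    rw [← h3, ln_vx (ne_succ hp ha l)]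
  · rw [h3]
    exact h1 e

theorem leftmost_unique {l l' : ℕ} (hl : l ≤ m + 1) (h1 : G.IsLower a l)
    (h2 : G.IsUpper a (l + 1)) (hl' : l' ≤ m + 1) (h1' : G.IsLower a l')
    (h2' : G.IsUpper a (l' + 1)) : l = l' := by
  by_contra hne
  exact lt_asymm (h.leftmost_lt hm hp ha hl h1 h2 hl' (Ne.symm hne))
    (h.leftmost_lt hm hp ha hl' h1' h2' hl hne)

theorem exists_leftmost {l l' : ℕ} (hl : l ≤ l') (h1 : G.IsLower a l) (h2 : G.IsUpper a l') :
    ∃ j, l ≤ j ∧ j < l' ∧ G.IsLower a j ∧ G.IsUpper a (j + 1) := by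
  induction l', hl using Nat.le_induction with
  | base => exact absurd h1 fun h1 => not_isUpper_and_isLower hm hp ha h2 h1
  | succ e he ih =>
    rcases h.isUpper_or_isLower hm hp ha e with h3 | h3
    · obtain ⟨j, e1, e2, e3⟩ := ih h3
      exact ⟨j, e1, by omega, e3⟩
    · exact ⟨e, he, by omega, h3, h2⟩

/-- A lower line is followed by an upper one only at the leftmost vertex, which is unique. Starting
from a lower and ending with an upper line, the sequence therefore switches exactly once. -/
theorem openRight (h1 : G.IsUpper a (m + 1)) (h2 : G.IsLower a 0) : G.OpenRight a 0 m := by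
  obtain ⟨j, -, hj2, hj3, hj4⟩ := h.exists_leftmost hm hp ha (Nat.zero_le _) h2 h1
  have hlow : ∀ l ≤ j, G.IsLower a l := by
    intro l hl
    refine (h.isUpper_or_isLower hm hp ha l).resolve_left fun h3 => ?_
    obtain ⟨j', -, e2, e3, e4⟩ := h.exists_leftmost hm hp ha (Nat.zero_le _) h2 h3
    have := h.leftmost_unique hm hp ha (by omega) hj3 hj4 (by omega) e3 e4
    omega
  have hup : ∀ l, j < l → l ≤ m + 1 → G.IsUpper a l := by
    intro l hl hl'
    refine (h.isUpper_or_isLower hm hp ha l).resolve_right fun h3 => ?_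
    obtain ⟨j', e1, e2, e3, e4⟩ := h.exists_leftmost hm hp ha hl' h3 h1
    have := h.leftmost_unique hm hp ha (by omega) hj3 hj4 (by omega) e3 e4
    omega
  refine ⟨j, Nat.zero_le _, by omega, h.t_lt_of_isLower_of_isUpper hm hp ha hj3 hj4,
    fun l _ hl hne => ?_, fun e l _ _ _ hl => hlow l hl e, fun e l _ _ hl hl' => hup l hl hl' e⟩
  rcases lt_or_gt_of_ne hne with h3 | h3
  · exact h.t_lt_of_isLower hm hp ha (hlow _ (by omega)) (hlow _ (by omega))
  · exact h.t_lt_of_isUpper hm hp ha (hup _ (by omega) (by omega)) (hup _ (by omega) (by omega))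

end IsPolygon

end Periodic

end Arrangement

/-! ### Polygons and the position of their closing vertex. -/

namespace Arrangement

variable {ι : Type*} {G : Arrangement ι} {a : ℕ → ι} {m : ℕ}

theorem exists_step {P : ℕ → Prop} {l l' : ℕ} (hl : l ≤ l') (h1 : ¬P l) (h2 : P l') :
    ∃ j, l ≤ j ∧ j < l' ∧ ¬P j ∧ P (j + 1) := by
  induction l', hl using Nat.le_induction with
  | base => exact absurd h2 h1
  | succ e he ih =>
    by_cases h3 : P e
    · obtain ⟨j, e1, e2, e3⟩ := ih h3
      exact ⟨j, e1, by omega, e3⟩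
    · exact ⟨e, he, by omega, h3, h2⟩

theorem vx_last (hp : Function.Periodic a (m + 2)) : G.vx a (m + 1) = G.x (a (m + 1)) (a 0) := by
  rw [vx, ← hp 0, zero_add]

theorem vy_last (hp : Function.Periodic a (m + 2)) : G.vy a (m + 1) = G.y (a (m + 1)) (a 0) := by
  rw [vy, ← hp 0, zero_add]

theorem vx_add (hp : Function.Periodic a (m + 2)) (l : ℕ) : G.vx a (l + 1 + (m + 1)) = G.vx a l := by
  rw [← vx_periodic (G := G) hp l]
  congr 1
  omega

variable (hm : 1 ≤ m) (hp : Function.Periodic a (m + 2)) (ha : Set.InjOn a (Set.Icc 0 (m + 1)))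

include hm hp ha

/-- By `OpenRight.lt_of_gt` the outer lines meet to the right of all vertices, and their
intersection closes the region. -/
theorem OpenRight.isPolygon (h : G.OpenRight a 0 m) (ht : G.t (a (m + 1)) < G.t (a 0)) :
    G.IsPolygon a := by
  have hy := h.lt_of_gt (by omega) ha ht
  have h0 : a (m + 1) ≠ a 0 := ne_of_t_lt ht
  have hne := ne_succ hp ha
  have hlast := vx_last (G := G) hp
  rw [G.y_symm, ← vy_last hp] at hy
  have hy1 : G.vx a 0 ≤ G.vx a (m + 1) := vx_le_of_vy_lt (hne _) (hne _) hy.1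
  have hy2 : G.vx a m ≤ G.vx a (m + 1) := vx_le_of_vy_lt (hne _) (hne _) hy.2
  have hy1' : G.vx a 0 < G.vx a (m + 1) := by
    refine lt_of_le_of_ne hy1 ?_
    have := vx_ne_succ (G := G) hm hp ha (m + 1)
    rw [show m + 1 + 1 = 0 + (m + 2) by omega, vx_periodic hp] at this
    exact this.symm
  have hy2' : G.vx a m < G.vx a (m + 1) := lt_of_le_of_ne hy2 (vx_ne_succ hm hp ha m)
  obtain ⟨j, hj⟩ := h
  have hj2 := hj.le_right
  have hpt : G.ln (a (m + 1)) (G.vx a (m + 1)) = G.ln (a 0) (G.vx a (m + 1)) := by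
    rw [hlast]
    exact ln_x h0
  refine isPolygon_of hp fun l hl => ?_
  rcases le_or_gt l j with h1 | h1
  · refine .inr ⟨?_, fun e he => ?_⟩
    · rcases l with _ | l
      · rwa [zero_add]
      · rw [vx_add hp]
        exact hj.vx_lower ha (Nat.zero_le _) (by omega)
    · rcases eq_or_ne e (m + 1) with rfl | he'
      · rw [hpt]
        exact hj.ln_le_first ha hy1 (Nat.zero_le _) h1
      · exact hj.lower e l (Nat.zero_le _) (by omega) (Nat.zero_le _) h1
  · refine .inl ⟨?_, fun e he => ?_⟩
    · obtain ⟨l, rfl⟩ : ∃ l', l = l' + 1 := ⟨l - 1, by omega⟩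
      rw [vx_add hp]
      rcases eq_or_ne l m with rfl | hl'
      · exact hy2'
      · exact hj.vx_upper ha (by omega) (by omega)
    · rcases eq_or_ne e (m + 1) with rfl | he'
      · exact hj.last_le_ln ha hy2 h1 hl
      · exact hj.upper e l (Nat.zero_le _) (by omega) h1 hl

/-- The order of the slopes excludes that the two lines through the closing vertex are both upper or
both lower. So this vertex is the rightmost or the leftmost one, and the others bound an open
region. -/
theorem isPolygon_iff_of_gt (ht : G.t (a (m + 1)) < G.t (a 0)) :
    G.IsPolygon a ↔ G.OpenRight a 0 m ∨ G.rot.OpenRight a 0 m := by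
  constructor
  · intro h
    have h0 : a (m + 1 + 1) = a 0 := by simpa using hp 0
    have hU : G.IsUpper a (m + 1 + 1) ↔ G.IsUpper a 0 := by simp only [IsUpper, h0]
    have hD : G.IsLower a (m + 1 + 1) ↔ G.IsLower a 0 := by simp only [IsLower, h0]
    rcases h.isUpper_or_isLower hm hp ha (m + 1) with h1 | h1 <;>
      rcases h.isUpper_or_isLower hm hp ha 0 with h2 | h2
    · have := h.t_lt_of_isUpper hm hp ha h1 (hU.2 h2)
      rw [h0] at this
      exact absurd this (lt_asymm ht)
    · exact .inl (h.openRight hm hp ha h1 h2)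
    · exact .inr ((isPolygon_rot.2 h).openRight hm hp ha (isUpper_rot.2 h1) (isLower_rot.2 h2))
    · have := h.t_lt_of_isLower hm hp ha h1 (hD.2 h2)
      rw [h0] at this
      exact absurd this (lt_asymm ht)
  · rintro (h | h)
    · exact h.isPolygon hm hp ha ht
    · exact isPolygon_rot.1 (h.isPolygon hm hp ha ht)

/-- The closing vertex lies on the lower boundary, strictly between the extreme vertices. The
vertical line through it meets the upper boundary on some line `a (k + 1)` and separates the
vertices `0, …, k` from `k + 1, …, m`. The indices `p` and `r` are those of the leftmost and the
rightmost vertex. -/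
theorem IsPolygon.exists_right_left (h : G.IsPolygon a) (h1 : G.IsLower a (m + 1))
    (h2 : G.IsLower a 0) : ∃ k < m, G.Right a 0 k (G.vy a (m + 1)) ∧
      G.rot.Right a (k + 1) m (G.rot.vy a (m + 1)) := by
  have hne : ∀ {p q : ℕ}, p ≤ m + 1 → q ≤ m + 1 → p ≠ q → a p ≠ a q :=
    fun hp hq => ne_of_injOn ha (Nat.zero_le _) (Nat.zero_le _) hp hq
  have hne' := ne_succ hp ha
  have h0 : a (m + 1 + 1) = a 0 := by simpa using hp 0
  have hD : G.IsLower a (m + 1 + 1) := by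
    simp only [IsLower, h0]
    exact h2
  -- If all lines were lower, the first coordinates would decrease strictly around the whole cycle.
  obtain ⟨q, hq1, hq2⟩ : ∃ q ≤ m, G.IsUpper a q := by
    by_contra! hcon
    have hlow : ∀ l ≤ m + 1, G.vx a (l + 1) < G.vx a 0 := by
      intro l hl
      induction l with
      | zero =>
        refine h.lt_of_isLower hm hp ha ?_
        exact (h.isUpper_or_isLower hm hp ha _).resolve_left (hcon _ (by omega))
      | succ l ih =>
        refine (h.lt_of_isLower hm hp ha ?_).trans (ih (by omega))
        rcases eq_or_ne (l + 1) m with rfl | h3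
        · exact h1
        rcases eq_or_ne l m with rfl | h3
        · exact hD
        · exact (h.isUpper_or_isLower hm hp ha _).resolve_left (hcon _ (by omega))
    have := hlow (m + 1) le_rfl
    rw [show m + 1 + 1 = 0 + (m + 2) by omega, vx_periodic hp] at this
    exact lt_irrefl _ this
  obtain ⟨p, -, hp2, hp3, hp4⟩ := h.exists_leftmost hm hp ha (Nat.zero_le _) h2 hq2
  obtain ⟨r, hr1, hr2, hr3, hr4⟩ := (isPolygon_rot.2 h).exists_leftmost hm hp ha
    (show q ≤ m + 1 by omega) (isLower_rot.2 hq2) (isUpper_rot.2 h1)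
  rw [isLower_rot] at hr3
  rw [isUpper_rot] at hr4
  have hlow : ∀ l ≤ p, G.IsLower a l := by
    intro l hl
    refine (h.isUpper_or_isLower hm hp ha l).resolve_left fun h3 => ?_
    obtain ⟨j', -, e2, e3, e4⟩ := h.exists_leftmost hm hp ha (Nat.zero_le _) h2 h3
    have := h.leftmost_unique hm hp ha (by omega) hp3 hp4 (by omega) e3 e4
    omega
  have hlow' : ∀ l, r < l → l ≤ m + 1 → G.IsLower a l := by
    intro l hl hl'
    refine (h.isUpper_or_isLower hm hp ha l).resolve_left fun h3 => ?_
    obtain ⟨j', e1, e2, e3, e4⟩ := h.exists_leftmost hm hp ha (show r + 1 ≤ l by omega) hr4 h3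
    have := h.leftmost_unique hm hp ha (by omega) hp3 hp4 (by omega) e3 e4
    omega
  have hup : ∀ l, p < l → l ≤ r → G.IsUpper a l := by
    intro l hl hl'
    refine (h.isUpper_or_isLower hm hp ha l).resolve_right fun h3 => ?_
    obtain ⟨j', e1, e2, e3, e4⟩ := h.exists_leftmost hm hp ha hl' h3 hr3
    have := h.leftmost_unique hm hp ha (by omega) hp3 hp4 (by omega) e3 e4
    omega
  have hzp : G.vy a p < G.vy a (m + 1) := G.y_lt _ _ _ _ (hne' _) (hne' _)
    (h.leftmost_lt hm hp ha (by omega) hp3 hp4 le_rfl (by omega))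
  have hzr : G.vy a (m + 1) < G.vy a r := by
    refine G.y_lt _ _ _ _ (hne' _) (hne' _) ?_
    have := (isPolygon_rot.2 h).leftmost_lt hm hp ha (by omega) (isLower_rot.2 hr3)
      (isUpper_rot.2 hr4) (le_refl (m + 1)) (by omega)
    rw [vx_rot, vx_rot] at this
    exact neg_lt_neg_iff.1 this
  obtain ⟨k, hk1, hk2, hk3, hk4⟩ := exists_step (P := fun l => G.vy a (m + 1) < G.vy a l)
    (show p ≤ r by omega) (lt_asymm hzp) hzr
  -- Equality is impossible because `y` separates different pairs of lines, even when their
  -- intersection points lie on one vertical line.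
  have hk5 : G.vy a k < G.vy a (m + 1) := by
    refine lt_of_le_of_ne (not_lt.1 hk3) fun h3 => ?_
    rw [vy_last hp] at h3
    have h01 : a (m + 1) ≠ a 0 := hne (by omega) (by omega) (by omega)
    rcases G.y_ne _ _ _ _ (hne' k) h01 h3 with ⟨e1, e2⟩ | ⟨e1, e2⟩
    · exact hne (by omega) (by omega) (by omega) e1
    · exact hne (p := k + 1) (q := m + 1) (by omega) (by omega) (by omega) e2
  have hpt : G.ln (a (m + 1)) (G.x (a (m + 1)) (a 0)) = G.ln (a 0) (G.x (a (m + 1)) (a 0)) :=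
    ln_x (hne (by omega) (by omega) (by omega))
  have hu := hup (k + 1) (by omega) (by omega) (m + 1)
  rw [vx_last hp] at hu
  have hu' : G.ln (a (m + 1)) (G.x (a (m + 1)) (a 0)) < G.ln (a (k + 1)) (G.x (a (m + 1)) (a 0)) := by
    refine lt_of_le_of_ne hu ?_
    have := ln_x_ne (G := G) (p := a 0) (q := a (m + 1)) (r := a (k + 1))
      (hne (by omega) (by omega) (by omega)) (hne (by omega) (by omega) (by omega))
      (hne (by omega) (by omega) (by omega))
    rwa [x_symm] at this
  have s1 : (G.t (a (k + 1)) < G.t (a 0) → G.vy a (m + 1) < G.y (a 0) (a (k + 1))) ∧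
      (G.t (a 0) < G.t (a (k + 1)) → G.y (a 0) (a (k + 1)) < G.vy a (m + 1)) := by
    rw [vy_last hp, G.y_symm (a (m + 1))]
    refine (ln_lt_iff_of_lower (hne (by omega) (by omega) (by omega))
      (hne (by omega) (by omega) (by omega)) (hne (by omega) (by omega) (by omega))).2 ?_
    rwa [x_symm, ← hpt]
  have s2 : (G.t (a (m + 1)) < G.t (a (k + 1)) →
        G.rot.vy a (m + 1) < G.rot.y (a (k + 1)) (a (m + 1))) ∧
      (G.t (a (k + 1)) < G.t (a (m + 1)) →
        G.rot.y (a (k + 1)) (a (m + 1)) < G.rot.vy a (m + 1)) := by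
    rw [vy_last hp]
    refine (ln_lt_iff_of_upper (G := G.rot) (hne (by omega) (by omega) (by omega))
      (hne (by omega) (by omega) (by omega)) (hne (by omega) (by omega) (by omega))).2 ?_
    rw [ln_rot, ln_rot, x_rot, neg_neg]
    exact neg_lt_neg hu'
  refine ⟨k, by omega, ⟨⟨p, Nat.zero_le _, hk1, h.t_lt_of_isLower_of_isUpper hm hp ha hp3 hp4,
    fun l _ hl hl' => ?_, fun e l _ _ _ hl => hlow l hl e,
    fun e l _ _ hl hl' => hup l hl (by omega) e⟩, ?_, hk5, s1.1, s1.2⟩,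
    ⟨⟨r, by omega, by omega, h.t_lt_of_isUpper_of_isLower hm hp ha hr3 hr4,
    fun l hl1 hl2 hl3 => ?_, fun e l _ _ hl hl' => isLower_rot.2 (hup l (by omega) hl') e,
    fun e l _ _ hl hl' => isUpper_rot.2 (hlow' l hl hl') e⟩, neg_lt_neg hk4, ?_, s2.1, s2.2⟩⟩
  · rcases lt_or_gt_of_ne hl' with h3 | h3
    · exact h.t_lt_of_isLower hm hp ha (hlow _ (by omega)) (hlow _ (by omega))
    · exact h.t_lt_of_isUpper hm hp ha (hup _ (by omega) (by omega)) (hup _ (by omega) (by omega))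
  · refine G.y_lt _ _ _ _ (hne' _) (hne' _) ?_
    have := h.lt_of_isLower hm hp ha hD
    rwa [show m + 1 + 1 = 0 + (m + 2) by omega, vx_periodic hp] at this
  · rcases lt_or_gt_of_ne hl3 with h3 | h3
    · exact h.t_lt_of_isUpper hm hp ha (hup _ (by omega) (by omega)) (hup _ (by omega) (by omega))
    · exact h.t_lt_of_isLower hm hp ha (hlow' _ (by omega) (by omega)) (hlow' _ (by omega) (by omega))
  · exact neg_lt_neg (G.y_lt _ _ _ _ (hne' _) (hne' _) (h.lt_of_isLower hm hp ha h1))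

/-- Gluing: the lines of one part must be compared with the vertices of the other. On the lower side
the comparison passes through `a 0` and `a (m + 1)`, which cross at the cut; on the upper side it
passes through the common line `a (k + 1)`. -/
theorem Right.isPolygon {k : ℕ} (hk : k < m) (ht : G.t (a 0) < G.t (a (m + 1)))
    (h : G.Right a 0 k (G.vy a (m + 1))) (h' : G.rot.Right a (k + 1) m (G.rot.vy a (m + 1))) :
    G.IsPolygon a := by
  have hne : ∀ {p q : ℕ}, p ≤ m + 1 → q ≤ m + 1 → p ≠ q → a p ≠ a q :=
    fun hp hq => ne_of_injOn ha (Nat.zero_le _) (Nat.zero_le _) hp hq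
  have hne' := ne_succ hp ha
  have ha1 : Set.InjOn a (Set.Icc 0 (k + 1)) := ha.mono (Set.Icc_subset_Icc le_rfl (by omega))
  have ha2 : Set.InjOn a (Set.Icc (k + 1) (m + 1)) :=
    ha.mono (Set.Icc_subset_Icc (by omega) le_rfl)
  have hlast := vx_last (G := G) hp
  have hpt : G.ln (a (m + 1)) (G.vx a (m + 1)) = G.ln (a 0) (G.vx a (m + 1)) := by
    rw [hlast]
    exact ln_x (hne (by omega) (by omega) (by omega))
  obtain ⟨⟨p, P⟩, hf, hl, hgt, hlt⟩ := h
  obtain ⟨⟨r, R⟩, hf', hl', -, -⟩ := h'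
  replace hf' := neg_lt_neg_iff.1 hf'
  replace hl' := neg_lt_neg_iff.1 hl'
  rw [vy_last hp, G.y_symm (a (m + 1)) (a 0)] at hgt hlt
  have hsep := (ln_lt_iff_of_lower (hne (by omega) (by omega) (by omega))
      (hne (by omega) (by omega) (by omega)) (hne (by omega) (by omega) (by omega))).1 ⟨hgt, hlt⟩
  rw [x_symm, ← hlast] at hsep
  have hp1 := P.le_right
  have hr1 := R.le_left
  have hr2 := R.le_right
  have xf := vx_le_of_vy_lt (hne' _) (hne' _) hf
  have xl := vx_le_of_vy_lt (hne' _) (hne' _) hl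
  have xf' := vx_le_of_vy_lt (hne' _) (hne' _) hf'
  have xl' := vx_le_of_vy_lt (hne' _) (hne' _) hl'
  have xlt : ∀ e ≤ k, G.vx a e ≤ G.vx a (m + 1) := fun e he => P.vx_le ha1 (Nat.zero_le _) he xf xl
  have xgt : ∀ e, k + 1 ≤ e → e ≤ m → G.vx a (m + 1) ≤ G.vx a e := fun e he he' => by
    have := R.vx_le ha2 he he' (z := -G.vx a (m + 1))
      (by rw [vx_rot]; exact neg_le_neg xf') (by rw [vx_rot]; exact neg_le_neg xl')
    rw [vx_rot] at this
    exact neg_le_neg_iff.1 this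
  -- the two chains of lines as seen from the two sides of the vertical line
  have low1 : ∀ l z, l ≤ p → G.vx a 0 ≤ z → G.ln (a l) z ≤ G.ln (a 0) z := fun l z h1 h2 =>
    P.ln_le_first ha1 h2 (Nat.zero_le _) h1
  have up1 : ∀ l z, p < l → l ≤ k + 1 → G.vx a k ≤ z → G.ln (a (k + 1)) z ≤ G.ln (a l) z :=
    fun l z h1 h2 h3 => P.last_le_ln ha1 h3 h1 h2
  have up2 : ∀ l z, k + 1 ≤ l → l ≤ r → z ≤ G.vx a (k + 1) → G.ln (a (k + 1)) z ≤ G.ln (a l) z := by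
    intro l z h1 h2 h3
    have := R.ln_le_first ha2 (z := -z) (by rw [vx_rot]; exact neg_le_neg h3) h1 h2
    rw [ln_rot, ln_rot, neg_neg] at this
    exact neg_le_neg_iff.1 this
  have low2 : ∀ l z, r < l → l ≤ m + 1 → z ≤ G.vx a m → G.ln (a l) z ≤ G.ln (a (m + 1)) z := by
    intro l z h1 h2 h3
    have := R.last_le_ln ha2 (z := -z) (by rw [vx_rot]; exact neg_le_neg h3) h1 h2
    rw [ln_rot, ln_rot, neg_neg] at this
    exact neg_le_neg_iff.1 this
  have vup2 : ∀ e l, k + 1 ≤ e → e ≤ m → k + 1 ≤ l → l ≤ r →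
      G.ln (a e) (G.vx a e) ≤ G.ln (a l) (G.vx a e) := by
    intro e l h1 h2 h3 h4
    have := R.lower e l h1 h2 h3 h4
    rw [ln_rot, ln_rot, vx_rot, neg_neg] at this
    exact neg_le_neg_iff.1 this
  have vlow2 : ∀ e l, k + 1 ≤ e → e ≤ m → r < l → l ≤ m + 1 →
      G.ln (a l) (G.vx a e) ≤ G.ln (a e) (G.vx a e) := by
    intro e l h1 h2 h3 h4
    have := R.upper e l h1 h2 h3 h4
    rw [ln_rot, ln_rot, vx_rot, neg_neg] at this
    exact neg_le_neg_iff.1 this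
  have lower : ∀ l e, l ≤ m + 1 → e ≤ m + 1 → l ≤ p ∨ r < l →
      G.ln (a l) (G.vx a e) ≤ G.ln (a e) (G.vx a e) := by
    intro l e hl he hc
    rcases eq_or_ne e (m + 1) with rfl | hem
    · rcases hc with h1 | h1
      · rw [hpt]
        exact low1 l _ h1 xf
      · exact low2 l _ h1 hl xl'
    · rcases le_or_gt e k with hek | hek <;> rcases hc with h1 | h1
      · exact P.lower e l (Nat.zero_le _) hek (Nat.zero_le _) h1
      · refine (low2 l _ h1 hl ((xlt e hek).trans xl')).trans (le_trans ?_
          (P.lower e 0 (Nat.zero_le _) hek (Nat.zero_le _) (Nat.zero_le _)))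
        rw [← le_x_iff ht, x_symm, ← hlast]
        exact xlt e hek
      · have h2 := xgt e hek (by omega)
        refine (low1 l _ h1 (xf.trans h2)).trans (le_trans ?_
          (vlow2 e (m + 1) hek (by omega) (by omega) le_rfl))
        rw [← x_le_iff ht, x_symm, ← hlast]
        exact h2
      · exact vlow2 e l hek (by omega) h1 hl
  have upper : ∀ l e, e ≤ m + 1 → p < l → l ≤ r →
      G.ln (a e) (G.vx a e) ≤ G.ln (a l) (G.vx a e) := by
    intro l e he h1 h2
    rcases eq_or_ne e (m + 1) with rfl | hem
    · rw [hpt]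
      refine hsep.le.trans ?_
      rcases le_total l (k + 1) with h3 | h3
      · exact up1 l _ h1 h3 xl
      · exact up2 l _ h3 h2 xf'
    · rcases le_or_gt e k with hek | hek <;> rcases le_total l (k + 1) with h3 | h3
      · exact P.upper e l (Nat.zero_le _) hek h1 h3
      · exact (P.upper e (k + 1) (Nat.zero_le _) hek (by omega) le_rfl).trans
          (up2 l _ h3 h2 ((xlt e hek).trans xf'))
      · exact (vup2 e (k + 1) hek (by omega) le_rfl (by omega)).trans
          (up1 l _ h1 h3 (xl.trans (xgt e hek (by omega))))
      · exact vup2 e l hek (by omega) h3 h2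
  refine isPolygon_of hp fun l hlm => ?_
  by_cases hc : l ≤ p ∨ r < l
  · refine .inr ⟨?_, fun e he => lower l e hlm he hc⟩
    rcases l with _ | l
    · rw [zero_add]
      refine lt_of_le_of_ne xf ?_
      have := vx_ne_succ (G := G) hm hp ha (m + 1)
      rw [show m + 1 + 1 = 0 + (m + 2) by omega, vx_periodic hp] at this
      exact this.symm
    · rw [vx_add hp]
      rcases hc with h1 | h1
      · exact P.vx_lower ha1 (Nat.zero_le _) (by omega)
      · rcases eq_or_ne l m with rfl | hlm'
        · exact lt_of_le_of_ne xl' (vx_ne_succ hm hp ha _).symm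
        · have := R.vx_upper ha2 (e := l) (by omega) (by omega)
          rw [vx_rot, vx_rot] at this
          exact neg_lt_neg_iff.1 this
  · push Not at hc
    refine .inl ⟨?_, fun e he => upper l e he hc.1 hc.2⟩
    obtain ⟨l, rfl⟩ : ∃ l', l = l' + 1 := ⟨l - 1, by omega⟩
    rw [vx_add hp]
    rcases lt_trichotomy l k with h1 | rfl | h1
    · exact P.vx_upper ha1 (by omega) h1
    · exact lt_of_le_of_ne (xl.trans xf') (vx_ne_succ hm hp ha _)
    · have := R.vx_lower ha2 (e := l) (by omega) (by omega)
      rw [vx_rot, vx_rot] at this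
      exact neg_lt_neg_iff.1 this

/-- Now both lines at the closing vertex are upper or both are lower; a half turn exchanges these
cases and the two alternatives. -/
theorem isPolygon_iff_of_lt (ht : G.t (a 0) < G.t (a (m + 1))) :
    G.IsPolygon a ↔ ∃ k < m,
      (G.Right a 0 k (G.vy a (m + 1)) ∧ G.rot.Right a (k + 1) m (G.rot.vy a (m + 1))) ∨
      (G.rot.Right a 0 k (G.rot.vy a (m + 1)) ∧ G.Right a (k + 1) m (G.vy a (m + 1))) := by
  constructor
  · intro h
    have h0 : a (m + 1 + 1) = a 0 := by simpa using hp 0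
    have hU : G.IsUpper a (m + 1 + 1) ↔ G.IsUpper a 0 := by simp only [IsUpper, h0]
    have hD : G.IsLower a (m + 1 + 1) ↔ G.IsLower a 0 := by simp only [IsLower, h0]
    rcases h.isUpper_or_isLower hm hp ha (m + 1) with h1 | h1 <;>
      rcases h.isUpper_or_isLower hm hp ha 0 with h2 | h2
    · obtain ⟨k, hk, e1, e2⟩ := (isPolygon_rot.2 h).exists_right_left hm hp ha
        (isLower_rot.2 h1) (isLower_rot.2 h2)
      rw [rot_rot] at e2
      exact ⟨k, hk, .inr ⟨e1, e2⟩⟩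
    · have := h.t_lt_of_isUpper_of_isLower hm hp ha h1 (hD.2 h2)
      rw [h0] at this
      exact absurd this (lt_asymm ht)
    · have := h.t_lt_of_isLower_of_isUpper hm hp ha h1 (hU.2 h2)
      rw [h0] at this
      exact absurd this (lt_asymm ht)
    · obtain ⟨k, hk, e⟩ := h.exists_right_left hm hp ha h1 h2
      exact ⟨k, hk, .inl e⟩
  · rintro ⟨k, hk, ⟨h, h'⟩ | ⟨h, h'⟩⟩
    · exact h.isPolygon hm hp ha hk ht h'
    · refine isPolygon_rot.1 (h.isPolygon hm hp ha hk ht ?_)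
      rw [rot_rot]
      exact h'

end Arrangement

/-! ### Perturbed coordinates and adapted bump functions. -/

open MeasureTheory Filter Topology

/-- A Schwartz function with integral one and support in a given ball. -/
theorem exists_bump (c : ℝ) {ε : ℝ} (hε : 0 < ε) : ∃ b : 𝓢(ℝ, ℝ), HasCompactSupport b ∧
    ∫ x, b x = 1 ∧ ∀ z, b z ≠ 0 → |z - c| < ε := by
  let β : ContDiffBump c := ⟨ε / 2, ε, by positivity, by linarith⟩
  refine ⟨HasCompactSupport.toSchwartzMap (f := β.normed volume) β.hasCompactSupport_normed
    β.contDiff_normed, β.hasCompactSupport_normed, β.integral_normed, fun z hz => ?_⟩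
  have h : z ∈ Function.support (β.normed volume) := hz
  rw [β.support_normed_eq] at h
  simpa [Real.dist_eq] using h

namespace LineConfig

variable {N : ℕ} (F : LineConfig N)

/-- The arrangement `G` consists of the given lines, and the bump functions of `B` are supported in
disjoint neighbourhoods of the numbers `y_{pq}`. -/
structure Adapted (G : Arrangement (Fin N)) (B : Bumps N) (ε : ℝ) : Prop where
  pos : 0 < ε
  t_eq : G.t = F.t
  s_eq : G.s = F.s
  point_eq : B.point = G.y
  support : ∀ p q z, B.bump p q z ≠ 0 → |z - G.y p q| < ε
  separated : ∀ p q p' q', G.y p q ≠ G.y p' q' → 2 * ε ≤ |G.y p q - G.y p' q'|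

theorem exists_arrangement : ∃ G : Arrangement (Fin N), G.t = F.t ∧ G.s = F.s := by
  let x : Fin N → Fin N → ℝ := fun p q => (F.s q - F.s p) / (F.t p - F.t q)
  have hx : ∀ p q, x p q = x q p := by
    intro p q
    simp only [x]
    rw [← neg_div_neg_eq]
    congr 1 <;> ring
  -- `κ` numbers the unordered pairs in base `N`. Adding `δ κ` with small `δ > 0` breaks the ties
  -- among the `x p q` without reversing a strict inequality.
  let κ : Fin N → Fin N → ℝ := fun p q => (min p q : Fin N).1 + (max p q : Fin N).1 * N
  have hκ : ∀ p q p' q', κ p q = κ p' q' → (p = p' ∧ q = q') ∨ (p = q' ∧ q = p') := by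
    intro p q p' q' h
    have h1 : (min p q : Fin N).1 + (max p q : Fin N).1 * N =
        (min p' q' : Fin N).1 + (max p' q' : Fin N).1 * N := by
      simp only [κ] at h
      exact_mod_cast h
    have hdiv : ∀ u v : Fin N, (u.1 + v.1 * N) / N = v.1 := fun u v => by
      rw [Nat.add_mul_div_right _ _ (Fin.pos p), Nat.div_eq_of_lt u.2, zero_add]
    have e1 : (max p q : Fin N).1 = (max p' q' : Fin N).1 := by
      rw [← hdiv (min p q) (max p q), h1, hdiv]
    have e2 : (min p q : Fin N).1 = (min p' q' : Fin N).1 := by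
      rw [e1] at h1
      omega
    have e1' := Fin.ext e1
    have e2' := Fin.ext e2
    rcases le_total p q with h2 | h2 <;> rcases le_total p' q' with h3 | h3 <;>
      simp only [max_eq_right, max_eq_left, min_eq_left, min_eq_right, h2, h3] at e1' e2' <;> tauto
  have hev : ∀ᶠ δ in 𝓝[>] (0 : ℝ), ∀ p q p' q', x p q < x p' q' →
      x p q + δ * κ p q < x p' q' + δ * κ p' q' := by
    simp only [eventually_all]
    intro p q p' q' h
    refine eventually_nhdsWithin_of_eventually_nhds ?_
    refine ContinuousAt.eventually_lt (by fun_prop) (by fun_prop) ?_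
    simpa using h
  obtain ⟨δ, hδ, hpos⟩ := (hev.and self_mem_nhdsWithin).exists
  have hpos : 0 < δ := hpos
  refine ⟨{ t := F.t, s := F.s, y := fun p q => x p q + δ * κ p q, t_ne := F.slope_ne,
            no_three := ?_, y_symm := ?_, y_ne := ?_, y_lt := ?_ }, rfl, rfl⟩
  · intro p q r hpq hqr hpr z h1 h2
    refine F.no_three p q r hpq hqr hpr ⟨(z, F.t p * z + F.s p), ?_, ?_, ?_⟩
    · rw [F.eval_derivative]
    · rw [F.eval_derivative]
      exact h1
    · rw [F.eval_derivative]
      exact h1.trans h2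
  · intro p q
    simp only [hx p q, κ, min_comm p q, max_comm p q]
  · intro p q p' q' _ _ h
    rcases lt_trichotomy (x p q) (x p' q') with h1 | h1 | h1
    · exact absurd h (hδ _ _ _ _ h1).ne
    · refine hκ _ _ _ _ ?_
      simp only [h1] at h
      exact mul_left_cancel₀ hpos.ne' (add_left_cancel h)
    · exact absurd h (hδ _ _ _ _ h1).ne'
  · intro p q p' q' _ _ h
    exact hδ _ _ _ _ h

theorem exists_adapted : ∃ (G : Arrangement (Fin N)) (B : Bumps N) (ε : ℝ), F.Adapted G B ε := by
  obtain ⟨G, ht, hs⟩ := F.exists_arrangement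
  have hev : ∀ᶠ ε in 𝓝[>] (0 : ℝ), ∀ p q p' q', G.y p q ≠ G.y p' q' →
      2 * ε < |G.y p q - G.y p' q'| := by
    simp only [eventually_all]
    intro p q p' q' h
    refine eventually_nhdsWithin_of_eventually_nhds ?_
    refine ContinuousAt.eventually_lt (by fun_prop) (by fun_prop) ?_
    simpa [sub_eq_zero] using h
  obtain ⟨ε, hε, hpos⟩ := (hev.and self_mem_nhdsWithin).exists
  choose b hb1 hb2 hb3 using fun p q => exists_bump (G.y p q) hpos
  exact ⟨G, ⟨G.y, b, hb1, hb2⟩, ε, hpos, ht, hs, rfl, hb3, fun p q p' q' h => (hε p q p' q' h).le⟩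

namespace Adapted

variable {F} {G : Arrangement (Fin N)} {B : Bumps N} {ε : ℝ}

open Classical in
theorem setIntegral_bump (A : F.Adapted G B ε) (p q : Fin N) {z : ℝ} (hz : ε ≤ |z - G.y p q|) :
    ∫ x in Set.Iic z, B.bump p q x = if G.y p q < z then 1 else 0 := by
  have hpos := A.pos
  split_ifs with h
  · rw [← B.integral_eq_one p q]
    refine setIntegral_eq_integral_of_forall_compl_eq_zero fun x hx => ?_
    by_contra h0
    have h1 := A.support p q x h0
    rw [Set.mem_Iic, not_le] at hx
    rw [abs_of_pos (by linarith)] at hz h1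
    linarith
  · refine setIntegral_eq_zero_of_forall_eq_zero fun x hx => ?_
    by_contra h0
    have h1 := A.support p q x h0
    rw [Set.mem_Iic] at hx
    rw [abs_of_nonpos (by linarith)] at hz h1
    linarith

end Adapted

end LineConfig

/-- A real number which is `1` or `-1`. -/
def IsSign (x : ℝ) : Prop := x = 1 ∨ x = -1

theorem IsSign.mul {x y : ℝ} (hx : IsSign x) (hy : IsSign y) : IsSign (x * y) := by
  rcases hx with rfl | rfl <;> rcases hy with rfl | rfl <;> simp [IsSign]

theorem IsSign.neg {x : ℝ} (hx : IsSign x) : IsSign (-x) := by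
  rcases hx with rfl | rfl <;> simp [IsSign]

theorem isSign_one : IsSign 1 := .inl rfl

theorem isSign_zpow (n : ℤ) : IsSign ((-1) ^ n) := by
  rcases Int.even_or_odd n with h | h
  · exact .inl h.neg_one_zpow
  · exact .inr h.neg_one_zpow

open Classical in
/-- The truth value of a proposition, as a real number. -/
noncomputable def ind (P : Prop) : ℝ := if P then 1 else 0

theorem ind_true {P : Prop} (h : P) : ind P = 1 := if_pos h

theorem ind_false {P : Prop} (h : ¬P) : ind P = 0 := if_neg h

theorem ind_congr {P Q : Prop} (h : P ↔ Q) : ind P = ind Q := by rw [propext h]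

theorem ind_neg_lt_neg {x y : ℝ} (h : x ≠ y) : ind (-x < -y) = 1 - ind (x < y) := by
  rcases lt_or_gt_of_ne h with h1 | h1
  · rw [ind_true h1, ind_false (by linarith), sub_self]
  · rw [ind_false (not_lt_of_gt h1), ind_true (by linarith), sub_zero]

/-! ### Step functions produced by the homotopies, and their coefficients. -/

namespace Arrangement

variable {ι : Type*} (G : Arrangement ι)

open Classical in
/-- The function obtained by applying the homotopy for the lines `a i`, `a (m + 1)` to a bump
function centered at `Y`. -/
noncomputable def jump (a : ℕ → ι) (i m : ℕ) (Y z : ℝ) : ℝ :=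
  if G.t (a i) < G.t (a (m + 1)) then ind (Y < z) - ind (Y < G.y (a i) (a (m + 1)))
  else ind (Y < z) - ind (G.y (a i) (a (m + 1)) < z)

variable {G} {a : ℕ → ι} {i m : ℕ}

/-- A half turn replaces each indicator by its complement, which changes the sign of a difference of
two. -/
theorem jump_rot {Y z : ℝ} (h1 : z ≠ Y) (h2 : z ≠ G.y (a i) (a (m + 1)))
    (h3 : Y ≠ G.y (a i) (a (m + 1))) : G.rot.jump a i m (-Y) (-z) = -G.jump a i m Y z := by
  have e1 := ind_neg_lt_neg h1.symm
  have e2 := ind_neg_lt_neg h2.symm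
  have e3 := ind_neg_lt_neg h3
  by_cases h : G.t (a i) < G.t (a (m + 1))
  · have h' : G.rot.t (a i) < G.rot.t (a (m + 1)) := h
    rw [jump, jump, if_pos h, if_pos h']
    simp only [rot]
    linarith
  · have h' : ¬G.rot.t (a i) < G.rot.t (a (m + 1)) := h
    rw [jump, jump, if_neg h, if_neg h']
    simp only [rot]
    linarith

variable (him : i ≤ m) (ha : Set.InjOn a (Set.Icc i (m + 1 + 1)))

include him ha

/-- This turns the coefficient of the last bump into a statement about the region of the longer
word. -/
theorem gt_and_right_last_iff :
    (G.t (a (m + 1 + 1)) < G.t (a (m + 1)) ∧ G.Right a i m (G.vy a (m + 1))) ↔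
      G.OpenRight a i (m + 1) ∧ G.vy a i < G.vy a (m + 1) :=
  ⟨fun h => ⟨.of_right_last him ha h.1 h.2, h.2.first_lt⟩, fun h => h.1.right_last him ha h.2⟩

theorem gt_and_right_first_iff :
    (G.t (a (i + 1)) < G.t (a i) ∧ G.Right a (i + 1) (m + 1) (G.vy a i)) ↔
      G.OpenRight a i (m + 1) ∧ G.vy a (m + 1) < G.vy a i :=
  ⟨fun h => ⟨.of_right_first him ha h.1 h.2, h.2.last_lt⟩, fun h => h.1.right_first him ha h.2⟩

omit him in
theorem y_ne_of_injOn {p q p' q' : ℕ} (hp : i ≤ p) (hpq : p < q) (hq : q ≤ m + 1 + 1)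
    (hp' : i ≤ p') (hpq' : p' < q') (hq' : q' ≤ m + 1 + 1) (h : p ≠ p' ∨ q ≠ q') :
    G.y (a p) (a q) ≠ G.y (a p') (a q') := by
  intro e
  have hinj : ∀ {u v : ℕ}, i ≤ u → u ≤ m + 1 + 1 → i ≤ v → v ≤ m + 1 + 1 → a u = a v → u = v :=
    fun h1 h2 h3 h4 h5 => ha ⟨h1, h2⟩ ⟨h3, h4⟩ h5
  rcases G.y_ne _ _ _ _ (fun e => hpq.ne (hinj hp (by omega) (by omega) hq e))
    (fun e => hpq'.ne (hinj hp' (by omega) (by omega) hq' e)) e with ⟨e1, e2⟩ | ⟨e1, e2⟩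
  · have e1 := hinj (by omega) (by omega) (by omega) (by omega) e1
    have e2 := hinj (by omega) (by omega) (by omega) (by omega) e2
    omega
  · have e1 := hinj (by omega) (by omega) (by omega) (by omega) e1
    have e2 := hinj (by omega) (by omega) (by omega) (by omega) e2
    omega

/-- If the outer lines meet to the left, the base point lies to the left of the bump and the jump is
a plain step. If they meet to the right, the correcting bump sits there and switches the step off
again. Both agree with `Right`. -/
theorem OpenRight.jump_last (h : G.OpenRight a i (m + 1)) (hy : G.vy a i < G.vy a (m + 1)) {z : ℝ}
    (hz : z ≠ G.y (a i) (a (m + 1 + 1))) :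
    G.jump a i (m + 1) (G.vy a (m + 1)) z = ind (G.Right a i (m + 1) z) := by
  have hR : G.Right a i (m + 1) z ↔ G.vy a (m + 1) < z ∧
      (G.t (a (m + 1 + 1)) < G.t (a i) → z < G.y (a i) (a (m + 1 + 1))) ∧
      (G.t (a i) < G.t (a (m + 1 + 1)) → G.y (a i) (a (m + 1 + 1)) < z) :=
    ⟨fun r => ⟨r.last_lt, r.lt_of_gt, r.lt_of_lt⟩, fun r => ⟨h, hy.trans r.1, r.1, r.2.1, r.2.2⟩⟩
  rw [ind_congr hR]
  have hne := ne_of_injOn ha le_rfl (show i ≤ m + 1 + 1 by omega) (by omega) le_rfl (by omega)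
  unfold jump
  rcases lt_or_gt_of_ne (G.t_ne _ _ hne) with ht | ht
  · have h1 := (h.lt_of_lt (by omega) ha ht).2
    rw [if_pos ht, ind_false (not_lt_of_gt h1), sub_zero]
    refine ind_congr ⟨fun h2 => ⟨h2, fun h3 => absurd ht (lt_asymm h3), fun _ => h1.trans h2⟩,
      fun h2 => h2.1⟩
  · have h1 := (h.lt_of_gt (by omega) ha ht).2
    rw [if_neg (lt_asymm ht)]
    rcases lt_or_gt_of_ne hz with h2 | h2
    · rw [ind_false (not_lt_of_gt h2), sub_zero]
      exact ind_congr ⟨fun h3 => ⟨h3, fun _ => h2, fun h4 => absurd ht (lt_asymm h4)⟩,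
        fun h3 => h3.1⟩
    · rw [ind_true h2, ind_true (h1.trans h2), sub_self,
        ind_false fun h3 => lt_asymm (h3.2.1 ht) h2]

theorem OpenRight.jump_first (h : G.OpenRight a i (m + 1)) (hy : G.vy a (m + 1) < G.vy a i) {z : ℝ}
    (hz : z ≠ G.y (a i) (a (m + 1 + 1))) :
    G.jump a i (m + 1) (G.vy a i) z = ind (G.Right a i (m + 1) z) := by
  have hR : G.Right a i (m + 1) z ↔ G.vy a i < z ∧
      (G.t (a (m + 1 + 1)) < G.t (a i) → z < G.y (a i) (a (m + 1 + 1))) ∧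
      (G.t (a i) < G.t (a (m + 1 + 1)) → G.y (a i) (a (m + 1 + 1)) < z) :=
    ⟨fun r => ⟨r.first_lt, r.lt_of_gt, r.lt_of_lt⟩, fun r => ⟨h, r.1, hy.trans r.1, r.2.1, r.2.2⟩⟩
  rw [ind_congr hR]
  have hne := ne_of_injOn ha le_rfl (show i ≤ m + 1 + 1 by omega) (by omega) le_rfl (by omega)
  unfold jump
  rcases lt_or_gt_of_ne (G.t_ne _ _ hne) with ht | ht
  · have h1 := (h.lt_of_lt (by omega) ha ht).1
    rw [if_pos ht, ind_false (not_lt_of_gt h1), sub_zero]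
    refine ind_congr ⟨fun h2 => ⟨h2, fun h3 => absurd ht (lt_asymm h3), fun _ => h1.trans h2⟩,
      fun h2 => h2.1⟩
  · have h1 := (h.lt_of_gt (by omega) ha ht).1
    rw [if_neg (lt_asymm ht)]
    rcases lt_or_gt_of_ne hz with h2 | h2
    · rw [ind_false (not_lt_of_gt h2), sub_zero]
      exact ind_congr ⟨fun h3 => ⟨h3, fun _ => h2, fun h4 => absurd ht (lt_asymm h4)⟩,
        fun h3 => h3.1⟩
    · rw [ind_true h2, ind_true (h1.trans h2), sub_self,
        ind_false fun h3 => lt_asymm (h3.2.1 ht) h2]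

/-- The possible coefficients of the two bump functions which appear in the transferred maps on the
word `a i, …, a (m + 2)`. -/
theorem coefficient_cases {σ τ σ' τ' : ℝ} (hσ : IsSign σ) (hτ : IsSign τ) (hσ' : IsSign σ')
    (hτ' : IsSign τ') {κ κ' : ℝ}
    (hκ : κ = ind (G.t (a (m + 1 + 1)) < G.t (a (m + 1))) *
      (σ * ind (G.Right a i m (G.vy a (m + 1))) + τ * ind (G.rot.Right a i m (G.rot.vy a (m + 1)))))
    (hκ' : κ' = ind (G.t (a (i + 1)) < G.t (a i)) *
      (σ' * ind (G.Right a (i + 1) (m + 1) (G.vy a i)) +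
        τ' * ind (G.rot.Right a (i + 1) (m + 1) (G.rot.vy a i)))) :
    (¬G.OpenRight a i (m + 1) ∧ ¬G.rot.OpenRight a i (m + 1) ∧ κ = 0 ∧ κ' = 0) ∨
    (G.OpenRight a i (m + 1) ∧ ¬G.rot.OpenRight a i (m + 1) ∧
      (G.vy a i < G.vy a (m + 1) ∧ IsSign κ ∧ κ' = 0 ∨
        G.vy a (m + 1) < G.vy a i ∧ κ = 0 ∧ IsSign κ')) ∨
    (G.rot.OpenRight a i (m + 1) ∧ ¬G.OpenRight a i (m + 1) ∧
      (G.rot.vy a i < G.rot.vy a (m + 1) ∧ IsSign κ ∧ κ' = 0 ∨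
        G.rot.vy a (m + 1) < G.rot.vy a i ∧ κ = 0 ∧ IsSign κ')) := by
  have hmul : ∀ P Q : Prop, ind P * ind Q = ind (P ∧ Q) := by
    intro P Q
    by_cases hP : P <;> by_cases hQ : Q <;> simp [ind, hP, hQ]
  have e : κ = σ * ind (G.OpenRight a i (m + 1) ∧ G.vy a i < G.vy a (m + 1)) +
      τ * ind (G.rot.OpenRight a i (m + 1) ∧ G.rot.vy a i < G.rot.vy a (m + 1)) := by
    rw [hκ, ← ind_congr (gt_and_right_last_iff him ha),
      ← ind_congr (gt_and_right_last_iff (G := G.rot) him ha), ← hmul, ← hmul]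
    simp only [rot]
    ring
  have e' : κ' = σ' * ind (G.OpenRight a i (m + 1) ∧ G.vy a (m + 1) < G.vy a i) +
      τ' * ind (G.rot.OpenRight a i (m + 1) ∧ G.rot.vy a (m + 1) < G.rot.vy a i) := by
    rw [hκ', ← ind_congr (gt_and_right_first_iff him ha),
      ← ind_congr (gt_and_right_first_iff (G := G.rot) him ha), ← hmul, ← hmul]
    simp only [rot]
    ring
  have hne : G.vy a i ≠ G.vy a (m + 1) :=
    y_ne_of_injOn ha le_rfl (by omega) (by omega) (by omega) (by omega) (by omega) (by omega)
  by_cases h1 : G.OpenRight a i (m + 1)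
  · have h2 : ¬G.rot.OpenRight a i (m + 1) := fun h2 => h1.not_rot (by omega) ha h2
    refine .inr (.inl ⟨h1, h2, ?_⟩)
    rcases lt_or_gt_of_ne hne with h3 | h3
    · exact .inl ⟨h3, by simpa [e, ind, h1, h2, h3] using hσ, by simp [e', ind, h2, h3.le]⟩
    · exact .inr ⟨h3, by simp [e, ind, h2, h3.le], by simpa [e', ind, h1, h2, h3] using hσ'⟩
  · by_cases h2 : G.rot.OpenRight a i (m + 1)
    · refine .inr (.inr ⟨h2, h1, ?_⟩)
      rcases lt_or_gt_of_ne hne with h3 | h3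
      · have h3 : G.rot.vy a (m + 1) < G.rot.vy a i := neg_lt_neg h3
        exact .inr ⟨h3, by simp [e, ind, h1, h3.le], by simpa [e', ind, h1, h2, h3] using hτ'⟩
      · have h3 : G.rot.vy a i < G.rot.vy a (m + 1) := neg_lt_neg h3
        exact .inl ⟨h3, by simpa [e, ind, h1, h2, h3] using hτ, by simp [e', ind, h1, h3.le]⟩
    · exact .inl ⟨h1, h2, by simp [e, ind, h1, h2], by simp [e', ind, h1, h2]⟩

/-- At most one of the two bumps survives, and the homotopy maps it to the indicator of the
condition `Right` for the longer word or, after a half turn, for the rotated arrangement. -/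
theorem exists_sign_jump {σ τ σ' τ' : ℝ} (hσ : IsSign σ) (hτ : IsSign τ) (hσ' : IsSign σ')
    (hτ' : IsSign τ') {κ κ' : ℝ}
    (hκ : κ = ind (G.t (a (m + 1 + 1)) < G.t (a (m + 1))) *
      (σ * ind (G.Right a i m (G.vy a (m + 1))) + τ * ind (G.rot.Right a i m (G.rot.vy a (m + 1)))))
    (hκ' : κ' = ind (G.t (a (i + 1)) < G.t (a i)) *
      (σ' * ind (G.Right a (i + 1) (m + 1) (G.vy a i)) +
        τ' * ind (G.rot.Right a (i + 1) (m + 1) (G.rot.vy a i)))) :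
    ∃ ρ ρ', IsSign ρ ∧ IsSign ρ' ∧ ∀ z, z ≠ G.vy a i → z ≠ G.vy a (m + 1) →
      z ≠ G.y (a i) (a (m + 1 + 1)) →
      -(κ * G.jump a i (m + 1) (G.vy a (m + 1)) z + κ' * G.jump a i (m + 1) (G.vy a i) z) =
        ρ * ind (G.Right a i (m + 1) z) + ρ' * ind (G.rot.Right a i (m + 1) (-z)) := by
  have hR : ∀ {G : Arrangement ι} {z : ℝ}, ¬G.OpenRight a i (m + 1) →
      ind (G.Right a i (m + 1) z) = 0 := fun h => ind_false fun h' => h h'.openRight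
  have hn1 : G.vy a (m + 1) ≠ G.y (a i) (a (m + 1 + 1)) :=
    y_ne_of_injOn ha (by omega) (by omega) (by omega) (by omega) (by omega) (by omega) (by omega)
  have hn2 : G.vy a i ≠ G.y (a i) (a (m + 1 + 1)) :=
    y_ne_of_injOn ha (by omega) (by omega) (by omega) (by omega) (by omega) (by omega) (by omega)
  rcases coefficient_cases him ha hσ hτ hσ' hτ' hκ hκ' with
    ⟨h1, h2, h3, h4⟩ | ⟨h1, h2, ⟨h3, h4, h5⟩ | ⟨h3, h4, h5⟩⟩ | ⟨h1, h2, ⟨h3, h4, h5⟩ | ⟨h3, h4, h5⟩⟩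
  · refine ⟨1, 1, isSign_one, isSign_one, fun z _ _ _ => ?_⟩
    rw [hR h1, hR h2, h3, h4]
    ring
  -- The second sign is arbitrary, since it multiplies a vanishing indicator.
  · refine ⟨-κ, 1, h4.neg, isSign_one, fun z _ _ hz => ?_⟩
    rw [hR h2, h1.jump_last him ha h3 hz, h5]
    ring
  · refine ⟨-κ', 1, h5.neg, isSign_one, fun z _ _ hz => ?_⟩
    rw [hR h2, h1.jump_first him ha h3 hz, h4]
    ring
  · refine ⟨1, κ, isSign_one, h4, fun z hz1 hz2 hz => ?_⟩
    rw [hR h2, ← h1.jump_last him ha h3 (z := -z) (neg_injective.ne hz), vy_rot,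
      jump_rot hz2 hz hn1, h5]
    ring
  · refine ⟨1, κ', isSign_one, h5, fun z hz1 hz2 hz => ?_⟩
    rw [hR h2, ← h1.jump_first him ha h3 (z := -z) (neg_injective.ne hz), vy_rot,
      jump_rot hz1 hz hn2, h4]
    ring

omit him ha in
/-- Exactly one of the products of truth values is nonzero if the lines form a polygon. -/
theorem sum_right_left (hm : 1 ≤ m) (hp : Function.Periodic a (m + 2))
    (ha : Set.InjOn a (Set.Icc 0 (m + 1))) (ht : G.t (a 0) < G.t (a (m + 1)))
    {s σ τ σ' τ' : ℕ → ℝ} (hs : ∀ e, IsSign (s e)) (hσ : ∀ e, IsSign (σ e))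
    (hτ : ∀ e, IsSign (τ e)) (hσ' : ∀ e, IsSign (σ' e)) (hτ' : ∀ e, IsSign (τ' e)) {T : ℝ}
    (hT : T = ∑ e ∈ Finset.Ico 0 m, s e *
      ((σ e * ind (G.Right a 0 e (G.vy a (m + 1))) +
        τ e * ind (G.rot.Right a 0 e (G.rot.vy a (m + 1)))) *
      (σ' e * ind (G.Right a (e + 1) m (G.vy a (m + 1))) +
        τ' e * ind (G.rot.Right a (e + 1) m (G.rot.vy a (m + 1)))))) :
    (G.IsPolygon a → IsSign T) ∧ (¬G.IsPolygon a → T = 0) := by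
  have hne : ∀ {p q : ℕ}, p ≤ m + 1 → q ≤ m + 1 → p ≠ q → a p ≠ a q :=
    fun hp hq => ne_of_injOn ha (Nat.zero_le _) (Nat.zero_le _) hp hq
  -- The first condition puts the closing vertex below the line `a (e + 1)`, the second one above
  -- it.
  have key : ∀ (G : Arrangement ι) (e : ℕ), e < m → G.Right a 0 e (G.vy a (m + 1)) →
      ¬G.Right a (e + 1) m (G.vy a (m + 1)) := by
    intro G e he h h'
    have h1 := h.lt_of_gt
    have h2 := h.lt_of_lt
    rw [vy_last hp, G.y_symm (a (m + 1))] at h1 h2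
    have h3 := (ln_lt_iff_of_lower (hne (by omega) (by omega) (by omega))
      (hne (by omega) (by omega) (by omega)) (hne (by omega) (by omega) (by omega))).1 ⟨h1, h2⟩
    have h1' := h'.lt_of_gt
    have h2' := h'.lt_of_lt
    rw [vy_last hp] at h1' h2'
    have h4 := (ln_lt_iff_of_upper (hne (by omega) (by omega) (by omega))
      (hne (by omega) (by omega) (by omega)) (hne (by omega) (by omega) (by omega))).1 ⟨h1', h2'⟩
    rw [x_symm] at h3
    have h5 : G.ln (a (m + 1)) (G.x (a (m + 1)) (a 0)) = G.ln (a 0) (G.x (a (m + 1)) (a 0)) :=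
      ln_x (hne (by omega) (by omega) (by omega))
    linarith
  -- The vertex `e + 1` would lie on both sides of the vertical line at the closing vertex.
  have key2 : ∀ (G : Arrangement ι) (e e' : ℕ), e' < m → e < e' →
      G.Right a 0 e' (G.vy a (m + 1)) → ¬G.rot.Right a (e + 1) m (G.rot.vy a (m + 1)) := by
    intro G e e' he' hee h h'
    obtain ⟨j, hj⟩ := h.openRight
    have h1 := hj.vy_lt (ha.mono (Set.Icc_subset_Icc le_rfl (by omega))) (Nat.zero_le (e + 1))
      (by omega) h.first_lt h.last_lt
    exact lt_asymm h1 (neg_lt_neg_iff.1 h'.first_lt)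
  have key3 : ∀ (G : Arrangement ι) (e e' : ℕ), G.Right a 0 e (G.vy a (m + 1)) →
      ¬G.rot.Right a 0 e' (G.rot.vy a (m + 1)) := fun G e e' h h' =>
    lt_asymm h.first_lt (neg_lt_neg_iff.1 h'.first_lt)
  have key4 : ∀ (G : Arrangement ι) (e : ℕ), G.Right a (e + 1) m (G.vy a (m + 1)) →
      ¬G.rot.Right a (e + 1) m (G.rot.vy a (m + 1)) := fun G e h h' =>
    lt_asymm h.first_lt (neg_lt_neg_iff.1 h'.first_lt)
  have hrr : ∀ e, G.rot.rot.Right a (e + 1) m (G.rot.rot.vy a (m + 1)) ↔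
      G.Right a (e + 1) m (G.vy a (m + 1)) := fun e => by rw [rot_rot]
  have hrr' : ∀ e, G.rot.rot.Right a 0 e (G.rot.rot.vy a (m + 1)) ↔
      G.Right a 0 e (G.vy a (m + 1)) := fun e => by rw [rot_rot]
  rw [isPolygon_iff_of_lt hm hp ha ht]
  constructor
  · rintro ⟨k, hk, h⟩
    have hT' := hT.trans (Finset.sum_eq_single_of_mem k (by simpa using hk) fun e he hek => ?_)
    · rw [hT']
      rcases h with ⟨h1, h2⟩ | ⟨h1, h2⟩
      · rw [ind_true h1, ind_false (key3 G k k h1), ind_true h2, ind_false (fun h => key4 G k h h2)]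
        simpa using (hs k).mul ((hσ k).mul (hτ' k))
      · rw [ind_true h1, ind_false (fun h => key3 G k k h h1), ind_true h2, ind_false (key4 G k h2)]
        simpa using (hs k).mul ((hτ k).mul (hσ' k))
    · have he : e < m := by simpa using he
      rcases lt_or_gt_of_ne hek with h0 | h0
      · rcases h with ⟨h1, h2⟩ | ⟨h1, h2⟩
        · rw [ind_false (fun h => key3 G k e h1 h), ind_false (key2 G e k hk h0 h1)]
          by_cases h3 : G.Right a 0 e (G.vy a (m + 1))
          · rw [ind_false (key G e he h3)]
            ring
          · rw [ind_false h3]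
            ring
        · rw [ind_false (fun h => key3 G e k h h1),
            ind_false (fun h => key2 G.rot e k hk h0 h1 ((hrr e).2 h))]
          by_cases h3 : G.rot.Right a 0 e (G.rot.vy a (m + 1))
          · rw [ind_false (key G.rot e he h3)]
            ring
          · rw [ind_false h3]
            ring
      · rcases h with ⟨h1, h2⟩ | ⟨h1, h2⟩
        · rw [ind_false (fun h => key3 G k e h1 h), ind_false (fun h => key2 G k e he h0 h h2)]
          ring
        · rw [ind_false (fun h => key3 G e k h h1),
            ind_false (fun h => key2 G.rot k e he h0 h ((hrr k).2 h2))]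
          ring
  · intro h
    rw [hT]
    refine Finset.sum_eq_zero fun e he => ?_
    have he : e < m := by simpa using he
    push Not at h
    obtain ⟨h1, h2⟩ := h e he
    by_cases h3 : G.Right a 0 e (G.vy a (m + 1))
    · rw [ind_false (key3 G e e h3), ind_false (key G e he h3), ind_false (h1 h3)]
      ring
    · rw [ind_false h3]
      by_cases h4 : G.rot.Right a 0 e (G.rot.vy a (m + 1))
      · rw [ind_false (key G.rot e he h4), ind_false (h2 h4)]
        ring
      · rw [ind_false h4]
        ring

end Arrangement

/-! ### Transferred maps on consecutive letters of a sequence. -/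

section Subwords

variable {ι : Type*}

/-- The letters `a (i + 1), …, a (i + n)`. -/
def word (a : ℕ → ι) (i n : ℕ) : List ι := (List.range' (i + 1) n).map a

theorem length_word (a : ℕ → ι) (i n : ℕ) : (word a i n).length = n := by simp [word]

theorem take_word (a : ℕ → ι) (i : ℕ) {k n : ℕ} (h : k ≤ n) : (word a i n).take k = word a i k := by
  rw [word, ← List.map_take, List.take_range'_of_length_ge h, word]

theorem drop_word (a : ℕ → ι) (i k n : ℕ) : (word a i n).drop k = word a (i + k) (n - k) := by
  rw [word, ← List.map_drop, List.drop_range', word]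
  congr 2
  omega

theorem word_succ (a : ℕ → ι) (i n : ℕ) : word a i (n + 1) = a (i + 1) :: word a (i + 1) n := by
  rw [word, List.range'_succ, List.map_cons, word]

theorem lastLetter_word (a : ℕ → ι) (i n : ℕ) : lastLetter (a i) (word a i n) = a (i + n) := by
  induction n generalizing i with
  | zero => rfl
  | succ n ih =>
    rw [word_succ, lastLetter, ih]
    congr 1
    omega

namespace TransferData

variable {T : Type*} [AddCommGroup T] [Module ℝ T] (D : TransferData ι T)

/-- The structure constants of the transferred functor on the letters `a i, …, a (m + 1)`. -/
noncomputable def phiW (a : ℕ → ι) (i m : ℕ) : T := D.phi (a i) (word a i (m + 1 - i))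

/-- The value of `lam` on the letters `a i, …, a (m + 1)`. -/
noncomputable def lamW (a : ℕ → ι) (i m : ℕ) : T := D.lam (a i) (word a i (m + 1 - i))

/-- The structure constants of the transferred products on the letters `a i, …, a (m + 1)`. -/
noncomputable def muW (a : ℕ → ι) (i m : ℕ) : ℝ := D.mu (a i) (word a i (m + 1 - i))

theorem phiW_self (a : ℕ → ι) (i : ℕ) : D.phiW a i i = D.e (a i) (a (i + 1)) := by
  rw [phiW, Nat.add_sub_cancel_left]
  exact D.phi_singleton _ _

theorem phiW_of_lt (a : ℕ → ι) {i m : ℕ} (h : i < m) :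
    D.phiW a i m = -D.h (a i) (a (m + 1)) (D.lamW a i m) := by
  rw [phiW, D.phi_of_two_le _ _ (by rw [length_word]; omega), lastLetter_word, lamW]
  congr 4
  omega

theorem muW_eq (a : ℕ → ι) {i m : ℕ} (h : i ≤ m) :
    D.muW a i m = D.p (a i) (a (m + 1)) (D.lamW a i m) := by
  rw [muW, mu, lastLetter_word, lamW]
  congr 3
  omega

/-- The cuts at the two end letters have an empty factor and vanish, so `e` runs over the proper
cuts. -/
theorem lamW_eq (a : ℕ → ι) {i m : ℕ} (h : i ≤ m) : D.lamW a i m = ∑ e ∈ Finset.Ico i m,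
    (-1 : ℝ) ^ wdeg D.sdeg (a i) (word a i (e + 1 - i)) •
      D.mul (D.phiW a i e) (D.phiW a (e + 1) m) := by
  obtain ⟨d, rfl⟩ := Nat.exists_eq_add_of_le h
  rw [lamW, lam, conv_eq_sum, length_word, Finset.sum_Ico_eq_sum_range, Finset.sum_range_succ,
    show i + d + 1 - i = d + 1 by omega, Finset.sum_range_succ', Nat.add_sub_cancel_left]
  have e1 : D.phi (lastLetter (a i) ((word a i (d + 1)).take (d + 1)))
      ((word a i (d + 1)).drop (d + 1)) = 0 := by
    rw [drop_word, Nat.sub_self]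
    rfl
  have e2 : twist D.sdeg D.phi (a i) ((word a i (d + 1)).take 0) = 0 := by
    rw [List.take_zero, twist, phi_nil, smul_zero]
  rw [e1, e2, map_zero, map_zero, LinearMap.zero_apply, add_zero, add_zero]
  refine Finset.sum_congr rfl fun k hk => ?_
  have hk : k < d := Finset.mem_range.1 hk
  rw [take_word _ _ (by omega), lastLetter_word, drop_word, twist, map_smul, LinearMap.smul_apply,
    phiW, phiW, show i + k + 1 - i = k + 1 by omega, show i + k + 1 = i + (k + 1) by omega,
    show i + d + 1 - (i + (k + 1)) = d + 1 - (k + 1) by omega]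

end TransferData

end Subwords

namespace Arrangement

variable {ι : Type*} {G : Arrangement ι} {a : ℕ → ι} {i m : ℕ}

/-- `Right` depends on `z` only through its position among the numbers `y` of the lines involved. -/
theorem right_congr (him : i ≤ m) {z z' : ℝ} (h : ∀ p q, i ≤ p → p < q → q ≤ m + 1 →
      (G.y (a p) (a q) < z ↔ G.y (a p) (a q) < z') ∧
        (z < G.y (a p) (a q) ↔ z' < G.y (a p) (a q))) :
    G.Right a i m z ↔ G.Right a i m z' := by
  have h1 := h i (i + 1) le_rfl (by omega) (by omega)
  have h2 := h m (m + 1) him (by omega) le_rfl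
  have h3 := h i (m + 1) le_rfl (by omega) le_rfl
  constructor
  · rintro ⟨r1, r2, r3, r4, r5⟩
    exact ⟨r1, h1.1.1 r2, h2.1.1 r3, fun r => h3.2.1 (r4 r), fun r => h3.1.1 (r5 r)⟩
  · rintro ⟨r1, r2, r3, r4, r5⟩
    exact ⟨r1, h1.1.2 r2, h2.1.2 r3, fun r => h3.2.2 (r4 r), fun r => h3.1.2 (r5 r)⟩

end Arrangement

/-! ### Exponents of the transferred maps. -/

namespace LineConfig

open MeasureTheory

variable {N : ℕ} (F : LineConfig N)

/-- The exponent `∑ (f_{a e} - f_{a (e + 1)} - c_e)`, where `c_e` is the critical value. -/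
noncomputable def expo (a : ℕ → Fin N) (i m : ℕ) (z : ℝ) : ℝ :=
  ∑ e ∈ Finset.Ico i (m + 1), (F.q (a e) (a (e + 1))).eval z

theorem expo_self (a : ℕ → Fin N) (i : ℕ) (z : ℝ) :
    F.expo a i i z = (F.q (a i) (a (i + 1))).eval z := by
  simp [expo]

theorem expo_add (a : ℕ → Fin N) {i e m : ℕ} (h1 : i ≤ e) (h2 : e < m) (z : ℝ) :
    F.expo a i e z + F.expo a (e + 1) m z = F.expo a i m z :=
  Finset.sum_Ico_consecutive _ (by omega) (by omega)

theorem eval_q (p q : Fin N) (z : ℝ) : (F.q p q).eval z =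
    (F.f p).eval z - (F.f q).eval z - (F.f p - F.f q).eval (F.v p q).1 := by
  simp [LineConfig.q]

theorem eval_q_critical (p q : Fin N) : (F.q p q).eval (F.v p q).1 = 0 := by
  rw [eval_q, eval_sub, sub_self]

/-- The polynomials telescope, so the exponent differs from `q (a i) (a (m + 1))` by a constant,
which is read off at the critical point, where the latter vanishes. -/
theorem expo_eq (a : ℕ → Fin N) {i m : ℕ} (h : i ≤ m) (z : ℝ) : F.expo a i m z =
    (F.q (a i) (a (m + 1))).eval z + F.expo a i m (F.v (a i) (a (m + 1))).1 := by
  have key : ∀ z, F.expo a i m z = (F.f (a i)).eval z - (F.f (a (m + 1))).eval z -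
      ∑ e ∈ Finset.Ico i (m + 1), (F.f (a e) - F.f (a (e + 1))).eval (F.v (a e) (a (e + 1))).1 := by
    intro z
    simp only [expo, eval_q, Finset.sum_sub_distrib (s := Finset.Ico i (m + 1)) (g := fun e =>
      (F.f (a e) - F.f (a (e + 1))).eval (F.v (a e) (a (e + 1))).1)]
    congr 1
    have := Finset.sum_Ico_sub (fun e => -(F.f (a e)).eval z) (show i ≤ m + 1 by omega)
    simpa [sub_eq_add_neg, add_comm] using this
  rw [key, key (F.v _ _).1, eval_q, eval_sub]
  ring

end LineConfig

/-! ### Homotopies applied to bump functions. -/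

namespace LineConfig

open MeasureTheory Arrangement

variable {N : ℕ} {F : LineConfig N} {G : Arrangement (Fin N)} {B : Bumps N} {ε : ℝ}
  {a : ℕ → Fin N} {i m : ℕ}

/-- The point `z` is not close to any `y_{pq}`, where `p`, `q` are among `a i, …, a (m + 1)`. -/
def Safe (G : Arrangement (Fin N)) (ε : ℝ) (a : ℕ → Fin N) (i m : ℕ) (z : ℝ) : Prop :=
  ∀ p q, i ≤ p → p < q → q ≤ m + 1 → ε ≤ |z - G.y (a p) (a q)|

namespace Adapted

variable (A : F.Adapted G B ε)

include A

theorem t_apply (p : Fin N) : G.t p = F.t p := congrFun A.t_eq p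

theorem vx_eq (e : ℕ) : G.vx a e = (F.v (a e) (a (e + 1))).1 := by
  rw [vx, x, A.s_eq, A.t_eq, v]

theorem ne_of_safe {z y : ℝ} (h : ε ≤ |z - y|) : z ≠ y := by
  rintro rfl
  rw [sub_self, abs_zero] at h
  exact absurd A.pos (not_lt.2 h)

theorem safe_of_ne {p q p' q' : Fin N} (h : G.y p q ≠ G.y p' q') : ε ≤ |G.y p q - G.y p' q'| := by
  have := A.separated _ _ _ _ h
  have := A.pos
  linarith

theorem safe_of_lt {p q p' q' : Fin N} (h : G.y p q ≠ G.y p' q') {z : ℝ} (hz : |z - G.y p q| < ε) :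
    ε ≤ |z - G.y p' q'| := by
  have h1 := A.separated _ _ _ _ h
  have h2 := abs_sub_le (G.y p q) z (G.y p' q')
  rw [abs_sub_comm (G.y p q) z] at h2
  linarith

theorem lt_iff_of_lt {p q p' q' : Fin N} (h : G.y p q ≠ G.y p' q') {z : ℝ}
    (hz : |z - G.y p q| < ε) : (G.y p' q' < z ↔ G.y p' q' < G.y p q) ∧
      (z < G.y p' q' ↔ G.y p q < G.y p' q') := by
  have h1 := A.separated _ _ _ _ h
  have h2 := A.pos
  rw [abs_lt] at hz
  rcases lt_or_gt_of_ne h with h3 | h3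
  · rw [abs_of_neg (by linarith)] at h1
    constructor
    · exact ⟨fun h4 => by linarith, fun h4 => by linarith⟩
    · exact ⟨fun h4 => by linarith, fun h4 => by linarith⟩
  · rw [abs_of_pos (by linarith)] at h1
    constructor
    · exact ⟨fun h4 => by linarith, fun h4 => by linarith⟩
    · exact ⟨fun h4 => by linarith, fun h4 => by linarith⟩

/-- On the support of a bump the indicators may be replaced by their values at its centre. -/
theorem right_congr_of_lt (him : i ≤ m) {p q : Fin N} {z : ℝ} (hz : |z - G.y p q| < ε)
    (h : ∀ p' q', i ≤ p' → p' < q' → q' ≤ m + 1 → G.y p q ≠ G.y (a p') (a q')) :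
    (G.Right a i m z ↔ G.Right a i m (G.y p q)) ∧
      (G.rot.Right a i m (-z) ↔ G.rot.Right a i m (G.rot.y p q)) := by
  refine ⟨right_congr him fun p' q' h1 h2 h3 => A.lt_iff_of_lt (h p' q' h1 h2 h3) hz,
    right_congr him fun p' q' h1 h2 h3 => ?_⟩
  have := A.lt_iff_of_lt (h p' q' h1 h2 h3) hz
  simp only [rot, neg_lt_neg_iff]
  exact ⟨this.2, this.1⟩

theorem integral_Iic_bump (p q : Fin N) {z : ℝ} (hz : ε ≤ |z - G.y p q|) :
    ∫ x in Set.Iic z, B.bump p q x = ind (G.y p q < z) := A.setIntegral_bump p q hz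

/-- The homotopy applied to a combination of two bump functions. -/
theorem solve_apply {φ : 𝓢(ℝ, ℝ)} {k k' : ℝ} {p q p' q' : Fin N}
    (hφ : ∀ y, Real.exp (-(F.q (a i) (a (m + 1))).eval y) * φ y =
      k * B.bump p q y + k' * B.bump p' q' y)
    (h1 : G.y (a i) (a (m + 1)) ≠ G.y p q) (h2 : G.y (a i) (a (m + 1)) ≠ G.y p' q') {z : ℝ}
    (hz : ε ≤ |z - G.y (a i) (a (m + 1))|) (hz1 : ε ≤ |z - G.y p q|) (hz2 : ε ≤ |z - G.y p' q'|) :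
    F.solve B (a i) (a (m + 1)) φ z = Real.exp ((F.q (a i) (a (m + 1))).eval z) *
      (k * G.jump a i m (G.y p q) z + k' * G.jump a i m (G.y p' q') z) := by
  have hint : ∀ (p q : Fin N), Integrable (B.bump p q) := fun p q => (B.bump p q).integrable
  have hsum : Integrable fun y => k * B.bump p q y + k' * B.bump p' q' y :=
    ((hint p q).const_mul k).add ((hint p' q').const_mul k')
  have hIic : ∀ w, ε ≤ |w - G.y p q| → ε ≤ |w - G.y p' q'| →
      ∫ y in Set.Iic w, (k * B.bump p q y + k' * B.bump p' q' y) =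
        k * ind (G.y p q < w) + k' * ind (G.y p' q' < w) := by
    intro w hw1 hw2
    rw [integral_add ((hint p q).const_mul k).integrableOn
      ((hint p' q').const_mul k').integrableOn, integral_const_mul, integral_const_mul,
      A.integral_Iic_bump p q hw1, A.integral_Iic_bump p' q' hw2]
  by_cases h : F.t (a i) < F.t (a (m + 1))
  · have h' : G.t (a i) < G.t (a (m + 1)) := by rwa [A.t_apply, A.t_apply]
    simp only [solve, h, dif_pos]
    change solveConcave _ (F.concave_q h) _ 0 φ z = _
    rw [solveConcave_apply, zero_add]
    congr 1
    simp only [hφ, A.point_eq]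
    rw [← intervalIntegral.integral_Iic_sub_Iic hsum.integrableOn hsum.integrableOn,
      hIic z hz1 hz2, hIic _ (A.safe_of_ne h1) (A.safe_of_ne h2), jump, jump, if_pos h', if_pos h']
    ring
  · have h' : ¬G.t (a i) < G.t (a (m + 1)) := by rwa [A.t_apply, A.t_apply]
    simp only [solve, h, dif_neg, not_false_eq_true]
    change solveConvex _ (F.convex_q h) _ (B.hasCompactSupport _ _) (B.integral_eq_one _ _) φ z = _
    rw [solveConvex_apply]
    congr 1
    simp only [hφ]
    have htot : ∫ y, (k * B.bump p q y + k' * B.bump p' q' y) = k + k' := by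
      rw [integral_add ((hint p q).const_mul k) ((hint p' q').const_mul k'), integral_const_mul,
        integral_const_mul, B.integral_eq_one, B.integral_eq_one, mul_one, mul_one]
    rw [htot, integral_sub hsum.integrableOn ((hint _ _).const_mul _).integrableOn,
      integral_const_mul, hIic z hz1 hz2, A.integral_Iic_bump _ _ hz, jump, jump, if_neg h',
      if_neg h']
    ring

theorem cocycle_snd {p q : Fin N} (hpq : p ≠ q) (y : ℝ) : (F.cocycle B p q).2 y =
    ind (G.t q < G.t p) * (Real.exp ((F.q p q).eval y) * B.bump p q y) := by
  rw [A.t_apply, A.t_apply]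
  by_cases h : F.t p < F.t q
  · rw [ind_false (lt_asymm h), zero_mul]
    simp only [cocycle, h, dif_pos]
    rfl
  · rw [ind_true (lt_of_le_of_ne (not_lt.1 h) (F.slope_ne p q hpq).symm), one_mul]
    simp only [cocycle, h, dif_neg, not_false_eq_true]
    exact expMul_apply _ _ _ _

theorem cocycle_fst {p q : Fin N} (y : ℝ) : (F.cocycle B p q).1 y =
    ind (G.t p < G.t q) * Real.exp ((F.q p q).eval y) := by
  rw [A.t_apply, A.t_apply]
  by_cases h : F.t p < F.t q
  · rw [ind_true h, one_mul]
    simp only [cocycle, h, dif_pos]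
    rw [solveConcave_apply]
    simp
  · rw [ind_false h, zero_mul]
    simp only [cocycle, h, dif_neg, not_false_eq_true]
    rfl

end Adapted

end LineConfig

/-! ### The transferred functor away from the bumps. -/

namespace LineConfig

open MeasureTheory Arrangement

variable {N : ℕ} {F : LineConfig N} {G : Arrangement (Fin N)} {B : Bumps N} {ε : ℝ}
  {a : ℕ → Fin N} {i m : ℕ}

/-- The transferred functor on the letters `a i, …, a (m + 1)` is given, up to signs and away from
the bumps, by the indicator functions of the conditions `Right`. -/
def Evaluates (F : LineConfig N) (G : Arrangement (Fin N)) (B : Bumps N) (ε : ℝ) (a : ℕ → Fin N)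
    (i m : ℕ) : Prop :=
  ∃ σ τ, IsSign σ ∧ IsSign τ ∧ ∀ z, Safe G ε a i m z →
    ((F.transferData B).phiW a i m).1 z = Real.exp (F.expo a i m z) *
      (σ * ind (G.Right a i m z) + τ * ind (G.rot.Right a i m (-z)))

theorem phiW_snd (F : LineConfig N) (B : Bumps N) (a : ℕ → Fin N) {i m : ℕ} (h : i < m) :
    ((F.transferData B).phiW a i m).2 = 0 := by
  rw [TransferData.phiW_of_lt _ _ h]
  change -(0 : 𝓢(ℝ, ℝ)) = 0
  exact neg_zero

theorem phiW_fst (F : LineConfig N) (B : Bumps N) (a : ℕ → Fin N) {i m : ℕ} (h : i < m) :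
    ((F.transferData B).phiW a i m).1 =
      -F.solve B (a i) (a (m + 1)) ((F.transferData B).lamW a i m).2 := by
  rw [TransferData.phiW_of_lt _ _ h]
  rfl

theorem lamW_fst (F : LineConfig N) (B : Bumps N) (a : ℕ → Fin N) {i m : ℕ} (h : i ≤ m) (z : ℝ) :
    ((F.transferData B).lamW a i m).1 z = ∑ e ∈ Finset.Ico i m,
      (-1 : ℝ) ^ wdeg (F.transferData B).sdeg (a i) (word a i (e + 1 - i)) *
        (((F.transferData B).phiW a i e).1 z * ((F.transferData B).phiW a (e + 1) m).1 z) := by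
  rw [TransferData.lamW_eq _ _ h, Prod.fst_sum, sum_apply]
  refine Finset.sum_congr rfl fun e _ => ?_
  rw [Prod.smul_fst, smul_apply, smul_eq_mul]
  exact congrArg _ (mulS_apply _ _ _)

theorem lamW_snd (F : LineConfig N) (B : Bumps N) (a : ℕ → Fin N) {i m : ℕ} (h : i ≤ m) (z : ℝ) :
    ((F.transferData B).lamW a i m).2 z = ∑ e ∈ Finset.Ico i m,
      (-1 : ℝ) ^ wdeg (F.transferData B).sdeg (a i) (word a i (e + 1 - i)) *
        (((F.transferData B).phiW a i e).1 z * ((F.transferData B).phiW a (e + 1) m).2 z) +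
      ∑ e ∈ Finset.Ico i m,
      (-1 : ℝ) ^ wdeg (F.transferData B).sdeg (a i) (word a i (e + 1 - i)) *
        (((F.transferData B).phiW a i e).2 z * ((F.transferData B).phiW a (e + 1) m).1 z) := by
  rw [TransferData.lamW_eq _ _ h, Prod.snd_sum, sum_apply, ← Finset.sum_add_distrib]
  refine Finset.sum_congr rfl fun e _ => ?_
  rw [Prod.smul_snd, smul_apply, smul_eq_mul, ← mul_add]
  refine congrArg _ ?_
  change (mulS _ _ + mulS _ _) z = _
  rw [add_apply, mulS_apply, mulS_apply]

namespace Adapted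

variable (A : F.Adapted G B ε)

include A

/-- For an ascending pair the two indicators describe the two sides of the base point and add up to
one. For a descending pair both vanish, in accordance with the cocycle being a one-form. -/
theorem evaluates_self (hne : a i ≠ a (i + 1)) : F.Evaluates G B ε a i i := by
  refine ⟨1, 1, isSign_one, isSign_one, fun z hz => ?_⟩
  rw [TransferData.phiW_self, expo_self]
  change (F.cocycle B _ _).1 z = _
  rw [A.cocycle_fst, mul_comm, one_mul, one_mul]
  congr 1
  have hz := A.ne_of_safe (hz i (i + 1) le_rfl (by omega) le_rfl)
  have key : ∀ (G : Arrangement (Fin N)) (z : ℝ), G.Right a i i z ↔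
      G.t (a i) < G.t (a (i + 1)) ∧ G.y (a i) (a (i + 1)) < z := by
    intro G z
    constructor
    · rintro ⟨⟨j, hj⟩, h1, -⟩
      obtain rfl : j = i := le_antisymm hj.le_right hj.le_left
      exact ⟨hj.ascent, h1⟩
    · rintro ⟨h1, h2⟩
      exact ⟨openRight_self h1, h2, h2, fun h => absurd h (lt_asymm h1), fun _ => h2⟩
  rw [ind_congr (key G z), ind_congr (key G.rot (-z))]
  by_cases h : G.t (a i) < G.t (a (i + 1))
  · have h' : G.rot.t (a i) < G.rot.t (a (i + 1)) := h
    simp only [h, h', true_and]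
    have := ind_neg_lt_neg hz.symm
    simp only [rot]
    rw [this, ind_true trivial]
    ring
  · have h' : ¬G.rot.t (a i) < G.rot.t (a (i + 1)) := h
    simp [h, h', ind_false]

/-- Only words with one morphism have a one-form part, so only the cuts next to the last and to the
first line contribute. On the support of the corresponding bump the other factor is given by
`Evaluates`, with constant indicators. -/
theorem lamW_snd_apply (him : i ≤ m) (ha : Set.InjOn a (Set.Icc i (m + 1 + 1)))
    (h1 : F.Evaluates G B ε a i m) (h2 : F.Evaluates G B ε a (i + 1) (m + 1)) :
    ∃ σ τ σ' τ' κ κ', IsSign σ ∧ IsSign τ ∧ IsSign σ' ∧ IsSign τ' ∧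
      κ = ind (G.t (a (m + 1 + 1)) < G.t (a (m + 1))) *
        (σ * ind (G.Right a i m (G.vy a (m + 1))) +
          τ * ind (G.rot.Right a i m (G.rot.vy a (m + 1)))) ∧
      κ' = ind (G.t (a (i + 1)) < G.t (a i)) *
        (σ' * ind (G.Right a (i + 1) (m + 1) (G.vy a i)) +
          τ' * ind (G.rot.Right a (i + 1) (m + 1) (G.rot.vy a i))) ∧
      ∀ y, ((F.transferData B).lamW a i (m + 1)).2 y = Real.exp (F.expo a i (m + 1) y) *
        (κ * B.bump (a (m + 1)) (a (m + 1 + 1)) y + κ' * B.bump (a i) (a (i + 1)) y) := by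
  obtain ⟨σ, τ, hσ, hτ, h1⟩ := h1
  obtain ⟨σ', τ', hσ', hτ', h2⟩ := h2
  have hne : ∀ {p q : ℕ}, i ≤ p → i ≤ q → p ≤ m + 1 + 1 → q ≤ m + 1 + 1 → p ≠ q → a p ≠ a q :=
    ne_of_injOn ha
  set s : ℝ := (-1 : ℝ) ^ wdeg (F.transferData B).sdeg (a i) (word a i (m + 1 - i)) with hs
  set s' : ℝ := (-1 : ℝ) ^ wdeg (F.transferData B).sdeg (a i) (word a i (i + 1 - i)) with hs'
  refine ⟨s * σ, s * τ, s' * σ', s' * τ', _, _, (isSign_zpow _).mul hσ, (isSign_zpow _).mul hτ,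
    (isSign_zpow _).mul hσ', (isSign_zpow _).mul hτ', rfl, rfl, fun y => ?_⟩
  rw [lamW_snd F B a (by omega)]
  rw [Finset.sum_eq_single_of_mem m (by simpa using him),
    Finset.sum_eq_single_of_mem i (by simpa using him), mul_add (Real.exp _)]
  · congr 1
    · rw [TransferData.phiW_self]
      change _ * (_ * (F.cocycle B _ _).2 y) = _
      rw [A.cocycle_snd (hne (by omega) (by omega) (by omega) (by omega) (by omega)),
        ← F.expo_add a him (Nat.lt_succ_self m), Real.exp_add, expo_self]
      by_cases hb : B.bump (a (m + 1)) (a (m + 1 + 1)) y = 0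
      · rw [hb]
        ring
      · have hy := A.support _ _ _ hb
        have hy' : ∀ p' q', i ≤ p' → p' < q' → q' ≤ m + 1 →
            G.y (a (m + 1)) (a (m + 1 + 1)) ≠ G.y (a p') (a q') := fun p' q' h1 h2 h3 =>
          y_ne_of_injOn ha (by omega) (by omega) (by omega) (by omega) (by omega) (by omega)
            (by omega)
        have hR := A.right_congr_of_lt him hy hy'
        rw [h1 y fun p' q' h1 h2 h3 => A.safe_of_lt (hy' p' q' h1 h2 h3) hy, ind_congr hR.1,
          ind_congr hR.2]
        simp only [vy]
        ring
    · rw [TransferData.phiW_self]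
      change _ * ((F.cocycle B _ _).2 y * _) = _
      rw [A.cocycle_snd (hne (by omega) (by omega) (by omega) (by omega) (by omega)),
        ← F.expo_add a le_rfl (show i < m + 1 by omega), Real.exp_add, expo_self]
      by_cases hb : B.bump (a i) (a (i + 1)) y = 0
      · rw [hb]
        ring
      · have hy := A.support _ _ _ hb
        have hy' : ∀ p' q', i + 1 ≤ p' → p' < q' → q' ≤ m + 1 + 1 →
            G.y (a i) (a (i + 1)) ≠ G.y (a p') (a q') := fun p' q' h1 h2 h3 =>
          y_ne_of_injOn ha (by omega) (by omega) (by omega) (by omega) (by omega) (by omega)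
            (by omega)
        have hR := A.right_congr_of_lt (show i + 1 ≤ m + 1 by omega) hy hy'
        rw [h2 y fun p' q' h1 h2 h3 => A.safe_of_lt (hy' p' q' h1 h2 h3) hy, ind_congr hR.1,
          ind_congr hR.2]
        simp only [vy]
        ring
  · intro e he hei
    rw [phiW_snd F B a (by simp at he; omega)]
    simp
  · intro e he hem
    rw [phiW_snd F B a (by simp at he; omega)]
    simp

end Adapted

end LineConfig

/-! ### The transferred products on sequences of distinct lines. -/

namespace LineConfig

open MeasureTheory Arrangement

variable {N : ℕ} {F : LineConfig N} {G : Arrangement (Fin N)} {B : Bumps N} {ε : ℝ}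
  {a : ℕ → Fin N} {i m : ℕ}

theorem exp_neg_mul_exp_expo (F : LineConfig N) (a : ℕ → Fin N) {i m : ℕ} (h : i ≤ m) {φ : ℝ → ℝ}
    {κ κ' β β' : ℝ} {y : ℝ}
    (hφ : φ y = Real.exp (F.expo a i m y) * (κ * β + κ' * β')) :
    Real.exp (-(F.q (a i) (a (m + 1))).eval y) * φ y =
      Real.exp (F.expo a i m (F.v (a i) (a (m + 1))).1) * κ * β +
        Real.exp (F.expo a i m (F.v (a i) (a (m + 1))).1) * κ' * β' := by
  rw [hφ, F.expo_eq a h, Real.exp_add, ← mul_assoc, ← mul_assoc, ← Real.exp_add, neg_add_cancel,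
    Real.exp_zero]
  ring

namespace Adapted

variable (A : F.Adapted G B ε)

include A

theorem evaluates_succ (him : i ≤ m) (ha : Set.InjOn a (Set.Icc i (m + 1 + 1)))
    (h1 : F.Evaluates G B ε a i m) (h2 : F.Evaluates G B ε a (i + 1) (m + 1)) :
    F.Evaluates G B ε a i (m + 1) := by
  obtain ⟨σ, τ, σ', τ', κ, κ', hσ, hτ, hσ', hτ', hκ, hκ', hl⟩ := A.lamW_snd_apply him ha h1 h2
  obtain ⟨ρ, ρ', hρ, hρ', hj⟩ := exists_sign_jump him ha hσ hτ hσ' hτ' hκ hκ'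
  refine ⟨ρ, ρ', hρ, hρ', fun z hz => ?_⟩
  have s0 := hz i (m + 1 + 1) le_rfl (by omega) le_rfl
  have s1 := hz (m + 1) (m + 1 + 1) (by omega) (by omega) le_rfl
  have s2 := hz i (i + 1) le_rfl (by omega) (by omega)
  rw [phiW_fst F B a (by omega), neg_apply,
    A.solve_apply (fun y => F.exp_neg_mul_exp_expo a (by omega) (hl y))
      (y_ne_of_injOn ha le_rfl (by omega) le_rfl (by omega) (by omega) le_rfl (by omega))
      (y_ne_of_injOn ha le_rfl (by omega) le_rfl le_rfl (by omega) (by omega) (by omega)) s0 s1 s2,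
    ← hj z (A.ne_of_safe s2) (A.ne_of_safe s1) (A.ne_of_safe s0),
    F.expo_eq a (show i ≤ m + 1 by omega) z, Real.exp_add]
  simp only [vy]
  ring

theorem evaluates (him : i ≤ m) (ha : Set.InjOn a (Set.Icc i (m + 1))) :
    F.Evaluates G B ε a i m := by
  obtain ⟨d, rfl⟩ := Nat.exists_eq_add_of_le him
  clear him
  induction d generalizing i with
  | zero => exact A.evaluates_self (ne_of_injOn ha le_rfl (by omega) (by omega) le_rfl (by omega))
  | succ d ih =>
    refine A.evaluates_succ (m := i + d) (by omega) ha
      (ih (ha.mono (Set.Icc_subset_Icc le_rfl (by omega)))) ?_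
    have := ih (i := i + 1) (ha.mono (Set.Icc_subset_Icc (by omega) (by omega)))
    rwa [show i + 1 + d = i + d + 1 by omega] at this

/-- The transferred products with output of degree one. -/
theorem muW_of_gt (ha : Set.InjOn a (Set.Icc 0 (m + 1 + 1)))
    (hp : Function.Periodic a (m + 1 + 2)) (ht : G.t (a (m + 1 + 1)) < G.t (a 0)) :
    ∃ T, (F.transferData B).muW a 0 (m + 1) =
        T * Real.exp (F.expo a 0 (m + 1) (F.v (a 0) (a (m + 1 + 1))).1) ∧
      (G.IsPolygon a → IsSign T) ∧ (¬G.IsPolygon a → T = 0) := by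
  obtain ⟨σ, τ, σ', τ', κ, κ', hσ, hτ, hσ', hτ', hκ, hκ', hl⟩ := A.lamW_snd_apply (Nat.zero_le m) ha
    (A.evaluates (Nat.zero_le m) (ha.mono (Set.Icc_subset_Icc le_rfl (by omega))))
    (A.evaluates (show 0 + 1 ≤ m + 1 by omega) (ha.mono (Set.Icc_subset_Icc (by omega) le_rfl)))
  -- The bumps have integral one, and at most one of the two coefficients is nonzero.
  refine ⟨κ + κ', ?_, ?_⟩
  · have h : ¬F.t (a 0) < F.t (a (m + 1 + 1)) := by
      rw [← A.t_apply, ← A.t_apply]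
      exact lt_asymm ht
    rw [TransferData.muW_eq _ _ (by omega)]
    change F.proj B _ _ _ = _
    simp only [proj, h, dif_neg, not_false_eq_true]
    change ∫ y, Real.exp (-(F.q (a 0) (a (m + 1 + 1))).eval y) *
      ((F.transferData B).lamW a 0 (m + 1)).2 y = _
    simp only [fun y => F.exp_neg_mul_exp_expo a (Nat.zero_le (m + 1)) (hl y)]
    rw [integral_add ((B.bump _ _).integrable.const_mul _) ((B.bump _ _).integrable.const_mul _),
      integral_const_mul, integral_const_mul, B.integral_eq_one, B.integral_eq_one]
    ring
  · rw [isPolygon_iff_of_gt (by omega) hp ha ht]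
    rcases coefficient_cases (Nat.zero_le m) ha hσ hτ hσ' hτ' hκ hκ' with
      ⟨h1, h2, h3, h4⟩ | ⟨h1, h2, ⟨h3, h4, h5⟩ | ⟨h3, h4, h5⟩⟩ |
        ⟨h1, h2, ⟨h3, h4, h5⟩ | ⟨h3, h4, h5⟩⟩
    · exact ⟨fun h => absurd h (by tauto), fun _ => by rw [h3, h4, add_zero]⟩
    · exact ⟨fun _ => by rwa [h5, add_zero], fun h => absurd (.inl h1) h⟩
    · exact ⟨fun _ => by rwa [h4, zero_add], fun h => absurd (.inl h1) h⟩
    · exact ⟨fun _ => by rwa [h5, add_zero], fun h => absurd (.inr h1) h⟩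
    · exact ⟨fun _ => by rwa [h4, zero_add], fun h => absurd (.inr h1) h⟩

/-- The transferred products with output of degree zero. -/
theorem muW_of_lt (hm : 1 ≤ m) (ha : Set.InjOn a (Set.Icc 0 (m + 1)))
    (hp : Function.Periodic a (m + 2)) (ht : G.t (a 0) < G.t (a (m + 1))) :
    ∃ T, (F.transferData B).muW a 0 m =
        T * Real.exp (F.expo a 0 m (F.v (a 0) (a (m + 1))).1) ∧
      (G.IsPolygon a → IsSign T) ∧ (¬G.IsPolygon a → T = 0) := by
  -- Outside the range of summation the signs get the dummy value `1`, so that they can be chosen as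
  -- functions of `e`.
  have hev : ∀ e, ∃ σ τ, IsSign σ ∧ IsSign τ ∧ (e < m → ∀ z, Safe G ε a 0 e z →
      ((F.transferData B).phiW a 0 e).1 z = Real.exp (F.expo a 0 e z) *
        (σ * ind (G.Right a 0 e z) + τ * ind (G.rot.Right a 0 e (-z)))) := by
    intro e
    by_cases he : e < m
    · obtain ⟨σ, τ, hσ, hτ, h⟩ := A.evaluates (Nat.zero_le e)
        (ha.mono (Set.Icc_subset_Icc le_rfl (by omega)))
      exact ⟨σ, τ, hσ, hτ, fun _ => h⟩
    · exact ⟨1, 1, isSign_one, isSign_one, fun h => absurd h he⟩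
  have hev' : ∀ e, ∃ σ τ, IsSign σ ∧ IsSign τ ∧ (e < m → ∀ z, Safe G ε a (e + 1) m z →
      ((F.transferData B).phiW a (e + 1) m).1 z = Real.exp (F.expo a (e + 1) m z) *
        (σ * ind (G.Right a (e + 1) m z) + τ * ind (G.rot.Right a (e + 1) m (-z)))) := by
    intro e
    by_cases he : e < m
    · obtain ⟨σ, τ, hσ, hτ, h⟩ := A.evaluates (show e + 1 ≤ m by omega)
        (ha.mono (Set.Icc_subset_Icc (by omega) le_rfl))
      exact ⟨σ, τ, hσ, hτ, fun _ => h⟩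
    · exact ⟨1, 1, isSign_one, isSign_one, fun h => absurd h he⟩
  choose σ τ hσ hτ h1 using hev
  choose σ' τ' hσ' hτ' h2 using hev'
  obtain ⟨m, rfl⟩ : ∃ m', m = m' + 1 := ⟨m - 1, by omega⟩
  have key := sum_right_left hm hp ha ht (fun e => isSign_zpow (wdeg (F.transferData B).sdeg (a 0)
    (word a 0 (e + 1 - 0)))) hσ hτ hσ' hτ' rfl
  refine ⟨_, ?_, key⟩
  have h : F.t (a 0) < F.t (a (m + 1 + 1)) := by
    rwa [← A.t_apply, ← A.t_apply]
  have hz : G.y (a 0) (a (m + 1 + 1)) = G.vy a (m + 1 + 1) := by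
    rw [vy_last hp, G.y_symm]
  rw [TransferData.muW_eq _ _ (by omega)]
  change F.proj B _ _ _ = _
  simp only [proj, h, dif_pos]
  change Real.exp (-(F.q (a 0) (a (m + 1 + 1))).eval (B.point (a 0) (a (m + 1 + 1)))) *
    ((F.transferData B).lamW a 0 (m + 1)).1 (B.point (a 0) (a (m + 1 + 1))) = _
  rw [A.point_eq, lamW_fst F B a (by omega), Finset.mul_sum, Finset.sum_mul]
  refine Finset.sum_congr rfl fun e he => ?_
  have he : e < m + 1 := by simpa using he
  have hsafe1 : Safe G ε a 0 e (G.y (a 0) (a (m + 1 + 1))) := fun p q h1 h2 h3 =>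
    A.safe_of_ne (y_ne_of_injOn ha le_rfl (by omega) le_rfl h1 h2 (by omega) (by omega))
  have hsafe2 : Safe G ε a (e + 1) (m + 1) (G.y (a 0) (a (m + 1 + 1))) := fun p q h1 h2 h3 =>
    A.safe_of_ne (y_ne_of_injOn ha le_rfl (by omega) le_rfl (by omega) h2 (by omega) (by omega))
  rw [h1 e he _ hsafe1, h2 e he _ hsafe2, hz, ← vy_rot]
  have hexp : Real.exp (F.expo a 0 (m + 1) (F.v (a 0) (a (m + 1 + 1))).1) =
      Real.exp (-(F.q (a 0) (a (m + 1 + 1))).eval (G.vy a (m + 1 + 1))) *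
        (Real.exp (F.expo a 0 e (G.vy a (m + 1 + 1))) *
          Real.exp (F.expo a (e + 1) (m + 1) (G.vy a (m + 1 + 1)))) := by
    rw [← Real.exp_add, ← Real.exp_add, F.expo_add a (Nat.zero_le e) he,
      F.expo_eq a (Nat.zero_le (m + 1)) (G.vy a (m + 1 + 1)), neg_add_cancel_left]
  rw [hexp]
  ring

end Adapted

end LineConfig

/-! ### The area of a polygon by vertical slices. -/

namespace Arrangement

open MeasureTheory

variable {ι : Type*} (G : Arrangement ι)

/-- The vertices of a polygon. -/
noncomputable def vertex (a : ℕ → ι) (e : ℕ) : ℝ × ℝ := (G.vx a e, G.ln (a e) (G.vx a e))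

/-- The region above the lines `a 0, …, a j` and below the lines `a (j + 1), …, a (m + 1)`. -/
def region (a : ℕ → ι) (m j : ℕ) : Set (ℝ × ℝ) :=
  {p | (∀ l ≤ j, G.ln (a l) p.1 ≤ p.2) ∧ ∀ l, j < l → l ≤ m + 1 → p.2 ≤ G.ln (a l) p.1}

variable {G} {a : ℕ → ι} {m j : ℕ}

theorem convex_region : Convex ℝ (G.region a m j) := by
  rintro p ⟨hp1, hp2⟩ q ⟨hq1, hq2⟩ u v hu hv huv
  have key : ∀ l, G.ln (a l) (u • p + v • q).1 = u * G.ln (a l) p.1 + v * G.ln (a l) q.1 := by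
    intro l
    simp only [ln, Prod.fst_add, Prod.smul_fst, smul_eq_mul]
    linear_combination (-G.s (a l)) * huv
  refine ⟨fun l hl => ?_, fun l hl hl' => ?_⟩
  · rw [key]
    exact add_le_add (mul_le_mul_of_nonneg_left (hp1 l hl) hu)
      (mul_le_mul_of_nonneg_left (hq1 l hl) hv)
  · rw [key]
    exact add_le_add (mul_le_mul_of_nonneg_left (hp2 l hl hl') hu)
      (mul_le_mul_of_nonneg_left (hq2 l hl hl') hv)

/-- A point on a line between two points on this line. -/
theorem mem_segment_of_ln {p : ι} {x y z w w' : ℝ} (hw : w = G.ln p x) (hw' : w' = G.ln p y)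
    (h1 : x ≤ z) (h2 : z ≤ y) : (z, G.ln p z) ∈ segment ℝ (x, w) (y, w') := by
  subst hw hw'
  have hz : z ∈ segment ℝ x y := by
    rw [segment_eq_Icc (h1.trans h2)]
    exact ⟨h1, h2⟩
  obtain ⟨u, v, hu, hv, huv, rfl⟩ := hz
  refine ⟨u, v, hu, hv, huv, Prod.ext rfl ?_⟩
  simp only [ln, Prod.snd_add, Prod.smul_snd, smul_eq_mul]
  linear_combination G.s p * huv

theorem mem_segment_vertical {z l w u : ℝ} (h1 : l ≤ w) (h2 : w ≤ u) :
    (z, w) ∈ segment ℝ (z, l) (z, u) := by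
  have hw : w ∈ segment ℝ l u := by
    rw [segment_eq_Icc (h1.trans h2)]
    exact ⟨h1, h2⟩
  obtain ⟨b, c, hb, hc, hbc, rfl⟩ := hw
  refine ⟨b, c, hb, hc, hbc, Prod.ext ?_ rfl⟩
  simp only [Prod.fst_add, Prod.smul_fst, smul_eq_mul, ← add_mul, hbc, one_mul]

namespace OpenRightAt

variable (h : G.OpenRightAt a 0 m j) (ha : Set.InjOn a (Set.Icc 0 (m + 1)))

include h ha

theorem vx_antitone {e e' : ℕ} (h1 : e ≤ e') (h2 : e' ≤ j) : G.vx a e' ≤ G.vx a e := by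
  induction e', h1 using Nat.le_induction with
  | base => exact le_rfl
  | succ e' he ih => exact (h.vx_lower ha (Nat.zero_le _) (by omega)).le.trans (ih (by omega))

theorem vx_monotone {e e' : ℕ} (h0 : j ≤ e) (h1 : e ≤ e') (h2 : e' ≤ m) :
    G.vx a e ≤ G.vx a e' := by
  induction e', h1 using Nat.le_induction with
  | base => exact le_rfl
  | succ e' he ih => exact (ih (by omega)).trans (h.vx_upper ha (by omega) (by omega)).le

theorem leftmost_le {e : ℕ} (he : e ≤ m) : G.vx a j ≤ G.vx a e := by
  rcases le_total e j with h1 | h1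
  · exact h.vx_antitone ha h1 le_rfl
  · exact h.vx_monotone ha le_rfl h1 he

/-- The lines bounding a vertical slice of the region. -/
theorem exists_slice {z : ℝ} (hz : G.vx a j < z) : ∃ u v, u ≤ j ∧ j < v ∧ v ≤ m + 1 ∧
    (∀ e ≤ j, (G.vx a e < z ↔ u ≤ e)) ∧ (∀ e, j ≤ e → e ≤ m → (G.vx a e < z ↔ e < v)) ∧
    (∀ l ≤ j, G.ln (a l) z ≤ G.ln (a u) z) ∧
    (∀ l, j < l → l ≤ m + 1 → G.ln (a v) z ≤ G.ln (a l) z) := by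
  classical
  have hjm := h.le_right
  have hu : ∃ e, G.vx a e < z := ⟨j, hz⟩
  have hv : ∃ e, j < e ∧ (e ≤ m → z ≤ G.vx a e) := ⟨m + 1, by omega, fun h => by omega⟩
  have hu1 : Nat.find hu ≤ j := Nat.find_min' hu hz
  have hv1 : Nat.find hv ≤ m + 1 := Nat.find_min' hv ⟨by omega, fun h => by omega⟩
  have hu2 : ∀ e ≤ j, (G.vx a e < z ↔ Nat.find hu ≤ e) := fun e he =>
    ⟨fun h1 => Nat.find_min' hu h1, fun h1 => (h.vx_antitone ha h1 he).trans_lt (Nat.find_spec hu)⟩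
  have hv2 : ∀ e, j ≤ e → e ≤ m → (G.vx a e < z ↔ e < Nat.find hv) := by
    intro e he he'
    constructor
    · intro h1
      by_contra h2
      push Not at h2
      have h3 := (Nat.find_spec hv).2 (by omega)
      exact absurd h1 (not_lt.2 (h3.trans (h.vx_monotone ha (Nat.find_spec hv).1.le h2 he')))
    · intro h1
      rcases eq_or_ne e j with rfl | hne
      · exact hz
      · have := Nat.find_min hv h1
        push Not at this
        exact (this (by omega)).2
  refine ⟨Nat.find hu, Nat.find hv, hu1, (Nat.find_spec hv).1, hv1, hu2, hv2, ?_, ?_⟩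
  · intro l hl
    rcases le_total l (Nat.find hu) with h1 | h1
    · induction h1 using Nat.decreasingInduction with
      | self => exact le_rfl
      | of_succ e he ih =>
        refine le_trans ?_ (ih (by omega))
        rw [← le_x_iff (h.descent e (Nat.zero_le _) (by omega) (by omega)), x_symm]
        exact not_lt.1 fun h2 => absurd ((hu2 e hl).1 h2) (by omega)
    · induction l, h1 using Nat.le_induction with
      | base => exact le_rfl
      | succ e he ih =>
        refine le_trans ?_ (ih (by omega))
        rw [← x_le_iff (h.descent e (Nat.zero_le _) (by omega) (by omega)), x_symm]
        exact ((hu2 e (by omega)).2 he).le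
  · intro l hl hl'
    rcases le_total l (Nat.find hv) with h1 | h1
    · induction h1 using Nat.decreasingInduction with
      | self => exact le_rfl
      | of_succ e he ih =>
        refine le_trans (ih (by omega) (by omega)) ?_
        rw [← x_le_iff (h.descent e (Nat.zero_le _) (by omega) (by omega)), x_symm]
        exact ((hv2 e (by omega) (by omega)).2 he).le
    · have hjv := (Nat.find_spec hv).1
      induction l, h1 using Nat.le_induction with
      | base => exact le_rfl
      | succ e he ih =>
        refine le_trans (ih (by omega) (by omega)) ?_
        rw [← le_x_iff (h.descent e (Nat.zero_le _) (by omega) (by omega)), x_symm]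
        exact not_lt.1 fun h2 => absurd ((hv2 e (by omega) (by omega)).1 h2) (by omega)

end OpenRightAt

end Arrangement

namespace Arrangement

open MeasureTheory

variable {ι : Type*} {G : Arrangement ι} {a : ℕ → ι} {m j : ℕ}

namespace OpenRightAt

variable (hm : 1 ≤ m) (hp : Function.Periodic a (m + 2)) (h : G.OpenRightAt a 0 m j)
  (ha : Set.InjOn a (Set.Icc 0 (m + 1))) (ht : G.t (a (m + 1)) < G.t (a 0))

include hm hp h ha ht

theorem vx_le_closing {e : ℕ} (he : e ≤ m) : G.vx a e ≤ G.vx a (m + 1) := by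
  have hy := OpenRight.lt_of_gt (by omega) ha ⟨j, h⟩ ht
  rw [G.y_symm, ← vy_last hp] at hy
  exact h.vx_le ha (Nat.zero_le _) he
    (vx_le_of_vy_lt (ne_succ hp ha _) (ne_succ hp ha _) hy.1)
    (vx_le_of_vy_lt (ne_succ hp ha _) (ne_succ hp ha _) hy.2)

theorem vertex_mem_region {e : ℕ} (he : e ≤ m + 1) : G.vertex a e ∈ G.region a m j := by
  have hjm := h.le_right
  rcases eq_or_ne e (m + 1) with rfl | he'
  · have h0 := h.vx_le_closing hm hp ha ht (Nat.zero_le m)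
    have hm' := h.vx_le_closing hm hp ha ht (le_refl m)
    refine ⟨fun l hl => ?_, fun l hl hl' => h.last_le_ln ha hm' hl hl'⟩
    change _ ≤ G.ln (a (m + 1)) (G.vx a (m + 1))
    rw [vx_last hp, ln_x (ne_of_t_lt ht), ← vx_last hp]
    exact h.ln_le_first ha h0 (Nat.zero_le _) hl
  · exact ⟨fun l hl => h.lower e l (Nat.zero_le _) (by omega) (Nat.zero_le _) hl,
      fun l hl hl' => h.upper e l (Nat.zero_le _) (by omega) hl hl'⟩

/-- The lower end of the slice lies on the side between the vertices `u` and `u - 1`; for `u = 0`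
this side ends in the closing vertex. -/
theorem lower_mem_convexHull {z : ℝ} {u : ℕ} (hz' : z ≤ G.vx a (m + 1))
    (hu : u ≤ j) (hu' : ∀ e ≤ j, (G.vx a e < z ↔ u ≤ e)) :
    (z, G.ln (a u) z) ∈ convexHull ℝ (G.vertex a '' Set.Iic (m + 1)) := by
  have hjm := h.le_right
  have hv : ∀ e ≤ m + 1, G.vertex a e ∈ convexHull ℝ (G.vertex a '' Set.Iic (m + 1)) :=
    fun e he => subset_convexHull ℝ _ ⟨e, he, rfl⟩
  have h1 := ((hu' u hu).2 le_rfl).le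
  rcases u with _ | u
  · refine (convex_convexHull ℝ _).segment_subset (hv 0 (by omega)) (hv (m + 1) le_rfl)
      (mem_segment_of_ln rfl ?_ h1 hz')
    rw [vx_last hp, ln_x (ne_of_t_lt ht)]
  · refine (convex_convexHull ℝ _).segment_subset (hv (u + 1) (by omega)) (hv u (by omega))
      (mem_segment_of_ln rfl (ln_vx (ne_succ hp ha u)).symm h1 ?_)
    exact not_lt.1 fun h2 => absurd ((hu' u (by omega)).1 h2) (by omega)

theorem upper_mem_convexHull {z : ℝ} {v : ℕ} (hz' : z ≤ G.vx a (m + 1)) (hv : j < v)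
    (hvm : v ≤ m + 1) (hv' : ∀ e, j ≤ e → e ≤ m → (G.vx a e < z ↔ e < v)) :
    (z, G.ln (a v) z) ∈ convexHull ℝ (G.vertex a '' Set.Iic (m + 1)) := by
  have hvt : ∀ e ≤ m + 1, G.vertex a e ∈ convexHull ℝ (G.vertex a '' Set.Iic (m + 1)) :=
    fun e he => subset_convexHull ℝ _ ⟨e, he, rfl⟩
  obtain ⟨v, rfl⟩ : ∃ v', v = v' + 1 := ⟨v - 1, by omega⟩
  refine (convex_convexHull ℝ _).segment_subset (hvt v (by omega)) (hvt (v + 1) hvm)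
      (mem_segment_of_ln (ln_vx (ne_succ hp ha v)).symm rfl ?_ ?_)
  · exact ((hv' v (by omega) (by omega)).2 (by omega)).le
  · rcases eq_or_ne v m with rfl | hne
    · exact hz'
    · exact not_lt.1 fun h2 => absurd ((hv' (v + 1) (by omega) (by omega)).1 h2) (by omega)

omit hm ha in
theorem fst_mem_of_mem_region {p : ℝ × ℝ} (hp' : p ∈ G.region a m j) :
    G.vx a j ≤ p.1 ∧ p.1 ≤ G.vx a (m + 1) := by
  have hjm := h.le_right
  constructor
  · exact (x_le_iff h.ascent).2 ((hp'.1 j le_rfl).trans (hp'.2 (j + 1) (by omega) (by omega)))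
  · rw [vx_last hp, le_x_iff ht]
    exact (hp'.1 0 (Nat.zero_le _)).trans (hp'.2 (m + 1) (by omega) (by omega))

theorem convexHull_eq : convexHull ℝ (G.vertex a '' Set.Iic (m + 1)) = G.region a m j := by
  have hjm := h.le_right
  refine Set.Subset.antisymm (convexHull_min ?_ convex_region) ?_
  · rintro _ ⟨e, he, rfl⟩
    exact h.vertex_mem_region hm hp ha ht he
  · rintro ⟨z, w⟩ hzw
    obtain ⟨hz, hz'⟩ := h.fst_mem_of_mem_region hp ht hzw
    rcases hz.lt_or_eq with hz | hz
    · obtain ⟨u, v, hu, hv, hvm, hu', hv', -⟩ := h.exists_slice ha hz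
      exact (convex_convexHull ℝ _).segment_subset
        (h.lower_mem_convexHull hm hp ha ht hz' hu hu')
        (h.upper_mem_convexHull hm hp ha ht hz' hv hvm hv')
        (mem_segment_vertical (hzw.1 u hu) (hzw.2 v hv hvm))
    · refine subset_convexHull ℝ _ ⟨j, by simp only [Set.mem_Iic]; omega, ?_⟩
      change G.vx a j = z at hz
      subst hz
      refine Prod.ext rfl (le_antisymm (hzw.1 j le_rfl) ?_)
      refine (hzw.2 (j + 1) (by omega) (by omega)).trans (le_of_eq ?_)
      exact ln_vx (ne_succ hp ha j)

open Classical in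
/-- The area of a polygon, as the integral of the lengths of its vertical slices. -/
theorem volume_convexHull : volume.real (convexHull ℝ (G.vertex a '' Set.Iic (m + 1))) =
    ∑ e ∈ Finset.Ico 0 (m + 1), ∫ z in (G.vx a e)..(G.vx a (m + 1)),
      (G.ln (a (e + 1)) z - G.ln (a e) z) := by
  have hjm := h.le_right
  set X := G.vx a (m + 1) with hX
  have hle : ∀ e ∈ Finset.Ico 0 (m + 1), G.vx a e ≤ X := fun e he =>
    h.vx_le_closing hm hp ha ht (by simp at he; omega)
  have hg : ∀ e, Continuous fun z => G.ln (a (e + 1)) z - G.ln (a e) z := by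
    intro e
    unfold ln
    fun_prop
  let H : ℝ → ℝ := fun z => ∑ e ∈ Finset.Ico 0 (m + 1),
    (Set.Ioc (G.vx a e) X).indicator (fun z => G.ln (a (e + 1)) z - G.ln (a e) z) z
  have hint : ∀ e, Integrable
      ((Set.Ioc (G.vx a e) X).indicator fun z => G.ln (a (e + 1)) z - G.ln (a e) z) := fun e =>
    (integrable_indicator_iff measurableSet_Ioc).2
      (((hg e).integrableOn_Icc).mono_set Set.Ioc_subset_Icc_self)
  -- The indicators select the vertices with `u ≤ e < v`, and the sum over them telescopes to the
  -- length of the slice.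
  have hH : ∀ z u v, G.vx a j < z → z ≤ X → u ≤ j → j < v → v ≤ m + 1 →
      (∀ e ≤ j, (G.vx a e < z ↔ u ≤ e)) → (∀ e, j ≤ e → e ≤ m → (G.vx a e < z ↔ e < v)) →
      H z = G.ln (a v) z - G.ln (a u) z := by
    intro z u v hz hz' hu hv hvm hu' hv'
    rw [← Finset.sum_Ico_sub (fun e => G.ln (a e) z) (show u ≤ v by omega)]
    simp only [H]
    rw [← Finset.sum_subset (Finset.Ico_subset_Ico (Nat.zero_le u) hvm)]
    · refine Finset.sum_congr rfl fun e he => ?_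
      rw [Finset.mem_Ico] at he
      rw [Set.indicator_of_mem]
      refine ⟨?_, hz'⟩
      rcases le_total e j with h1 | h1
      · exact (hu' e h1).2 he.1
      · exact (hv' e h1 (by omega)).2 he.2
    · intro e he he'
      rw [Finset.mem_Ico] at he he'
      refine Set.indicator_of_notMem (fun h2 => he' ?_) _
      rcases le_total e j with h1 | h1
      · exact ⟨(hu' e h1).1 h2.1, by omega⟩
      · exact ⟨by omega, (hv' e h1 (by omega)).1 h2.1⟩
  have hH0 : ∀ z, ¬(G.vx a j < z ∧ z ≤ X) → H z = 0 := by
    intro z hz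
    refine Finset.sum_eq_zero fun e he => Set.indicator_of_notMem (fun h1 => hz ⟨?_, h1.2⟩) _
    exact (h.leftmost_le ha (by simp at he; omega)).trans_lt h1.1
  have hslice : ∀ z, volume (Prod.mk z ⁻¹' convexHull ℝ (G.vertex a '' Set.Iic (m + 1))) =
      ENNReal.ofReal (H z) := by
    intro z
    by_cases hz : G.vx a j < z ∧ z ≤ X
    · obtain ⟨u, v, hu, hv, hvm, hu', hv', hu'', hv''⟩ := h.exists_slice ha hz.1
      rw [hH z u v hz.1 hz.2 hu hv hvm hu' hv', ← Real.volume_Icc]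
      congr 1
      rw [h.convexHull_eq hm hp ha ht]
      ext w
      exact ⟨fun hw => ⟨hw.1 u hu, hw.2 v hv hvm⟩, fun hw =>
        ⟨fun l hl => (hu'' l hl).trans hw.1, fun l hl hl' => hw.2.trans (hv'' l hl hl')⟩⟩
    · rw [hH0 z hz, ENNReal.ofReal_zero, h.convexHull_eq hm hp ha ht]
      have hsub : Prod.mk z ⁻¹' G.region a m j ⊆ {G.ln (a j) z} := by
        intro w hw
        have h1 := h.fst_mem_of_mem_region hp ht hw
        have h2 : G.vx a j = z := by
          by_contra hne
          exact hz ⟨lt_of_le_of_ne h1.1 hne, h1.2⟩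
        refine le_antisymm ((hw.2 (j + 1) (by omega) (by omega)).trans (le_of_eq ?_))
          (hw.1 j le_rfl)
        subst h2
        exact ln_vx (ne_succ hp ha j)
      exact measure_mono_null hsub (by simp)
  have hnn : ∀ z, 0 ≤ H z := by
    intro z
    by_cases hz : G.vx a j < z ∧ z ≤ X
    · obtain ⟨u, v, hu, hv, hvm, hu', hv', -⟩ := h.exists_slice ha hz.1
      rw [hH z u v hz.1 hz.2 hu hv hvm hu' hv']
      have h1 := h.lower_mem_convexHull hm hp ha ht hz.2 hu hu'
      rw [h.convexHull_eq hm hp ha ht] at h1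
      exact sub_nonneg.2 (h1.2 v hv hvm)
    · exact (hH0 z hz).ge
  have hmeas : MeasurableSet (convexHull ℝ (G.vertex a '' Set.Iic (m + 1))) :=
    (((Set.finite_Iic (m + 1)).image _).isCompact_convexHull ℝ).isClosed.measurableSet
  have hHint : Integrable H := integrable_finsetSum _ fun e _ => hint e
  rw [measureReal_def, Measure.volume_eq_prod, Measure.prod_apply hmeas]
  simp only [hslice]
  rw [← ofReal_integral_eq_lintegral_ofReal hHint (Filter.Eventually.of_forall hnn),
    ENNReal.toReal_ofReal (integral_nonneg hnn), integral_finsetSum _ fun e _ => hint e]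
  refine Finset.sum_congr rfl fun e he => ?_
  rw [integral_indicator measurableSet_Ioc, intervalIntegral.integral_of_le (hle e he)]

end OpenRightAt

end Arrangement

/-! ### Area and critical values. -/

namespace LineConfig

open MeasureTheory Arrangement

variable {N : ℕ} (F : LineConfig N)

/-- The critical value of `f_p - f_q`. -/
noncomputable def critical (p q : Fin N) : ℝ := (F.f p - F.f q).eval (F.v p q).1

theorem v_symm_fst (p q : Fin N) : (F.v p q).1 = (F.v q p).1 := by
  change (F.s q - F.s p) / (F.t p - F.t q) = (F.s p - F.s q) / (F.t q - F.t p)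
  rw [← neg_div_neg_eq, neg_sub, neg_sub]

/-- At the closing vertex the values telescope to `f_{a 0} - f_{a (m + 1)}`, which is minus the
critical value of the closing pair. -/
theorem expo_critical (a : ℕ → Fin N) {m : ℕ} (hp : Function.Periodic a (m + 2)) :
    F.expo a 0 m (F.v (a 0) (a (m + 1))).1 =
      -∑ e ∈ Finset.range (m + 2), F.critical (a e) (a (e + 1)) := by
  have h0 : a (m + 1 + 1) = a 0 := by simpa using hp 0
  rw [Finset.sum_range_succ, h0, Finset.range_eq_Ico, expo]
  simp only [eval_q]
  rw [Finset.sum_sub_distrib]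
  have := Finset.sum_Ico_sub (fun e => -(F.f (a e)).eval (F.v (a 0) (a (m + 1))).1)
    (show 0 ≤ m + 1 by omega)
  have h2 : F.critical (a (m + 1)) (a 0) = (F.f (a (m + 1))).eval (F.v (a 0) (a (m + 1))).1 -
      (F.f (a 0)).eval (F.v (a 0) (a (m + 1))).1 := by
    rw [critical, v_symm_fst, eval_sub]
  have h3 : ∑ e ∈ Finset.Ico 0 (m + 1), ((F.f (a e)).eval (F.v (a 0) (a (m + 1))).1 -
      (F.f (a (e + 1))).eval (F.v (a 0) (a (m + 1))).1) =
      (F.f (a 0)).eval (F.v (a 0) (a (m + 1))).1 -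
        (F.f (a (m + 1))).eval (F.v (a 0) (a (m + 1))).1 := by
    rw [← neg_sub_neg, ← this]
    exact Finset.sum_congr rfl fun e _ => (neg_sub_neg _ _).symm
  rw [h3, h2]
  simp only [critical]
  ring

variable {F} {G : Arrangement (Fin N)} {B : Bumps N} {ε : ℝ} (A : F.Adapted G B ε)

namespace Adapted

include A

theorem ln_eq (p : Fin N) (z : ℝ) : G.ln p z = F.t p * z + F.s p := by
  rw [ln, A.t_eq, A.s_eq]

/-- The integrand is the derivative of `-q`, and `q` vanishes at the lower limit, its critical
point. -/
theorem integral_ln (a : ℕ → Fin N) (e : ℕ) (X : ℝ) :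
    ∫ z in (G.vx a e)..X, (G.ln (a (e + 1)) z - G.ln (a e) z) =
      -(F.q (a e) (a (e + 1))).eval X := by
  have hd : ∀ z, HasDerivAt (fun z => -(F.q (a e) (a (e + 1))).eval z)
      (G.ln (a (e + 1)) z - G.ln (a e) z) z := by
    intro z
    have := ((F.q (a e) (a (e + 1))).hasDerivAt z).neg
    rw [F.eval_derivative_q] at this
    convert! this using 1
    rw [A.ln_eq, A.ln_eq]
    ring
  rw [intervalIntegral.integral_eq_sub_of_hasDerivAt fun z _ => hd z, A.vx_eq, eval_q_critical]
  · ring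
  · refine Continuous.intervalIntegrable ?_ _ _
    unfold ln
    fun_prop

/-- With the closing vertex rightmost, the other vertices bound a region open to the right. The
integrals of its slices, evaluated at that vertex, add up to minus the exponent there. -/
theorem volume_convexHull_of_le {a : ℕ → Fin N} {m : ℕ} (hm : 1 ≤ m)
    (hp : Function.Periodic a (m + 2)) (ha : Set.InjOn a (Set.Icc 0 (m + 1)))
    (h : G.IsPolygon a) (hmax : ∀ e, G.vx a e ≤ G.vx a (m + 1)) :
    volume.real (convexHull ℝ (G.vertex a '' Set.Iic (m + 1))) =
      ∑ e ∈ Finset.range (m + 2), F.critical (a e) (a (e + 1)) := by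
  have h0 : a (m + 1 + 1) = a 0 := by simpa using hp 0
  have hU : G.IsUpper a (m + 1) := (h.isUpper_or_isLower hm hp ha _).resolve_right fun h1 =>
    absurd (h.lt_of_isLower hm hp ha h1) (not_lt.2 (hmax _))
  have hD : G.IsLower a (m + 1 + 1) := (h.isUpper_or_isLower hm hp ha _).resolve_left fun h1 =>
    absurd (h.lt_of_isUpper hm hp ha h1) (not_lt.2 (hmax _))
  have ht := h.t_lt_of_isUpper_of_isLower hm hp ha hU hD
  rw [h0] at ht
  have hD0 : G.IsLower a 0 := by
    simp only [Arrangement.IsLower, h0] at hD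
    exact hD
  obtain ⟨j, hj⟩ := h.openRight hm hp ha hU hD0
  rw [hj.volume_convexHull hm hp ha ht, ← neg_eq_iff_eq_neg.2 (F.expo_critical a hp), expo,
    ← Finset.sum_neg_distrib]
  refine Finset.sum_congr rfl fun e _ => ?_
  rw [A.integral_ln, A.vx_eq, h0, v_symm_fst]

end Adapted

end LineConfig

/-- The periodic extension of a finite sequence. -/
def extend {ι : Type*} {k : ℕ} (a : Fin (k + 1) → ι) (l : ℕ) : ι := a (Fin.ofNat (k + 1) l)

/-! ### Cyclic sequences, and the area of an arbitrary polygon. -/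

section Extend

variable {ι : Type*} {k : ℕ} (a : Fin (k + 1) → ι)

theorem ofNat_succ (l : ℕ) : Fin.ofNat (k + 1) (l + 1) = Fin.ofNat (k + 1) l + 1 := by
  ext
  simp [Fin.val_add]

theorem extend_val (i : Fin (k + 1)) : extend a i = a i := by
  rw [extend]
  congr 1
  ext
  simp

theorem extend_val_succ (i : Fin (k + 1)) : extend a (i + 1) = a (i + 1) := by
  rw [extend, ofNat_succ]
  congr 2
  ext
  simp

theorem extend_periodic : Function.Periodic (extend a) (k + 1) := by
  intro l
  rw [extend, extend]
  congr 1
  ext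
  simp

theorem extend_injOn (ha : Function.Injective a) : Set.InjOn (extend a) (Set.Icc 0 k) := by
  intro l hl l' hl' h
  have h1 := congrArg Fin.val (ha h)
  simp only [Set.mem_Icc] at hl hl'
  simpa [Nat.mod_eq_of_lt (show l < k + 1 by omega), Nat.mod_eq_of_lt (show l' < k + 1 by omega)]
    using h1

end Extend

namespace LineConfig

open MeasureTheory Arrangement

variable {N : ℕ} {F : LineConfig N} {G : Arrangement (Fin N)} {B : Bumps N} {ε : ℝ}
  (A : F.Adapted G B ε) {m : ℕ} {a : Fin (m + 1 + 1) → Fin N}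

namespace Adapted

include A

theorem vertices_ofNat (a : Fin (m + 1 + 1) → Fin N) (l : ℕ) :
    F.vertices a (Fin.ofNat (m + 1 + 1) l) = G.vertex (extend a) l := by
  rw [vertices, ← ofNat_succ]
  change F.v (extend a l) (extend a (l + 1)) = _
  refine Prod.ext (A.vx_eq l).symm ?_
  change _ = G.ln (extend a l) _
  rw [A.ln_eq, A.vx_eq]
  rfl

theorem vertices_eq (a : Fin (m + 1 + 1) → Fin N) (i : Fin (m + 1 + 1)) :
    F.vertices a i = G.vertex (extend a) i := by
  rw [← A.vertices_ofNat]
  congr 1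
  ext
  simp

-- Both ends of the side lie on the line `a (l + 1)`, so the cross product is the horizontal length
-- of the side times the height over this line.
omit A in
theorem cross_vertex {a : ℕ → Fin N} {l e : ℕ} (h : a l ≠ a (l + 1)) :
    cross (G.vertex a l) (G.vertex a (l + 1)) (G.vertex a e) =
      (G.vx a (l + 1) - G.vx a l) * (G.ln (a e) (G.vx a e) - G.ln (a (l + 1)) (G.vx a e)) := by
  simp only [cross, vertex]
  rw [← ln_vx h]
  simp only [ln]
  ring

/-- Only the condition on the sides carries information; distinctness and non-collinearity of the
vertices follow from general position. -/
theorem isClockwiseConvexPolygon_iff (hm : 1 ≤ m) (ha : Function.Injective a) :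
    IsClockwiseConvexPolygon (F.vertices a) ↔ G.IsPolygon (extend a) := by
  have hp := extend_periodic a
  have hi := extend_injOn a ha
  have hne := ne_succ hp hi
  constructor
  · intro h l e
    rw [← cross_vertex (hne l), ← A.vertices_ofNat, ← A.vertices_ofNat, ← A.vertices_ofNat,
      ofNat_succ]
    exact h.right_of_edge _ _
  · intro h
    refine ⟨fun i j hij => ?_, fun i j => ?_, 0, 1, 2, ?_⟩
    · rw [A.vertices_eq, A.vertices_eq] at hij
      have h1 := congrArg Prod.fst hij
      have h2 := congrArg Prod.snd hij
      exact Fin.ext (vertex_injective hm hp hi (by omega) (by omega) h1 h2)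
    · have h1 := h i j
      rw [← cross_vertex (hne _), ← A.vertices_eq, ← A.vertices_eq, ← A.vertices_ofNat,
        ofNat_succ] at h1
      convert! h1 using 3
      ext
      simp
    · have e0 : (0 : Fin (m + 1 + 1)) = Fin.ofNat _ 0 := rfl
      have e1 : (1 : Fin (m + 1 + 1)) = Fin.ofNat _ (0 + 1) := rfl
      have e2 : (2 : Fin (m + 1 + 1)) = Fin.ofNat _ 2 := rfl
      rw [e0, e1, e2, A.vertices_ofNat, A.vertices_ofNat, A.vertices_ofNat, cross_vertex (hne 0)]
      exact mul_ne_zero (sub_ne_zero.2 (vx_ne_succ hm hp hi 0).symm)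
        (sub_ne_zero.2 (ln_succ_ne hm hp hi 1))

theorem range_vertices (a : Fin (m + 1 + 1) → Fin N) :
    Set.range (F.vertices a) = G.vertex (extend a) '' Set.Iic (m + 1) := by
  ext p
  constructor
  · rintro ⟨i, rfl⟩
    exact ⟨i, by simp only [Set.mem_Iic]; omega, (A.vertices_eq a i).symm⟩
  · rintro ⟨l, -, rfl⟩
    exact ⟨_, A.vertices_ofNat a l⟩

theorem area_eq (hm : 1 ≤ m) (ha : Function.Injective a)
    (h : IsClockwiseConvexPolygon (F.vertices a)) :
    area (F.vertices a) = ∑ i, F.critical (a i) (a (i + 1)) := by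
  obtain ⟨r, hr⟩ := Finite.exists_max fun i => (F.vertices a i).1
  -- The shift makes the rightmost vertex `r` of the polygon its closing vertex, of index `m + 1`;
  -- area and sum of critical values are invariant under it.
  let b : Fin (m + 1 + 1) → Fin N := fun i => a (i + (r + 1))
  have hb : Function.Injective b := fun i j hij => add_right_cancel (ha hij)
  have hvb : ∀ i, F.vertices b i = F.vertices a (i + (r + 1)) := by
    intro i
    simp only [vertices, b]
    exact congrArg _ (congrArg a (add_right_comm _ _ _))
  have hpb : IsClockwiseConvexPolygon (F.vertices b) := by
    refine ⟨fun i j hij => ?_, fun i j => ?_, ?_⟩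
    · rw [hvb, hvb] at hij
      exact add_right_cancel (h.injective hij)
    · rw [hvb, hvb, hvb]
      rw [add_right_comm i 1]
      exact h.right_of_edge (i + (r + 1)) (j + (r + 1))
    · obtain ⟨i, j, l, hl⟩ := h.not_collinear
      exact ⟨i - (r + 1), j - (r + 1), l - (r + 1), by simpa only [hvb, sub_add_cancel] using hl⟩
  have hrange : Set.range (F.vertices b) = Set.range (F.vertices a) := by
    rw [funext hvb]
    exact (Equiv.addRight (r + 1)).surjective.range_comp (F.vertices a)
  have hmax : ∀ e, G.vx (extend b) e ≤ G.vx (extend b) (m + 1) := by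
    intro e
    have h1 := congrArg Prod.fst (A.vertices_ofNat b e)
    have h2 := congrArg Prod.fst (A.vertices_ofNat b (m + 1))
    rw [hvb] at h1 h2
    change _ = G.vx (extend b) e at h1
    change _ = G.vx (extend b) (m + 1) at h2
    rw [← h1, ← h2]
    convert! hr _ using 3
    have : Fin.ofNat (m + 1 + 1) (m + 1) = Fin.last (m + 1) := by
      ext
      simp
    rw [this, add_comm r, ← add_assoc, Fin.last_add_one, zero_add]
  have key := A.volume_convexHull_of_le hm (extend_periodic b) (extend_injOn b hb)
    ((A.isClockwiseConvexPolygon_iff hm hb).1 hpb) hmax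
  rw [← A.range_vertices, hrange] at key
  rw [area, key, ← Fin.sum_univ_eq_sum_range (fun e => F.critical (extend b e) (extend b (e + 1))),
    ← Equiv.sum_comp (Equiv.addRight (r + 1)) fun i => F.critical (a i) (a (i + 1))]
  refine Finset.sum_congr rfl fun i _ => ?_
  rw [extend_val, extend_val_succ]
  simp only [b, Equiv.coe_addRight]
  exact congrArg _ (congrArg a (add_right_comm _ _ _))

end Adapted

end LineConfig

/-! ### Basis vectors and the products evaluated on them. -/

variable {Obj : Type*} {δ : Obj → Obj → ℤ}

/-- The basis vector of the one-dimensional morphism space. -/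
noncomputable def lineBasis (δ : Obj → Obj → ℤ) (a b : Obj) : lineHom δ a b (δ a b) :=
  toLine δ a b (δ a b) 1

theorem coe_lineBasis (a b : Obj) : (lineBasis δ a b : ℝ) = 1 := by
  rw [lineBasis, coe_toLine, if_pos rfl]

theorem toLine_eq_smul (a b : Obj) (x : ℝ) : toLine δ a b (δ a b) x = x • lineBasis δ a b := by
  rw [lineBasis, ← map_smul, smul_eq_mul, mul_one]

theorem existsUnique_smul_lineBasis (a b : Obj) (x : lineHom δ a b (δ a b)) :
    ∃! c : ℝ, x = c • lineBasis δ a b := by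
  refine ⟨x, Subtype.ext ?_, fun c hc => ?_⟩
  · rw [Submodule.coe_smul, coe_lineBasis, smul_eq_mul, mul_one]
  · have h := congrArg Subtype.val hc
    rw [Submodule.coe_smul, coe_lineBasis, smul_eq_mul, mul_one] at h
    exact h.symm

theorem coef_chainOf {k : ℕ} (a : Fin (k + 1) → Obj) : coef (chainOf (lineBasis δ) a) = 1 := by
  induction k with
  | zero => rfl
  | succ k ih =>
    have h : coef (chainOf (lineBasis δ) a) =
      (lineBasis δ (a 0) (a 1) : ℝ) * coef (chainOf (lineBasis δ) (Fin.tail a)) := rfl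
    rw [h, ih, coe_lineBasis, one_mul]

theorem objs_chainOf {k : ℕ} (a : Fin (k + 1) → Obj) :
    (chainOf (lineBasis δ) a).objs = List.ofFn (Fin.tail a) := by
  induction k with
  | zero => rfl
  | succ k ih =>
    have h : (chainOf (lineBasis δ) a).objs =
      a 1 :: (chainOf (lineBasis δ) (Fin.tail a)).objs := rfl
    rw [h, ih, List.ofFn_succ]
    rfl

theorem word_extend {k : ℕ} (a : Fin (k + 1) → Obj) :
    word (extend a) 0 k = List.ofFn (Fin.tail a) := by
  refine List.ext_getElem (by simp [word]) fun i h1 h2 => ?_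
  have hi : i < k := by simpa using h2
  simp only [word, List.getElem_map, List.getElem_range', List.getElem_ofFn, Fin.tail]
  have := extend_val a (Fin.succ ⟨i, hi⟩)
  rw [← this]
  congr 1
  simp
  omega

namespace LineConfig

variable {N : ℕ} {F : LineConfig N} {G : Arrangement (Fin N)} {B : Bumps N} {ε : ℝ}

theorem minimal_m_chainOf (B : Bumps N) {m : ℕ} (a : Fin (m + 1 + 1) → Fin N) (r : ℤ) :
    (F.minimal B).m (chainOf (lineBasis F.deg) a) r =
      toLine F.deg (a 0) (a (Fin.last (m + 1))) r
        ((-1 : ℝ) ^ (chainOf (lineBasis F.deg) a).suspSign *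
          (F.transferData B).muW (extend a) 0 m) := by
  have h : (F.transferData B).muW (extend a) 0 m =
      coef (chainOf (lineBasis F.deg) a) *
        (F.transferData B).mu (a 0) (chainOf (lineBasis F.deg) a).objs := by
    rw [coef_chainOf, one_mul, objs_chainOf, ← word_extend]
    rfl
  rw [h]
  rfl

theorem Adapted.area_eq_neg_expo (A : F.Adapted G B ε) {m : ℕ} {a : Fin (m + 1 + 1) → Fin N}
    (hm : 1 ≤ m) (ha : Function.Injective a) (h : IsClockwiseConvexPolygon (F.vertices a)) :
    F.expo (extend a) 0 m (F.v (extend a 0) (extend a (m + 1))).1 = -area (F.vertices a) := by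
  rw [A.area_eq hm ha h, F.expo_critical _ (extend_periodic a),
    ← Fin.sum_univ_eq_sum_range (fun e => F.critical (extend a e) (extend a (e + 1)))]
  congr 1
  refine Finset.sum_congr rfl fun i _ => ?_
  rw [extend_val, extend_val_succ]

theorem Adapted.muW_extend (A : F.Adapted G B ε) {m : ℕ} {a : Fin (m + 1 + 1) → Fin N}
    (hm : 1 ≤ m) (ha : Function.Injective a) :
    (IsClockwiseConvexPolygon (F.vertices a) → ∃ T, IsSign T ∧
      (F.transferData B).muW (extend a) 0 m = T * Real.exp (-area (F.vertices a))) ∧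
    (¬ IsClockwiseConvexPolygon (F.vertices a) →
      (F.transferData B).muW (extend a) 0 m = 0) := by
  have hi := extend_injOn a ha
  have hp := extend_periodic a
  have key : ∃ T, (F.transferData B).muW (extend a) 0 m =
      T * Real.exp (F.expo (extend a) 0 m (F.v (extend a 0) (extend a (m + 1))).1) ∧
      (G.IsPolygon (extend a) → IsSign T) ∧ (¬ G.IsPolygon (extend a) → T = 0) := by
    rcases lt_trichotomy (G.t (extend a 0)) (G.t (extend a (m + 1))) with h | h | h
    · exact A.muW_of_lt hm hi hp h
    · have h1 := hi (show 0 ∈ Set.Icc 0 (m + 1) by simp) (show m + 1 ∈ Set.Icc 0 (m + 1) by simp)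
        (not_not.1 fun hne => G.t_ne _ _ hne h)
      omega
    · obtain ⟨m, rfl⟩ : ∃ m', m = m' + 1 := ⟨m - 1, by omega⟩
      exact A.muW_of_gt hi hp h
  obtain ⟨T, hT, h1, h2⟩ := key
  rw [← A.isClockwiseConvexPolygon_iff hm ha] at h1 h2
  refine ⟨fun h => ⟨T, h1 h, ?_⟩, fun h => ?_⟩
  · rw [hT, A.area_eq_neg_expo hm ha h]
  · rw [hT, h2 h, zero_mul]

end LineConfig

end FukayaLines

theorem mainTheorem1 (N : ℕ) (hN : 2 ≤ N) (F : FukayaLines.LineConfig N) :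
    ∃ (C : FukayaLines.AInfCategory.{0, 0} (Fin N)) (e : ∀ a b, C.Hom a b (F.deg a b)),
      -- (i) the morphism spaces
      (∀ a b, a ≠ b →
        (∀ x : C.Hom a b (F.deg a b), ∃! c : ℝ, x = c • e a b) ∧
        (∀ n : ℤ, n ≠ F.deg a b → ∀ x : C.Hom a b n, x = 0)) ∧
      -- (ii) the differential and the transversal products
      (∀ a b, a ≠ b → ∀ (n : ℤ) (x : C.Hom a b n), C.diff x = 0) ∧
      (∀ (k : ℕ), 2 ≤ k → ∀ a : Fin (k + 1) → Fin N, Function.Injective a →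
        (FukayaLines.IsClockwiseConvexPolygon (F.vertices a) →
          ∃ ε : ℝ, (ε = 1 ∨ ε = -1) ∧
            C.m (FukayaLines.chainOf e a) (F.deg (a 0) (a (Fin.last k))) =
              (ε * Real.exp (-FukayaLines.area (F.vertices a))) • e (a 0) (a (Fin.last k))) ∧
        (¬ FukayaLines.IsClockwiseConvexPolygon (F.vertices a) →
          ∀ r : ℤ, C.m (FukayaLines.chainOf e a) r = 0)) ∧
      -- (iii) the homotopy equivalence
      (∃ G : FukayaLines.AInfFunctor C (FukayaLines.deRham F),
        G.obj = id ∧ G.IsHomotopyEquivalence) := by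
  open FukayaLines in
  obtain ⟨G, B, ε, A⟩ := F.exists_adapted
  refine ⟨F.minimal B, lineBasis F.deg, fun a b _ => ⟨existsUnique_smul_lineBasis a b,
    fun n hn x => ?_⟩, fun a b _ n x => F.minimal_diff B x, fun k hk a ha => ?_,
    F.functor B, rfl, F.functor_isHomotopyEquivalence B⟩
  · exact Subtype.ext (not_not.1 fun h => hn (eq_of_coe_ne_zero h))
  -- `muW (extend a) 0 m` involves the letters `a 0, …, a (m + 1)`, that is, `m + 1` inputs.
  · obtain ⟨m, rfl⟩ : ∃ m, k = m + 1 := ⟨k - 1, by omega⟩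
    obtain ⟨h1, h2⟩ := A.muW_extend (by omega) ha
    refine ⟨fun h => ?_, fun h r => ?_⟩
    · obtain ⟨T, hT, hmu⟩ := h1 h
      -- The sign is that of the suspended product times the suspension sign.
      refine ⟨_, (isSign_zpow (chainOf (lineBasis F.deg) a).suspSign).mul hT, ?_⟩
      refine (LineConfig.minimal_m_chainOf B a _).trans ?_
      rw [hmu, toLine_eq_smul, mul_assoc]
      rfl
    · refine (LineConfig.minimal_m_chainOf B a r).trans ?_
      rw [h2 h, mul_zero, map_zero]
      rfl
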